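/- Let $d\ge 2$ and let $L:\mathbb{T}^d\to\mathbb{T}^d$ be the automorphism of the torus $\mathbb{T}^d=\mathbb{R}^d/\mathbb{Z}^d$ induced by a matrix $A\in GL(d,\mathbb{Z})$ whose characteristic polynomial is irreducible over $\mathbb{Q}$, which is diagonalizable over $\mathbb{R}$, and whose eigenvalues satisfy $|\beta_1|<\dots<|\beta_d|$ with $|\beta_i|\ne 1$ for all $i$. Let $v_i$ be an eigenvector for $\beta_i$. Then there is $\delta>0$ such that the following holds for every $0<\alpha<1$ and every $C^{1+\alpha}$ diffeomorphism $f$ of $\mathbb{T}^d$ that is $\delta$-close to $L$ in the $C^1$ sense (that is, some lift $F$ of $f$ to $\mathbb{R}^d$ satisfies $\|F(x)-Ax\|<\delta$ and $\|DF(x)-A\|<\delta$ for all $x$). 1. There is exactly one splitting $T\mathbb{T}^d=E_1^f\oplus\dots\oplus E_d^f$ into continuous $Df$-invariant line bundles which is dominated in this order: for some $C>0$, $0<\rho<1$, all $i<j$, $n\ge 0$, $x\in\mathbb{T}^d$, $v\in E_i^f(x)$ and $w\in E_j^f(x)$ one has $\|Df^n(x)v\|\,\|w\|\le C\rho^n\|Df^n(x)w\|\,\|v\|$.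 For $|\beta_m|>1$ let $W_m^{u,f}(p)$ be the leaf through $p$ tangent to $E_m^f$, that is, the set of points that can be joined to $p$ by a $C^1$ curve tangent to $E_m^f$, and let $W_m^{u,L}(p)=p+\mathbb{R}v_m$. 2. Suppose that every point of $\mathbb{T}^d$ is Lyapunov regular for $f$ (the tangent space at the point is a direct sum of subspaces $O_j$ such that $\frac1n\log\|Df^n v\|$ converges, both for $n\to+\infty$ and for $n\to-\infty$, to the same number $\chi_j$ for all $0\neq v\in O_j$, where the $\chi_j$ are distinct), or that $f$ has constant periodic data ($Df^\tau(p)$ and $Df^\tau(q)$ are conjugate whenever $f^\tau(p)=p$ and $f^\tau(q)=q$). Let $h$ be a homeomorphism of $\mathbb{T}^d$ with $h\circ L=f\circ h$. If $h(W_m^{u,L}(p))=W_m^{u,f}(h(p))$ for every $p\in\mathbb{T}^d$ and every $m$ with $|\beta_m|>1$, then there is $\varepsilon\in(0,1)$ such that for every $m$ with $|\beta_m|>1$ the restriction of $h$ to each leaf of $W_m^{u,L}$ is a $C^{1+\varepsilon}$ diffeomorphism onto a leaf of $W_m^{u,f}$, uniformly in the leaf: $t\mapsto h(p+tv_m)$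 is differentiable with nowhere vanishing derivative, and the derivative is $\varepsilon$-Hölder continuous with a constant independent of $p$. -/

import Mathlib

/-- The Euclidean space `ℝ^d`, the universal cover of the torus and the model of all its tangent
spaces. -/
abbrev RSpace (d : ℕ) : Type := EuclideanSpace ℝ (Fin d)

/-- The torus `𝕋^d = ℝ^d / ℤ^d`. -/
abbrev Torus (d : ℕ) : Type := UnitAddTorus (Fin d)

/-- The covering projection `ℝ^d → 𝕋^d`. -/
def torusProj {d : ℕ} (x : RSpace d) : Torus d := fun i => ((x i : ℝ) : UnitAddCircle)

/-- The linear map of `ℝ^d` given by an integer matrix. -/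
noncomputable def linLift {d : ℕ} (A : Matrix (Fin d) (Fin d) ℤ) : RSpace d →L[ℝ] RSpace d :=
  Matrix.toEuclideanCLM (n := Fin d) (𝕜 := ℝ) (A.map (Int.cast : ℤ → ℝ))

/-- The endomorphism of `𝕋^d` induced by an integer matrix (an automorphism if `det A = ±1`). -/
noncomputable def toralMap {d : ℕ} (A : Matrix (Fin d) (Fin d) ℤ) (p : Torus d) : Torus d :=
  fun i => ∑ j, A i j • p j

/-- `F : ℝ^d → ℝ^d` is a lift of `f : 𝕋^d → 𝕋^d`. -/
def IsTorusLift {d : ℕ} (F : RSpace d → RSpace d) (f : Torus d → Torus d) : Prop :=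
  ∀ x, f (torusProj x) = torusProj (F x)

/-- `F` is of class `C^{1+α}`: continuously differentiable, with `α`-Hölder derivative. -/
def IsC1Holder {d : ℕ} (α : ℝ) (F : RSpace d → RSpace d) : Prop :=
  ContDiff ℝ 1 F ∧ ∃ C : ℝ, ∀ x y, ‖fderiv ℝ F x - fderiv ℝ F y‖ ≤ C * ‖x - y‖ ^ α

/-- `F` is `δ`-close to the linear map of `A` in the `C¹` sense, uniformly on `ℝ^d`. -/
def IsC1Close {d : ℕ} (δ : ℝ) (A : Matrix (Fin d) (Fin d) ℤ) (F : RSpace d → RSpace d) : Prop :=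
  ∀ x, ‖F x - linLift A x‖ < δ ∧ ‖fderiv ℝ F x - linLift A‖ < δ

/-- A field of lines on the torus is continuous: it is locally spanned by a continuous
vector field. -/
def IsContinuousLineField {d : ℕ} (E : Torus d → Submodule ℝ (RSpace d)) : Prop :=
  ∀ p, ∃ U ∈ nhds p, ∃ w : Torus d → RSpace d,
    ContinuousOn w U ∧ ∀ q ∈ U, w q ≠ 0 ∧ E q = Submodule.span ℝ {w q}

/-- `E 0, …, E (d-1)` is a dominated splitting of the tangent bundle of `𝕋^d` into `d` continuous
line bundles invariant under the derivative of the torus diffeomorphism with lift `F`, numbered by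
increasing strength of expansion. -/
structure IsDominatedLineSplitting {d : ℕ} (F : RSpace d → RSpace d)
    (E : Fin d → Torus d → Submodule ℝ (RSpace d)) : Prop where
  continuous : ∀ i, IsContinuousLineField (E i)
  internal : ∀ p, DirectSum.IsInternal (fun i => E i p)
  invariant : ∀ i x, (E i (torusProj x)).map (fderiv ℝ F x).toLinearMap = E i (torusProj (F x))
  dominated : ∃ C ρ : ℝ, 0 < C ∧ 0 < ρ ∧ ρ < 1 ∧ ∀ i j, i < j → ∀ (x : RSpace d) (n : ℕ),
    ∀ v ∈ E i (torusProj x), ∀ w ∈ E j (torusProj x),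
      ‖fderiv ℝ F^[n] x v‖ * ‖w‖ ≤ C * ρ ^ n * (‖fderiv ℝ F^[n] x w‖ * ‖v‖)

/-- The leaf through `p` of the foliation tangent to the line field `E`: the set of all points
that can be joined to `p` by a `C¹` curve tangent to `E`. Curves in the torus are given by their
lifts to `ℝ^d`. -/
def tangentLeaf {d : ℕ} (E : Torus d → Submodule ℝ (RSpace d)) (p : Torus d) : Set (Torus d) :=
  {q | ∃ γ : ℝ → RSpace d, ContDiff ℝ 1 γ ∧ (∀ t, deriv γ t ∈ E (torusProj (γ t))) ∧
    torusProj (γ 0) = p ∧ torusProj (γ 1) = q}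

/-- The point below `x` is (Lyapunov) regular: the tangent space splits into subspaces `O j` such
that every nonzero `v ∈ O j` has Lyapunov exponent `χ j`, that is,
`(1/n) log ‖Df^n(x) v‖ → χ j` both as `n → +∞` and as `n → -∞`. -/
def IsLyapunovRegular {d : ℕ} (F : RSpace d ≃ₜ RSpace d) (x : RSpace d) : Prop :=
  ∃ (r : ℕ) (O : Fin r → Submodule ℝ (RSpace d)) (χ : Fin r → ℝ),
    StrictMono χ ∧ (∀ j, O j ≠ ⊥) ∧ DirectSum.IsInternal O ∧
    ∀ j, ∀ v ∈ O j, v ≠ 0 →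
      Filter.Tendsto (fun n : ℕ => (1 / (n : ℝ)) * Real.log ‖fderiv ℝ (⇑F)^[n] x v‖)
        Filter.atTop (nhds (χ j)) ∧
      Filter.Tendsto (fun n : ℕ => (1 / (-(n : ℝ))) * Real.log ‖fderiv ℝ (⇑F.symm)^[n] x v‖)
        Filter.atTop (nhds (χ j))

/-- Constant periodic data: `Df^τ(p)` and `Df^τ(q)` are linearly conjugate whenever
`f^τ(p) = p` and `f^τ(q) = q`. -/
def HasConstantPeriodicData {d : ℕ} (f : Torus d → Torus d) (F : RSpace d → RSpace d) : Prop :=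
  ∀ (τ : ℕ) (x y : RSpace d),
    f^[τ] (torusProj x) = torusProj x → f^[τ] (torusProj y) = torusProj y →
    ∃ P : RSpace d ≃ₗ[ℝ] RSpace d, ∀ v, P (fderiv ℝ F^[τ] x v) = fderiv ℝ F^[τ] y (P v)

/-- `h` is a `C^{1+ε}` diffeomorphism along the lines of direction `v`, uniformly: for every `x`
the curve `t ↦ h (x + t v)` in the torus, seen through a lift `γ` to `ℝ^d`, is differentiable,
its derivative is `ε`-Hölder with a constant independent of `x`, and it has no zeros (so that the
inverse of `h` is `C^{1+ε}` along the image curve as well). -/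
def IsC1HolderAlong {d : ℕ} (ε : ℝ) (h : Torus d → Torus d) (v : RSpace d) : Prop :=
  ∃ C : ℝ, ∀ x : RSpace d, ∃ γ γ' : ℝ → RSpace d,
    (∀ t, torusProj (γ t) = h (torusProj (x + t • v))) ∧
    (∀ t, HasDerivAt γ (γ' t) t) ∧ (∀ t, γ' t ≠ 0) ∧
    ∀ s t, ‖γ' s - γ' t‖ ≤ C * |s - t| ^ ε

/-! Existence of the splitting. In the eigenbasis `v` the derivative of `F` is uniformly close to
`diag β`. A graph transform that pushes the coordinates weaker than `m` forward and pulls the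
stronger ones back contracts the sections of a cone around the `m`-th axis; its fixed point `W m` is
an invariant, periodic, Hölder line field with multiplier `c m` (`exists_invariantFrame`).
Uniqueness compares growth rates: domination in forward time places the `k`-th line of one splitting
in the `k`-th flag of the other, backward time places it in the opposite flag, and the two flags
meet in a line (`IsDominatedBasis.repr_eq_zero`).

Rigidity, first half: the Birkhoff sums of `log |c m|` stay within a fixed `K` of `n * lam`. On
periodic orbits they equal `n * lam`, where `lam` is read off at the fixed point `H 0`. Under
constant periodic data this compares eigenvalues of conjugate matrices. Under regularity one takes a
point whose orbit accompanies the given periodic orbit in the future and the fixed point in the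
past; its forward exponents are those of the first, its backward exponents those of the second, and
regularity identifies them. The linear closing lemma and the exponential shadowing of bounded orbit
segments carry the estimate to all points. No transfer function is constructed.

Rigidity, second half: a lift `H` of `h` is at bounded distance from a linear map, and on a line of
direction `v m` its `m`-th coordinate is strictly monotone (`strictMono_coord`). Iterating `F` and
rescaling by `β m ^ n` turns this coarse linearity into exact information: `lam = log |β m|`, and
`H` is bi-Lipschitz along the lines. Hence `H` is differentiable along a line at some point `x₀`.
Blowing up at `x₀` and pushing forward by the dynamics, with Hölder control of distortion, bounds
the oscillation of the logarithmic difference quotients on a whole line in the limit. Irreducibility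
makes that line dense in the torus, so the bound holds everywhere
(`IsLeafMap.abs_log_leafQuotient_sub_log_le`), and it is a Hölder estimate for the logarithm of the
derivative. -/

/-! ### Invariant line fields of a nearly diagonal cocycle -/

/-- A perturbation of size `κ` of `diag β` has, for every `m`, an invariant line field in the cone of
aperture `η` around the `m`-th axis, attracting with rate `q`. -/
structure SpectralGap {d : ℕ} (β : Fin d → ℝ) (κ η q : ℝ) : Prop where
  κ_nonneg : 0 ≤ κ
  η_nonneg : 0 ≤ η
  η_le_one : η ≤ 1
  q_pos : 0 < q
  q_lt_one : q < 1
  κ_lt : ∀ i, κ < |β i|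
  rate : ∀ i j, i < j → |β i| + 3 * κ ≤ q * (|β j| - κ)
  cone : ∀ i j, i < j → (|β i| + κ) * η + κ ≤ η * (|β j| - κ)

/-- `w` takes values in the affine cone of aperture `η` around the `m`-th axis. -/
def IsLineSection {X : Type*} {d : ℕ} (m : Fin d) (η : ℝ) (w : X → Fin d → ℝ) : Prop :=
  ∀ x, w x m = 1 ∧ ∀ i, i ≠ m → |w x i| ≤ η

/-- The graph transform whose fixed points are the invariant line fields near the `m`-th axis. -/
noncomputable def lineStep {X : Type*} {d : ℕ} (β : Fin d → ℝ) (m : Fin d)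
    (M : X → (Fin d → ℝ) →ₗ[ℝ] (Fin d → ℝ)) (F : X ≃ X) (w : X → Fin d → ℝ) : X → Fin d → ℝ :=
  fun x i =>
    if i < m then M (F.symm x) (w (F.symm x)) i / M (F.symm x) (w (F.symm x)) m
    else if i = m then 1
    else (M x (w x) m * w (F x) i - (M x (w x) i - β i * w x i)) / β i

section LineField

variable {X : Type*} {d : ℕ} {β : Fin d → ℝ} {κ η q : ℝ} {m : Fin d}

lemma norm_le_one_of_line {u : Fin d → ℝ} (hη : η ≤ 1) (hm : u m = 1)
    (hu : ∀ i, i ≠ m → |u i| ≤ η) : ‖u‖ ≤ 1 := by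
  refine (pi_norm_le_iff_of_nonneg zero_le_one).2 fun i => ?_
  by_cases h : i = m
  · subst h; simp [hm]
  · exact (hu i h).trans hη

lemma abs_eval_le_of_close {L : (Fin d → ℝ) →ₗ[ℝ] (Fin d → ℝ)}
    (hL : ∀ u i, |L u i - β i * u i| ≤ κ * ‖u‖) (u : Fin d → ℝ) (i : Fin d) :
    |L u i| ≤ |β i| * |u i| + κ * ‖u‖ := by
  have h := hL u i
  have h2 : |L u i| ≤ |L u i - β i * u i| + |β i * u i| := by
    simpa using abs_add_le (L u i - β i * u i) (β i * u i)
  rw [abs_mul] at h2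
  linarith

lemma le_abs_multiplier {L : (Fin d → ℝ) →ₗ[ℝ] (Fin d → ℝ)} (hκ : 0 ≤ κ)
    (hL : ∀ u i, |L u i - β i * u i| ≤ κ * ‖u‖) {u : Fin d → ℝ} (hm : u m = 1) (hu : ‖u‖ ≤ 1) :
    |β m| - κ ≤ |L u m| := by
  have h := hL u m
  rw [hm, mul_one] at h
  have h2 : |β m| ≤ |L u m - β m| + |L u m| := by
    have := abs_sub (L u m) (L u m - β m)
    simp only [sub_sub_cancel] at this
    linarith
  have : κ * ‖u‖ ≤ κ := mul_le_of_le_one_right hκ hu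
  linarith

/-- Forward half of the contraction. Since the subtracted ratio has modulus at most `1`, numerator
and denominator together change by at most `(|β i| + 2 * κ) * R + 2 * ε`, and the denominator is at
least `|β m| - κ`. The term `ε` allows two different linear maps: it is `0` for convergence and
periodicity, and positive for Hölder regularity. -/
lemma abs_ratio_sub_ratio_le (G : SpectralGap β κ η q) {L L' : (Fin d → ℝ) →ₗ[ℝ] (Fin d → ℝ)}
    (hL : ∀ u i, |L u i - β i * u i| ≤ κ * ‖u‖) (hL' : ∀ u i, |L' u i - β i * u i| ≤ κ * ‖u‖)
    {u u' : Fin d → ℝ} (hm : u m = 1) (hm' : u' m = 1) (hu : ‖u‖ ≤ 1) (hu' : ‖u'‖ ≤ 1)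
    {C R ε : ℝ} (hC : 2 ≤ C * (|β m| - κ)) (hR : ‖u - u'‖ ≤ R) (hε : ‖L u' - L' u'‖ ≤ ε)
    {i : Fin d} (hi : i < m) :
    |L u i / L u m - L' u' i / L' u' m| ≤ q * R + C * ε := by
  have hR0 : 0 ≤ R := (norm_nonneg _).trans hR
  have hε0 : 0 ≤ ε := (norm_nonneg _).trans hε
  have hκ := G.κ_nonneg
  have hb := le_abs_multiplier hκ hL hm hu
  have hb' := le_abs_multiplier hκ hL' hm' hu'
  have hpos : 0 < |β m| - κ := sub_pos.2 (G.κ_lt m)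
  have hsub : ∀ j, L u j - L' u' j = L (u - u') j + (L u' - L' u') j := fun j => by
    simp [map_sub]
  have hεj : ∀ j, |(L u' - L' u') j| ≤ ε := fun j => (norm_le_pi_norm _ j).trans hε
  have hκR : κ * ‖u - u'‖ ≤ κ * R := mul_le_mul_of_nonneg_left hR hκ
  have ha : |L u i - L' u' i| ≤ (|β i| + κ) * R + ε := by
    have h1 := abs_eval_le_of_close hL (u - u') i
    have h2 : |β i| * |(u - u') i| ≤ |β i| * R :=
      mul_le_mul_of_nonneg_left ((norm_le_pi_norm _ i).trans hR) (abs_nonneg _)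
    rw [hsub]
    refine (abs_add_le _ _).trans ?_
    linarith [hεj i]
  have hbb : |L u m - L' u' m| ≤ κ * R + ε := by
    have h1 := abs_eval_le_of_close hL (u - u') m
    simp only [Pi.sub_apply, hm, hm', sub_self, abs_zero, mul_zero, zero_add] at h1
    rw [hsub]
    refine (abs_add_le _ _).trans ?_
    linarith [hεj m]
  have ha' : |L' u' i| ≤ |L' u' m| := by
    have h1 := abs_eval_le_of_close hL' u' i
    have h2 : |β i| * |u' i| ≤ |β i| :=
      mul_le_of_le_one_right (abs_nonneg _) ((norm_le_pi_norm _ i).trans hu')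
    have h3 : κ * ‖u'‖ ≤ κ := mul_le_of_le_one_right hκ hu'
    have h4 := G.rate i m hi
    have h5 : q * (|β m| - κ) ≤ |β m| - κ := mul_le_of_le_one_left hpos.le G.q_lt_one.le
    linarith
  have hb0 : 0 < |L u m| := hpos.trans_le hb
  have hb0' : 0 < |L' u' m| := hpos.trans_le hb'
  have key : L u i / L u m - L' u' i / L' u' m
      = ((L u i - L' u' i) - (L' u' i / L' u' m) * (L u m - L' u' m)) / L u m := by
    have := abs_pos.1 hb0
    have := abs_pos.1 hb0'
    field_simp
    ring
  rw [key, abs_div, div_le_iff₀ hb0]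
  have hr : |L' u' i / L' u' m| ≤ 1 := by
    rw [abs_div]; exact div_le_one_of_le₀ ha' (abs_nonneg _)
  have h1 : |(L u i - L' u' i) - (L' u' i / L' u' m) * (L u m - L' u' m)|
      ≤ (|β i| + 2 * κ) * R + 2 * ε := by
    refine (abs_sub _ _).trans ?_
    rw [abs_mul]
    have := mul_le_mul hr hbb (abs_nonneg _) zero_le_one
    linarith
  have hC0 : 0 ≤ C := by
    by_contra h
    have := mul_neg_of_neg_of_pos (not_le.1 h) hpos
    linarith
  have h2 : (q * R + C * ε) * (|β m| - κ) ≤ (q * R + C * ε) * |L u m| :=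
    mul_le_mul_of_nonneg_left hb
      (add_nonneg (mul_nonneg G.q_pos.le hR0) (mul_nonneg hC0 hε0))
  have h3 := mul_le_mul_of_nonneg_right (G.rate i m hi) hR0
  have h4 := mul_le_mul_of_nonneg_right hC hε0
  have h5 : 0 ≤ κ * R := mul_nonneg hκ hR0
  nlinarith

/-- Backward half of the contraction. The multiplier varies by `κ * R`, the pulled back slope
contributes `(|β m| + κ) * R`, and the defect from the diagonal map another `κ * R`. Their sum is
the source of `3 * κ` in `SpectralGap.rate`. -/
lemma abs_pullback_sub_pullback_le (G : SpectralGap β κ η q)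
    {L L' : (Fin d → ℝ) →ₗ[ℝ] (Fin d → ℝ)}
    (hL : ∀ u i, |L u i - β i * u i| ≤ κ * ‖u‖) (hL' : ∀ u i, |L' u i - β i * u i| ≤ κ * ‖u‖)
    {u u' : Fin d → ℝ} (hm : u m = 1) (hm' : u' m = 1) (hu' : ‖u'‖ ≤ 1)
    {C R ε s s' : ℝ} {i : Fin d} (hC : 2 ≤ C * (|β i| - κ)) (hR : ‖u - u'‖ ≤ R)
    (hε : ‖L u' - L' u'‖ ≤ ε) (hs : |s| ≤ 1) (hss : |s - s'| ≤ R) (hi : m < i) :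
    |(L u m * s - (L u i - β i * u i)) / β i - (L' u' m * s' - (L' u' i - β i * u' i)) / β i|
      ≤ q * R + C * ε := by
  have hR0 : 0 ≤ R := (norm_nonneg _).trans hR
  have hε0 : 0 ≤ ε := (norm_nonneg _).trans hε
  have hκ := G.κ_nonneg
  have hβ : 0 < |β i| := hκ.trans_lt (G.κ_lt i)
  have hpos : 0 < |β i| - κ := sub_pos.2 (G.κ_lt i)
  have hεj : ∀ j, |(L u' - L' u') j| ≤ ε := fun j => (norm_le_pi_norm _ j).trans hε
  have hκR : κ * ‖u - u'‖ ≤ κ * R := mul_le_mul_of_nonneg_left hR hκ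
  have hsub : ∀ j, L u j - L' u' j = L (u - u') j + (L u' - L' u') j := fun j => by
    simp [map_sub]
  have hbb : |L u m - L' u' m| ≤ κ * R + ε := by
    have h1 := abs_eval_le_of_close hL (u - u') m
    simp only [Pi.sub_apply, hm, hm', sub_self, abs_zero, mul_zero, zero_add] at h1
    rw [hsub]
    refine (abs_add_le _ _).trans ?_
    linarith [hεj m]
  have haa : |(L u i - β i * u i) - (L' u' i - β i * u' i)| ≤ κ * R + ε := by
    have h1 := hL (u - u') i
    have h2 : (L u i - β i * u i) - (L' u' i - β i * u' i)
        = (L (u - u') i - β i * (u - u') i) + (L u' - L' u') i := by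
      simp [map_sub]; ring
    rw [h2]
    refine (abs_add_le _ _).trans ?_
    linarith [hεj i]
  have hb' : |L' u' m| ≤ |β m| + κ := by
    have h1 := abs_eval_le_of_close hL' u' m
    rw [hm', abs_one, mul_one] at h1
    have h3 : κ * ‖u'‖ ≤ κ := mul_le_of_le_one_right hκ hu'
    linarith
  rw [← sub_div, abs_div, div_le_iff₀ hβ]
  have h1 : L u m * s - (L u i - β i * u i) - (L' u' m * s' - (L' u' i - β i * u' i))
      = (L u m - L' u' m) * s + L' u' m * (s - s')
        - ((L u i - β i * u i) - (L' u' i - β i * u' i)) := by ring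
  rw [h1]
  have h2 : |(L u m - L' u' m) * s| ≤ κ * R + ε := by
    rw [abs_mul]
    exact (mul_le_of_le_one_right (abs_nonneg _) hs).trans hbb
  have h3 : |L' u' m * (s - s')| ≤ (|β m| + κ) * R := by
    rw [abs_mul]
    exact mul_le_mul hb' hss (abs_nonneg _) (by positivity)
  have h4 := abs_sub ((L u m - L' u' m) * s + L' u' m * (s - s'))
    ((L u i - β i * u i) - (L' u' i - β i * u' i))
  have h5 := abs_add_le ((L u m - L' u' m) * s) (L' u' m * (s - s'))
  have h6 := mul_le_mul_of_nonneg_right (G.rate m i hi) hR0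
  have h7 := mul_le_mul_of_nonneg_right hC hε0
  have hC0 : 0 ≤ C := by
    by_contra h
    have := mul_neg_of_neg_of_pos (not_le.1 h) hpos
    linarith
  have h8 : 0 ≤ C * ε * κ := by positivity
  have h9 : 0 ≤ q * R * κ := mul_nonneg (mul_nonneg G.q_pos.le hR0) hκ
  nlinarith

variable {M : X → (Fin d → ℝ) →ₗ[ℝ] (Fin d → ℝ)} {F : X ≃ X}

lemma IsLineSection.norm_le {w : X → Fin d → ℝ} (hw : IsLineSection m η w) (hη : η ≤ 1) (x : X) :
    ‖w x‖ ≤ 1 := norm_le_one_of_line hη (hw x).1 (hw x).2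

lemma IsLineSection.lineStep (G : SpectralGap β κ η q)
    (hM : ∀ x u i, |M x u i - β i * u i| ≤ κ * ‖u‖) {w : X → Fin d → ℝ}
    (hw : IsLineSection m η w) : IsLineSection m η (lineStep β m M F w) := by
  intro x
  refine ⟨by simp [_root_.lineStep], fun i hi => ?_⟩
  have hκ := G.κ_nonneg
  rcases lt_or_gt_of_ne hi with h | h
  · simp only [_root_.lineStep, h, if_true]
    set z := F.symm x
    have hn := hw.norm_le G.η_le_one z
    have h1 := le_abs_multiplier hκ (hM z) (hw z).1 hn
    have hpos : 0 < |β m| - κ := sub_pos.2 (G.κ_lt m)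
    rw [abs_div, div_le_iff₀ (hpos.trans_le h1)]
    have h2 := abs_eval_le_of_close (hM z) (w z) i
    have h3 := mul_le_mul_of_nonneg_left ((hw z).2 i hi) (abs_nonneg (β i))
    have h4 : κ * ‖w z‖ ≤ κ := mul_le_of_le_one_right hκ hn
    have h5 := G.cone i m h
    have h6 := mul_le_mul_of_nonneg_left h1 G.η_nonneg
    have h7 := mul_nonneg hκ G.η_nonneg
    nlinarith
  · have hβ : 0 < |β i| := hκ.trans_lt (G.κ_lt i)
    simp only [_root_.lineStep, not_lt_of_gt h, hi, if_false]
    have hn := hw.norm_le G.η_le_one x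
    rw [abs_div, div_le_iff₀ hβ]
    have h1 := hM x (w x) i
    have h2 := abs_eval_le_of_close (hM x) (w x) m
    rw [(hw x).1, abs_one, mul_one] at h2
    have h4 : κ * ‖w x‖ ≤ κ := mul_le_of_le_one_right hκ hn
    have h5 : |M x (w x) m * w (F x) i| ≤ (|β m| + κ) * η := by
      rw [abs_mul]
      exact mul_le_mul (by linarith) ((hw (F x)).2 i hi) (abs_nonneg _) (by positivity)
    have h6 := abs_sub (M x (w x) m * w (F x) i) (M x (w x) i - β i * w x i)
    have h7 := G.cone m i h
    have h8 := mul_nonneg hκ G.η_nonneg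
    nlinarith

/-- Mixing the two directions of time makes one map contract in all coordinates: a slope over the
`m`-th axis shrinks forward when it points to a weaker axis and backward when it points to a
stronger one. The value at `x` thus depends on the section at `F.symm x`, `x` and `F x`. -/
lemma norm_lineStep_sub_le (G : SpectralGap β κ η q)
    (hM : ∀ x u i, |M x u i - β i * u i| ≤ κ * ‖u‖) {w w' : X → Fin d → ℝ}
    (hw : IsLineSection m η w) (hw' : IsLineSection m η w') {C R ε : ℝ} {x x' : X}
    (hC : ∀ i, 2 ≤ C * (|β i| - κ))
    (h₁ : ‖w (F.symm x) - w' (F.symm x')‖ ≤ R) (h₂ : ‖w x - w' x'‖ ≤ R)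
    (h₃ : ‖w (F x) - w' (F x')‖ ≤ R)
    (e₁ : ∀ u, ‖u‖ ≤ 1 → ‖M (F.symm x) u - M (F.symm x') u‖ ≤ ε)
    (e₂ : ∀ u, ‖u‖ ≤ 1 → ‖M x u - M x' u‖ ≤ ε) :
    ‖lineStep β m M F w x - lineStep β m M F w' x'‖ ≤ q * R + C * ε := by
  have hR0 : 0 ≤ R := (norm_nonneg _).trans h₁
  have hε0 : 0 ≤ ε := (norm_nonneg _).trans (e₁ 0 (by simp))
  have hpos : 0 < |β m| - κ := sub_pos.2 (G.κ_lt m)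
  have hC0 : 0 ≤ C := by
    by_contra h
    have := mul_neg_of_neg_of_pos (not_le.1 h) hpos
    linarith [hC m]
  have hnn : 0 ≤ q * R + C * ε := add_nonneg (mul_nonneg G.q_pos.le hR0) (mul_nonneg hC0 hε0)
  refine (pi_norm_le_iff_of_nonneg hnn).2 fun i => ?_
  rw [Pi.sub_apply, Real.norm_eq_abs]
  have n : ∀ z, ‖w z‖ ≤ 1 := hw.norm_le G.η_le_one
  have n' : ∀ z, ‖w' z‖ ≤ 1 := hw'.norm_le G.η_le_one
  rcases lt_trichotomy i m with h | h | h
  · simp only [lineStep, h, if_true]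
    exact abs_ratio_sub_ratio_le G (hM _) (hM _) (hw _).1 (hw' _).1 (n _) (n' _) (hC m) h₁
      (e₁ _ (n' _)) h
  · simpa [lineStep, h] using hnn
  · simp only [lineStep, not_lt_of_gt h, h.ne', if_false]
    exact abs_pullback_sub_pullback_le G (hM _) (hM _) (hw _).1 (hw' _).1 (n' _) (hC i) h₂
      (e₂ _ (n' _)) ((norm_le_pi_norm _ i).trans (n _)) ((norm_le_pi_norm _ i).trans h₃) h

lemma exists_distortion_const (G : SpectralGap β κ η q) :
    ∃ C : ℝ, 0 ≤ C ∧ ∀ i, 2 ≤ C * (|β i| - κ) := by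
  refine ⟨∑ j, 2 / (|β j| - κ),
    Finset.sum_nonneg fun j _ => div_nonneg two_pos.le (sub_pos.2 (G.κ_lt j)).le, fun i => ?_⟩
  have hpos : 0 < |β i| - κ := sub_pos.2 (G.κ_lt i)
  rw [← div_le_iff₀ hpos]
  exact Finset.single_le_sum (f := fun j => 2 / (|β j| - κ))
    (fun j _ => div_nonneg two_pos.le (sub_pos.2 (G.κ_lt j)).le) (Finset.mem_univ i)

lemma lineStep_eq_self_iff (G : SpectralGap β κ η q)
    (hM : ∀ x u i, |M x u i - β i * u i| ≤ κ * ‖u‖) {w : X → Fin d → ℝ}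
    (hw : IsLineSection m η w) :
    lineStep β m M F w = w ↔ ∀ x, M x (w x) = M x (w x) m • w (F x) := by
  have hc : ∀ x, M x (w x) m ≠ 0 := fun x => abs_pos.1 <|
    (sub_pos.2 (G.κ_lt m)).trans_le
      (le_abs_multiplier G.κ_nonneg (hM x) (hw x).1 (hw.norm_le G.η_le_one x))
  have hβ : ∀ i, β i ≠ 0 := fun i => abs_pos.1 (G.κ_nonneg.trans_lt (G.κ_lt i))
  constructor
  · intro h x
    ext i
    rw [Pi.smul_apply, smul_eq_mul]
    rcases lt_trichotomy i m with hi | hi | hi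
    · have h1 := congrFun (congrFun h (F x)) i
      simp only [lineStep, hi, if_true, Equiv.symm_apply_apply] at h1
      rw [← h1, mul_div_cancel₀ _ (hc x)]
    · rw [hi, (hw (F x)).1, mul_one]
    · have h1 := congrFun (congrFun h x) i
      simp only [lineStep, not_lt_of_gt hi, hi.ne', if_false] at h1
      rw [div_eq_iff (hβ i)] at h1
      linarith
  · intro h
    ext x i
    rcases lt_trichotomy i m with hi | hi | hi
    · simp only [lineStep, hi, if_true]
      have h1 := congrFun (h (F.symm x)) i
      rw [Pi.smul_apply, smul_eq_mul, Equiv.apply_symm_apply] at h1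
      rw [div_eq_iff (hc _), h1, mul_comm]
    · subst hi; simp [lineStep, (hw x).1]
    · simp only [lineStep, not_lt_of_gt hi, hi.ne', if_false]
      have h1 := congrFun (h x) i
      rw [Pi.smul_apply, smul_eq_mul] at h1
      rw [div_eq_iff (hβ i)]
      linarith

/-- Along two orbits with the same linear maps the section differs by a quantity that each
application of the contraction multiplies by `q`, so it differs by nothing. With `r` the equality of
projections to the torus this yields periodicity. -/
lemma invariant_section_eq_of_rel (G : SpectralGap β κ η q)
    (hM : ∀ x u i, |M x u i - β i * u i| ≤ κ * ‖u‖) {w : X → Fin d → ℝ}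
    (hw : IsLineSection m η w) (h : ∀ x, M x (w x) = M x (w x) m • w (F x)) {r : X → X → Prop}
    (hr : ∀ x y, r x y → r (F x) (F y)) (hr' : ∀ x y, r x y → r (F.symm x) (F.symm y))
    (hMr : ∀ x y, r x y → M x = M y) {x y : X} (hxy : r x y) : w x = w y := by
  obtain ⟨C, -, hC⟩ := exists_distortion_const G
  rw [← lineStep_eq_self_iff G hM hw] at h
  have key : ∀ n : ℕ, ∀ x y, r x y → ‖w x - w y‖ ≤ q ^ n * 2 := by
    intro n
    induction n with
    | zero =>
      intro x y _
      have := norm_sub_le (w x) (w y)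
      have := hw.norm_le G.η_le_one x
      have := hw.norm_le G.η_le_one y
      rw [pow_zero]; linarith
    | succ n ih =>
      intro x y hxy
      have := norm_lineStep_sub_le (F := F) G hM hw hw hC (ih _ _ (hr' x y hxy))
        (ih _ _ hxy) (ih _ _ (hr x y hxy)) (ε := 0)
        (fun u _ => by simp [hMr _ _ (hr' x y hxy)]) (fun u _ => by simp [hMr _ _ hxy])
      rw [h, mul_zero, add_zero] at this
      rw [pow_succ', mul_assoc]; exact this
  rw [← sub_eq_zero, ← norm_le_zero_iff]
  refine ge_of_tendsto' (f := fun n : ℕ => q ^ n * 2) (x := Filter.atTop) ?_ fun n => key n x y hxy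
  simpa using (tendsto_pow_atTop_nhds_zero_of_lt_one G.q_pos.le G.q_lt_one).mul_const 2

/-- The iterates of the constant section converge geometrically at each point. One step turns a
Hölder constant `H` into `q * K ^ θ * H` plus a fixed error, so the condition `q * K ^ θ < 1` keeps
all iterates, and the limit, uniformly `θ`-Hölder. -/
theorem exists_invariant_section [PseudoMetricSpace X] (G : SpectralGap β κ η q)
    (hM : ∀ x u i, |M x u i - β i * u i| ≤ κ * ‖u‖) {K θ C : ℝ} (hK : 0 ≤ K) (hθ : 0 < θ)
    (hF : ∀ x y, dist (F x) (F y) ≤ K * dist x y)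
    (hF' : ∀ x y, dist (F.symm x) (F.symm y) ≤ K * dist x y) (hK1 : 1 ≤ K)
    (hMC : ∀ x y u, ‖u‖ ≤ 1 → ‖M x u - M y u‖ ≤ C * dist x y ^ θ) (hC : 0 ≤ C)
    (hq : q * K ^ θ < 1) :
    ∃ w : X → Fin d → ℝ, IsLineSection m η w ∧ (∀ x, M x (w x) = M x (w x) m • w (F x)) ∧
      ∃ H : ℝ, 0 ≤ H ∧ ∀ x y, ‖w x - w y‖ ≤ H * dist x y ^ θ := by
  obtain ⟨C', hC'0, hC'⟩ := exists_distortion_const G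
  set T := lineStep β m M F with hT
  set w₀ : X → Fin d → ℝ := fun _ => Pi.single m 1 with hw₀
  have hKθ : (1 : ℝ) ≤ K ^ θ := Real.one_le_rpow hK1 hθ.le
  have sec : ∀ n : ℕ, IsLineSection m η (T^[n] w₀) := by
    intro n
    induction n with
    | zero =>
      intro x
      refine ⟨by simp [w₀], fun i hi => ?_⟩
      simp [w₀, Pi.single_eq_of_ne hi, G.η_nonneg]
    | succ n ih => rw [Function.iterate_succ_apply']; exact ih.lineStep G hM
  have cauchy : ∀ n : ℕ, ∀ x, ‖T^[n] w₀ x - T^[n + 1] w₀ x‖ ≤ 2 * q ^ n := by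
    intro n
    induction n with
    | zero =>
      intro x
      have := norm_sub_le (T^[0] w₀ x) (T^[0 + 1] w₀ x)
      have := (sec 0).norm_le G.η_le_one x
      have := (sec (0 + 1)).norm_le G.η_le_one x
      rw [pow_zero]; linarith
    | succ n ih =>
      intro x
      have := norm_lineStep_sub_le (F := F) (x := x) (x' := x) G hM (sec n) (sec (n + 1)) hC'
        (ih _) (ih _) (ih _) (ε := 0) (fun u _ => by simp) (fun u _ => by simp)
      rw [mul_zero, add_zero] at this
      rw [Function.iterate_succ_apply', Function.iterate_succ_apply' T (n + 1)]
      refine this.trans (le_of_eq ?_)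
      rw [pow_succ]; ring
  -- The fixed point of the affine recursion that the Hölder constants of the iterates obey.
  set H := C' * (C * K ^ θ) / (1 - q * K ^ θ) with hH
  have hH0 : 0 ≤ H := div_nonneg (by positivity) (by linarith)
  have hHeq : q * (H * K ^ θ) + C' * (C * K ^ θ) = H := by
    have : 1 - q * K ^ θ ≠ 0 := by linarith
    rw [hH]; field_simp; ring
  have hdist : ∀ {a b : X} {t : ℝ}, 0 ≤ t → dist a b ≤ K * t → dist a b ^ θ ≤ K ^ θ * t ^ θ :=
    fun ht h => by
      rw [← Real.mul_rpow hK ht]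
      exact Real.rpow_le_rpow dist_nonneg h hθ.le
  have hol : ∀ n : ℕ, ∀ x y, ‖T^[n] w₀ x - T^[n] w₀ y‖ ≤ H * dist x y ^ θ := by
    intro n
    induction n with
    | zero => intro x y; simp [w₀]; positivity
    | succ n ih =>
      intro x y
      rw [Function.iterate_succ_apply']
      have hb : ∀ {a b : X}, dist a b ≤ K * dist x y →
          ‖T^[n] w₀ a - T^[n] w₀ b‖ ≤ H * K ^ θ * dist x y ^ θ := fun h => by
        refine (ih _ _).trans ?_
        rw [mul_assoc]
        exact mul_le_mul_of_nonneg_left (hdist dist_nonneg h) hH0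
      have he : ∀ {a b : X}, dist a b ≤ K * dist x y → ∀ u, ‖u‖ ≤ 1 →
          ‖M a u - M b u‖ ≤ C * K ^ θ * dist x y ^ θ := fun h u hu => by
        refine (hMC _ _ u hu).trans ?_
        rw [mul_assoc]
        exact mul_le_mul_of_nonneg_left (hdist dist_nonneg h) hC
      have hid : dist x y ≤ K * dist x y := le_mul_of_one_le_left dist_nonneg hK1
      refine (norm_lineStep_sub_le (F := F) (x := x) (x' := y) G hM (sec n) (sec n) hC'
        (hb (hF' x y)) (hb hid) (hb (hF x y)) (he (hF' x y)) (he hid)).trans (le_of_eq ?_)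
      calc _ = (q * (H * K ^ θ) + C' * (C * K ^ θ)) * dist x y ^ θ := by ring
        _ = _ := by rw [hHeq]
  have lim : ∀ x, ∃ a, Filter.Tendsto (fun n => T^[n] w₀ x) Filter.atTop (nhds a) := fun x =>
    cauchySeq_tendsto_of_complete
      (cauchySeq_of_le_geometric q 2 G.q_lt_one fun n => by
        rw [dist_eq_norm]; exact cauchy n x)
  choose w hwlim using lim
  have hcoord : ∀ x i, Filter.Tendsto (fun n => T^[n] w₀ x i) Filter.atTop (nhds (w x i)) :=
    fun x i => (tendsto_pi_nhds.1 (hwlim x)) i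
  have hsec : IsLineSection m η w := fun x =>
    ⟨tendsto_nhds_unique (hcoord x m) (by simp [(sec _ x).1]), fun i hi =>
      le_of_tendsto' (hcoord x i).abs fun n => (sec n x).2 i hi⟩
  refine ⟨w, hsec, ?_, H, hH0, fun x y =>
    le_of_tendsto' ((hwlim x).sub (hwlim y)).norm fun n => hol n x y⟩
  rw [← lineStep_eq_self_iff G hM hsec]
  have hMlim : ∀ x i, Filter.Tendsto (fun n => M x (T^[n] w₀ x) i) Filter.atTop
      (nhds (M x (w x) i)) := fun x i =>
    (tendsto_pi_nhds.1 (((M x).continuous_of_finiteDimensional.tendsto _).comp (hwlim x))) i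
  ext x i
  have h1 := (hcoord x i).comp (Filter.tendsto_add_atTop_nat 1)
  refine tendsto_nhds_unique ?_ h1
  have h2 : ((fun n => T^[n] w₀ x i) ∘ fun a => a + 1) = fun n => T (T^[n] w₀) x i := by
    funext n; simp only [Function.comp, Function.iterate_succ_apply']
  rw [h2, hT]
  rcases lt_trichotomy i m with hi | hi | hi
  · simp only [lineStep, hi, if_true]
    refine (hMlim _ _).div (hMlim _ _) ?_
    exact abs_pos.1 <| (sub_pos.2 (G.κ_lt m)).trans_le
      (le_abs_multiplier G.κ_nonneg (hM _) (hsec _).1 (hsec.norm_le G.η_le_one _))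
  · simp only [lineStep, hi, lt_irrefl, if_false, if_true]
    exact tendsto_const_nhds
  · simp only [lineStep, not_lt_of_gt hi, hi.ne', if_false]
    exact (((hMlim _ _).mul (hcoord _ _)).sub
      ((hMlim _ _).sub ((hcoord _ _).const_mul _))).div_const _

end LineField

/-- At `κ = 0` all the inequalities are strict once `q` is close enough to `1`; so `q` is fixed
first and `κ` is then taken small by continuity. -/
lemma exists_spectralGap {d : ℕ} {β : Fin d → ℝ} (hβ : ∀ i, 0 < |β i|)
    (hmono : StrictMono fun i => |β i|) {η : ℝ} (hη : 0 < η) (hη1 : η ≤ 1) {κ₀ : ℝ} (hκ₀ : 0 < κ₀) :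
    ∃ κ q : ℝ, 0 < κ ∧ κ ≤ κ₀ ∧ SpectralGap β κ η q := by
  have e1 : ∀ᶠ q in nhdsWithin (1 : ℝ) (Set.Iio 1), ∀ i j, i < j → |β i| < q * |β j| := by
    refine Filter.eventually_all.2 fun i => Filter.eventually_all.2 fun j => ?_
    by_cases hij : i < j
    · have : Filter.Tendsto (fun q : ℝ => q * |β j|) (nhdsWithin 1 (Set.Iio 1))
          (nhds (1 * |β j|)) :=
        ((continuous_id.mul continuous_const).tendsto 1).mono_left nhdsWithin_le_nhds
      filter_upwards [this.eventually (lt_mem_nhds (by simpa using hmono hij))] with q hq _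
      exact hq
    · exact Filter.Eventually.of_forall fun q h => absurd h hij
  obtain ⟨q, hq, hq1, hq0⟩ := (e1.and ((eventually_mem_nhdsWithin).and
    (nhdsWithin_le_nhds (lt_mem_nhds (zero_lt_one' ℝ))))).exists
  have lim : ∀ (φ : ℝ → ℝ) (a : ℝ), Continuous φ → φ 0 < a →
      ∀ᶠ κ in nhdsWithin (0 : ℝ) (Set.Ioi 0), φ κ < a := fun φ a hφ h =>
    ((hφ.tendsto 0).mono_left nhdsWithin_le_nhds).eventually (gt_mem_nhds h)
  have e2 : ∀ᶠ κ in nhdsWithin (0 : ℝ) (Set.Ioi 0), ∀ i j, i < j →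
      |β i| + 3 * κ - q * (|β j| - κ) < 0 :=
    Filter.eventually_all.2 fun i => Filter.eventually_all.2 fun j => by
      by_cases hij : i < j
      · filter_upwards [lim (fun κ => |β i| + 3 * κ - q * (|β j| - κ)) 0 (by fun_prop)
          (by simpa using hq i j hij)] with κ hκ _
        exact hκ
      · exact Filter.Eventually.of_forall fun q h => absurd h hij
  have e3 : ∀ᶠ κ in nhdsWithin (0 : ℝ) (Set.Ioi 0), ∀ i j, i < j →
      (|β i| + κ) * η + κ - η * (|β j| - κ) < 0 :=
    Filter.eventually_all.2 fun i => Filter.eventually_all.2 fun j => by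
      by_cases hij : i < j
      · filter_upwards [lim (fun κ => (|β i| + κ) * η + κ - η * (|β j| - κ)) 0 (by fun_prop)
          (by have : |β i| < |β j| := hmono hij
              simp only [add_zero, sub_zero]; nlinarith)] with κ hκ _
        exact hκ
      · exact Filter.Eventually.of_forall fun q h => absurd h hij
  have e4 : ∀ᶠ κ in nhdsWithin (0 : ℝ) (Set.Ioi 0), ∀ i, κ < |β i| :=
    Filter.eventually_all.2 fun i => lim id _ continuous_id (hβ i)
  obtain ⟨κ, ⟨h2, h3, h4⟩, h5, h6⟩ := ((e2.and (e3.and e4)).and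
    ((eventually_mem_nhdsWithin).and (lim id _ continuous_id hκ₀))).exists
  exact ⟨κ, q, h5, h6.le, le_of_lt h5, hη.le, hη1, hq0, hq1, h4,
    fun i j hij => by linarith [h2 i j hij], fun i j hij => by linarith [h3 i j hij]⟩

/-! ### Lattice, covering projection and lifts of torus maps -/

/-- The lattice vector of `ℝ^d` with integer coordinates `k`. -/
noncomputable def latticeVec {d : ℕ} (k : Fin d → ℤ) : RSpace d := WithLp.toLp 2 fun i => (k i : ℝ)

section TorusBasics

variable {d : ℕ}

@[simp] lemma latticeVec_apply (k : Fin d → ℤ) (i : Fin d) : latticeVec k i = k i := rfl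

lemma latticeVec_add (k l : Fin d → ℤ) : latticeVec (k + l) = latticeVec k + latticeVec l := by
  ext i; simp

lemma latticeVec_neg (k : Fin d → ℤ) : latticeVec (-k) = -latticeVec k := by
  ext i; simp

lemma latticeVec_zero : latticeVec (0 : Fin d → ℤ) = 0 := by
  ext i; simp

@[simp] lemma torusProj_apply (x : RSpace d) (i : Fin d) :
    torusProj x i = ((x i : ℝ) : UnitAddCircle) := rfl

lemma torusProj_add (x y : RSpace d) : torusProj (x + y) = torusProj x + torusProj y := by
  ext i; simp

lemma torusProj_sub (x y : RSpace d) : torusProj (x - y) = torusProj x - torusProj y := by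
  ext i; simp

lemma torusProj_eq_zero_iff {x : RSpace d} : torusProj x = 0 ↔ ∃ k, x = latticeVec k := by
  constructor
  · intro h
    have : ∀ i, ∃ n : ℤ, (n : ℝ) = x i := fun i => by
      have := congrFun h i
      rw [torusProj_apply, Pi.zero_apply, AddCircle.coe_eq_zero_iff] at this
      simpa using this
    choose k hk using this
    exact ⟨k, by ext i; simp [hk]⟩
  · rintro ⟨k, rfl⟩
    ext i
    rw [torusProj_apply, Pi.zero_apply, AddCircle.coe_eq_zero_iff]
    exact ⟨k i, by simp⟩

lemma torusProj_eq_iff {x y : RSpace d} :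
    torusProj x = torusProj y ↔ ∃ k, x = y + latticeVec k := by
  rw [← sub_eq_zero, ← torusProj_sub, torusProj_eq_zero_iff]
  simp only [sub_eq_iff_eq_add']

@[simp] lemma torusProj_add_latticeVec (x : RSpace d) (k : Fin d → ℤ) :
    torusProj (x + latticeVec k) = torusProj x := torusProj_eq_iff.2 ⟨k, rfl⟩

lemma isOpenQuotientMap_torusProj : IsOpenQuotientMap (torusProj : RSpace d → Torus d) := by
  have h1 : IsOpenQuotientMap (Pi.map fun (_ : Fin d) (t : ℝ) => (t : UnitAddCircle)) :=
    IsOpenQuotientMap.piMap fun _ => QuotientAddGroup.isOpenQuotientMap_mk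
  exact h1.comp (EuclideanSpace.equiv (Fin d) ℝ).toHomeomorph.isOpenQuotientMap

lemma continuous_torusProj : Continuous (torusProj : RSpace d → Torus d) :=
  isOpenQuotientMap_torusProj.continuous

lemma surjective_torusProj : Function.Surjective (torusProj : RSpace d → Torus d) :=
  isOpenQuotientMap_torusProj.surjective

lemma linLift_apply (A : Matrix (Fin d) (Fin d) ℤ) (x : RSpace d) (i : Fin d) :
    linLift A x i = ∑ j, (A i j : ℝ) * x j := by
  have h : (linLift A x).ofLp = (A.map (Int.cast : ℤ → ℝ)).mulVec x.ofLp :=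
    Matrix.ofLp_toEuclideanCLM _ _
  rw [h]
  simp [Matrix.mulVec, dotProduct]

lemma linLift_latticeVec (A : Matrix (Fin d) (Fin d) ℤ) (k : Fin d → ℤ) :
    linLift A (latticeVec k) = latticeVec (A.mulVec k) := by
  ext i
  simp [linLift_apply, Matrix.mulVec, dotProduct]

lemma toralMap_torusProj (A : Matrix (Fin d) (Fin d) ℤ) (x : RSpace d) :
    toralMap A (torusProj x) = torusProj (linLift A x) := by
  ext i
  rw [torusProj_apply, linLift_apply]
  have h : ((∑ j, (A i j : ℝ) * x j : ℝ) : UnitAddCircle)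
      = ∑ j, (((A i j : ℝ) * x j : ℝ) : UnitAddCircle) :=
    map_sum (QuotientAddGroup.mk' (AddSubgroup.zmultiples (1 : ℝ))) _ _
  rw [h]
  refine Finset.sum_congr rfl fun j _ => ?_
  rw [← zsmul_eq_mul]
  rfl

lemma eq_of_torusProj_eq_zero {X : Type*} [TopologicalSpace X] [PreconnectedSpace X]
    {g : X → RSpace d} (hg : Continuous g) (h : ∀ x, torusProj (g x) = 0) (x y : X) :
    g x = g y := by
  have hk : ∀ x, ∃ k, g x = latticeVec k := fun x => torusProj_eq_zero_iff.1 (h x)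
  choose k hk using hk
  ext i
  have hc : Continuous fun x => g x i := by fun_prop
  have hloc : IsLocallyConstant fun x => k x i := by
    refine (IsLocallyConstant.iff_continuous _).2 ?_
    refine Int.isClosedEmbedding_coe_real.isInducing.continuous_iff.2 ?_
    have : ((fun n : ℤ => (n : ℝ)) ∘ fun x => k x i) = fun x => g x i := by
      funext x; simp [hk]
    rw [this]; exact hc
  have := hloc.apply_eq_of_isPreconnected (isPreconnected_univ) (Set.mem_univ x) (Set.mem_univ y)
  rw [hk x, hk y]; simp [this]

lemma eq_add_of_torusProj_eq {X : Type*} [TopologicalSpace X] [PreconnectedSpace X] [Nonempty X]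
    {g g' : X → RSpace d} (hg : Continuous g) (hg' : Continuous g')
    (h : ∀ x, torusProj (g x) = torusProj (g' x)) : ∃ k, ∀ x, g x = g' x + latticeVec k := by
  have h0 : ∀ x, torusProj (g x - g' x) = 0 := fun x => by rw [torusProj_sub, h, sub_self]
  obtain ⟨x₀⟩ := ‹Nonempty X›
  obtain ⟨k, hk⟩ := torusProj_eq_zero_iff.1 (h0 x₀)
  refine ⟨k, fun x => ?_⟩
  have : g x - g' x = latticeVec k := (eq_of_torusProj_eq_zero (hg.sub hg') h0 x x₀).trans hk
  rw [← this]
  simp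

/-- Each coordinate lifts through the covering of the circle by the line. The domain is kept general
because both maps of `ℝ^d` and curves have to be lifted. -/
lemma exists_torus_lift {X : Type*} [TopologicalSpace X] [SimplyConnectedSpace X]
    [LocallyPathConnectedSpace X] {a : X → Torus d} (ha : Continuous a) (x₀ : X) (e₀ : RSpace d)
    (he : torusProj e₀ = a x₀) :
    ∃ g : X → RSpace d, Continuous g ∧ (∀ x, torusProj (g x) = a x) ∧ g x₀ = e₀ := by
  have cov : IsCoveringMap ((↑) : ℝ → UnitAddCircle) := AddCircle.isCoveringMap_coe 1
  have h : ∀ i, ∃ g : C(X, ℝ), g x₀ = e₀ i ∧ ((↑) : ℝ → UnitAddCircle) ∘ g = fun x => a x i :=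
    fun i => (cov.existsUnique_continuousMap_lifts ⟨fun x => a x i, by fun_prop⟩ x₀ (e₀ i)
      (by simpa using congrFun he i)).exists
  choose g hg0 hg using h
  refine ⟨fun x => WithLp.toLp 2 fun i => g i x, ?_, fun x => ?_, ?_⟩
  · exact (PiLp.continuous_toLp 2 _).comp (continuous_pi fun i => (g i).continuous)
  · ext i; exact congrFun (hg i) x
  · ext i; exact hg0 i

lemma exists_latticeVec_bounded (x : RSpace d) :
    ∃ k : Fin d → ℤ, ∀ i, (x + latticeVec k) i ∈ Set.Icc (0 : ℝ) 1 :=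
  ⟨fun i => -⌊x i⌋, fun i => by
    have h1 := Int.floor_le (x i)
    have h2 := (Int.lt_floor_add_one (x i)).le
    simp only [PiLp.add_apply, latticeVec_apply, Int.cast_neg, Set.mem_Icc]
    constructor <;> linarith⟩

lemma isCompact_unitCube : IsCompact {x : RSpace d | ∀ i, x i ∈ Set.Icc (0 : ℝ) 1} := by
  have h : IsCompact (Set.pi Set.univ fun _ : Fin d => Set.Icc (0 : ℝ) 1) :=
    isCompact_univ_pi fun _ => isCompact_Icc
  have := h.image (PiLp.continuous_toLp 2 fun _ : Fin d => ℝ)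
  convert this using 1
  ext x
  constructor
  · intro hx
    exact ⟨fun i => x i, fun i _ => hx i, rfl⟩
  · rintro ⟨y, hy, rfl⟩ i
    exact hy i (Set.mem_univ i)

lemma exists_norm_le_of_periodic {E : Type*} [SeminormedAddCommGroup E] {φ : RSpace d → E}
    (hφ : Continuous φ) (hper : ∀ x k, φ (x + latticeVec k) = φ x) :
    ∃ C : ℝ, 0 ≤ C ∧ ∀ x, ‖φ x‖ ≤ C := by
  obtain ⟨C, hC⟩ := isCompact_unitCube.exists_bound_of_continuousOn (f := φ) hφ.continuousOn
  have key : ∀ x, ‖φ x‖ ≤ C := fun x => by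
    obtain ⟨k, hk⟩ := exists_latticeVec_bounded x
    rw [← hper x k]
    exact hC _ hk
  exact ⟨C, (norm_nonneg _).trans (key 0), key⟩

/-- A lift to `ℝ^d` of a continuous map of the torus is at bounded distance from a linear map
preserving the lattice. -/
lemma exists_linear_part {H : RSpace d → RSpace d} (hH : Continuous H) {a : Torus d → Torus d}
    (ha : ∀ x, torusProj (H x) = a (torusProj x)) :
    ∃ B : RSpace d →L[ℝ] RSpace d, (∀ x k, H (x + latticeVec k) = H x + B (latticeVec k)) ∧
      (∀ k, ∃ l, B (latticeVec k) = latticeVec l) ∧ ∃ C : ℝ, 0 ≤ C ∧ ∀ x, ‖H x - B x‖ ≤ C := by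
  have h1 : ∀ k : Fin d → ℤ, ∃ l, ∀ x, H (x + latticeVec k) = H x + latticeVec l := fun k =>
    eq_add_of_torusProj_eq (by fun_prop) hH fun x => by rw [ha, ha, torusProj_add_latticeVec]
  choose c hc using h1
  have hinj : ∀ {k l : Fin d → ℤ}, latticeVec k = latticeVec l → k = l := fun {k l} h => by
    ext i
    have := congrArg (fun x : RSpace d => x i) h
    simpa using this
  -- The deck transformations are permuted by a homomorphism, which extends linearly; what is left
  -- of `H` is then periodic, hence bounded.
  have cadd : ∀ k l, c (k + l) = c k + c l := fun k l => by
    apply hinj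
    have e1 := hc (k + l) 0
    rw [latticeVec_add, ← add_assoc, hc l, hc k, add_assoc] at e1
    rw [latticeVec_add, add_left_cancel e1.symm]
  let cHom : (Fin d → ℤ) →+ (Fin d → ℤ) := AddMonoidHom.mk' c cadd
  have csum : ∀ k, c k = ∑ i, k i • c (Pi.single i 1) := fun k => by
    have : k = ∑ i, k i • (Pi.single i 1 : Fin d → ℤ) := by
      ext j; simp [Finset.sum_apply, Pi.single_apply]
    conv_lhs => rw [this]
    change cHom _ = _
    rw [map_sum]
    exact Finset.sum_congr rfl fun i _ => map_zsmul cHom _ _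
  let B : RSpace d →ₗ[ℝ] RSpace d :=
    ∑ i, (LinearMap.toSpanSingleton ℝ (RSpace d) (latticeVec (c (Pi.single i 1)))).comp
      (EuclideanSpace.proj (𝕜 := ℝ) i : RSpace d →L[ℝ] ℝ).toLinearMap
  have hB : ∀ x, B x = ∑ i, x i • latticeVec (c (Pi.single i 1)) := fun x => by
    simp [B, LinearMap.sum_apply]
  have hBk : ∀ k, B (latticeVec k) = latticeVec (c k) := fun k => by
    rw [hB, csum k]
    ext j
    simp [Finset.sum_apply]
  have hper : ∀ x k, H (x + latticeVec k) = H x + LinearMap.toContinuousLinearMap B (latticeVec k) :=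
    fun x k => by
      rw [LinearMap.coe_toContinuousLinearMap', hBk, hc]
  refine ⟨LinearMap.toContinuousLinearMap B, hper, fun k => ⟨c k, by simp [hBk]⟩, ?_⟩
  refine exists_norm_le_of_periodic (by fun_prop) fun x k => ?_
  rw [hper, map_add]
  abel

lemma eq_zero_of_norm_le {B : RSpace d →L[ℝ] RSpace d} {C : ℝ} (h : ∀ x, ‖B x‖ ≤ C) : B = 0 := by
  ext1 x
  by_contra hx
  have hx' : 0 < ‖B x‖ := norm_pos_iff.2 hx
  obtain ⟨n, hn⟩ := exists_nat_gt (C / ‖B x‖)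
  rw [div_lt_iff₀ hx'] at hn
  have := h ((n : ℝ) • x)
  rw [map_smul, norm_smul, Real.norm_natCast] at this
  linarith

/-- The linear part of `F` and the map of `A` are at bounded distance from each other, and a bounded
linear difference vanishes. -/
lemma lift_add_latticeVec {A : Matrix (Fin d) (Fin d) ℤ} {F : RSpace d → RSpace d}
    {f : Torus d → Torus d} (hF : Continuous F) (hlift : IsTorusLift F f) {C : ℝ}
    (hC : ∀ x, ‖F x - linLift A x‖ ≤ C) (x : RSpace d) (k : Fin d → ℤ) :
    F (x + latticeVec k) = F x + linLift A (latticeVec k) := by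
  obtain ⟨B, hB, -, C', -, hC'⟩ := exists_linear_part hF fun x => (hlift x).symm
  have : B - linLift A = 0 := eq_zero_of_norm_le (C := C + C') fun x => by
    have h1 : (B - linLift A) x = (F x - linLift A x) - (F x - B x) := by simp
    rw [h1]
    exact (norm_sub_le _ _).trans (add_le_add (hC x) (hC' x))
  rw [hB, sub_eq_zero.1 this]

lemma exists_descend {E : Type*} [TopologicalSpace E] {φ : RSpace d → E}
    (hφ : Continuous φ) (hper : ∀ x k, φ (x + latticeVec k) = φ x) :
    ∃ ψ : Torus d → E, Continuous ψ ∧ ∀ x, ψ (torusProj x) = φ x := by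
  refine ⟨φ ∘ Function.surjInv surjective_torusProj, ?_, ?_⟩
  · rw [isOpenQuotientMap_torusProj.isQuotientMap.continuous_iff]
    convert hφ using 1
    funext x
    obtain ⟨k, hk⟩ := torusProj_eq_iff.1 (Function.surjInv_eq surjective_torusProj (torusProj x))
    simp only [Function.comp, hk, hper]
  · intro x
    obtain ⟨k, hk⟩ := torusProj_eq_iff.1 (Function.surjInv_eq surjective_torusProj (torusProj x))
    simp only [Function.comp, hk, hper]

end TorusBasics

/-! ### Eigenbasis coordinates and the invariant frame -/

/-- The supremum norm of the coordinates in the basis `v`. -/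
noncomputable def coordNorm {d : ℕ} (v : Module.Basis (Fin d) ℝ (RSpace d)) (x : RSpace d) : ℝ :=
  ‖v.equivFun x‖

/-- `F` is, up to a perturbation with Lipschitz constant `κ`, diagonal in the basis `v`. -/
def IsNearDiagonal {d : ℕ} (β : Fin d → ℝ) (v : Module.Basis (Fin d) ℝ (RSpace d)) (κ : ℝ)
    (F : RSpace d → RSpace d) : Prop :=
  ∀ x y i, |v.repr (F x - F y) i - β i * v.repr (x - y) i| ≤ κ * coordNorm v (x - y)

/-- `W m`, `m < d`, is an invariant frame for the derivative of `F`, with multipliers `c m`, close to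
the basis `v`, periodic and Hölder continuous. -/
structure IsInvariantFrame {d : ℕ} (β : Fin d → ℝ) (v : Module.Basis (Fin d) ℝ (RSpace d))
    (κ η θ : ℝ) (F : RSpace d → RSpace d) (W : Fin d → RSpace d → RSpace d)
    (c : Fin d → RSpace d → ℝ) : Prop where
  repr_self : ∀ m x, v.repr (W m x) m = 1
  repr_ne : ∀ m x i, i ≠ m → |v.repr (W m x) i| ≤ η
  fderiv_apply : ∀ m x, fderiv ℝ F x (W m x) = c m x • W m (F x)
  multiplier : ∀ m x, |c m x - β m| ≤ κ
  periodic : ∀ m x k, W m (x + latticeVec k) = W m x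
  multiplier_periodic : ∀ m x k, c m (x + latticeVec k) = c m x
  holder : ∃ H : ℝ, 0 ≤ H ∧ ∀ m x y, ‖W m x - W m y‖ ≤ H * ‖x - y‖ ^ θ
  multiplier_holder : ∃ H : ℝ, 0 ≤ H ∧ ∀ m x y, |c m x - c m y| ≤ H * ‖x - y‖ ^ θ

section Frame

variable {d : ℕ} {β : Fin d → ℝ} {v : Module.Basis (Fin d) ℝ (RSpace d)}

lemma coordNorm_nonneg (x : RSpace d) : 0 ≤ coordNorm v x := norm_nonneg _

lemma abs_repr_le (x : RSpace d) (i : Fin d) : |v.repr x i| ≤ coordNorm v x :=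
  norm_le_pi_norm (v.equivFun x) i

lemma coordNorm_le {x : RSpace d} {C : ℝ} (hC : 0 ≤ C) (h : ∀ i, |v.repr x i| ≤ C) :
    coordNorm v x ≤ C := (pi_norm_le_iff_of_nonneg hC).2 h

lemma exists_coordNorm_eq (hd : 0 < d) (x : RSpace d) : ∃ i, |v.repr x i| = coordNorm v x := by
  have : Nonempty (Fin d) := ⟨⟨0, hd⟩⟩
  obtain ⟨i, hi⟩ := Finite.exists_max fun i => |v.repr x i|
  exact ⟨i, le_antisymm (abs_repr_le x i) (coordNorm_le (abs_nonneg _) hi)⟩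

lemma exists_coordNorm_equiv (v : Module.Basis (Fin d) ℝ (RSpace d)) :
    ∃ C : ℝ, 1 ≤ C ∧ (∀ x, coordNorm v x ≤ C * ‖x‖) ∧ ∀ x, ‖x‖ ≤ C * coordNorm v x := by
  let e := v.equivFunL
  refine ⟨‖(e : RSpace d →L[ℝ] (Fin d → ℝ))‖ + ‖(e.symm : (Fin d → ℝ) →L[ℝ] RSpace d)‖ + 1,
    by linarith [norm_nonneg (e : RSpace d →L[ℝ] (Fin d → ℝ)),
      norm_nonneg (e.symm : (Fin d → ℝ) →L[ℝ] RSpace d)], fun x => ?_, fun x => ?_⟩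
  · have := (e : RSpace d →L[ℝ] (Fin d → ℝ)).le_opNorm x
    have h2 := mul_nonneg (norm_nonneg (e.symm : (Fin d → ℝ) →L[ℝ] RSpace d)) (norm_nonneg x)
    change ‖e x‖ ≤ _ at this
    change ‖e x‖ ≤ _
    linarith [norm_nonneg x]
  · have := (e.symm : (Fin d → ℝ) →L[ℝ] RSpace d).le_opNorm (e x)
    have h2 := mul_nonneg (norm_nonneg (e : RSpace d →L[ℝ] (Fin d → ℝ))) (norm_nonneg (e x))
    change ‖e.symm (e x)‖ ≤ _ at this
    rw [e.symm_apply_apply] at this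
    change _ ≤ _ * ‖e x‖
    linarith [norm_nonneg (e x)]

lemma repr_linLift {A : Matrix (Fin d) (Fin d) ℤ} (hv : ∀ i, linLift A (v i) = β i • v i)
    (x : RSpace d) (i : Fin d) : v.repr (linLift A x) i = β i * v.repr x i := by
  conv_lhs => rw [← v.sum_repr x]
  simp only [map_sum, map_smul, hv, Finsupp.coe_finsetSum, Finset.sum_apply, Finsupp.smul_apply,
    Module.Basis.repr_self, smul_eq_mul, Finsupp.single_apply]
  simp [mul_comm]

lemma IsC1Close.isNearDiagonal {A : Matrix (Fin d) (Fin d) ℤ}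
    (hv : ∀ i, linLift A (v i) = β i • v i) {C δ : ℝ}
    (hC : ∀ x, coordNorm v x ≤ C * ‖x‖) (hC' : ∀ x, ‖x‖ ≤ C * coordNorm v x) (hC0 : 0 ≤ C)
    (hδ : 0 ≤ δ) {F : RSpace d → RSpace d} (hF : Differentiable ℝ F) (h : IsC1Close δ A F) :
    IsNearDiagonal β v (C ^ 2 * δ) F := by
  intro x y i
  have h1 : ‖(F x - linLift A x) - (F y - linLift A y)‖ ≤ δ * ‖x - y‖ := by
    refine convex_univ.norm_image_sub_le_of_norm_fderiv_le (𝕜 := ℝ)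
      (f := fun z => F z - linLift A z) (fun z _ => (hF z).sub (linLift A).differentiableAt)
      (fun z _ => ?_) (Set.mem_univ y) (Set.mem_univ x)
    have : fderiv ℝ (fun z => F z - linLift A z) z = fderiv ℝ F z - linLift A := by
      rw [fderiv_fun_sub (hF z) (linLift A).differentiableAt, ContinuousLinearMap.fderiv]
    rw [this]
    exact (h z).2.le
  have h2 : v.repr (F x - F y) i - β i * v.repr (x - y) i
      = v.repr ((F x - linLift A x) - (F y - linLift A y)) i := by
    rw [← repr_linLift hv, map_sub (linLift A)]
    simp only [map_sub, Finsupp.sub_apply]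
    ring
  rw [h2]
  refine (abs_repr_le _ i).trans ((hC _).trans ?_)
  calc C * ‖(F x - linLift A x) - (F y - linLift A y)‖ ≤ C * (δ * (C * coordNorm v (x - y))) := by
        gcongr
        exact h1.trans (mul_le_mul_of_nonneg_left (hC' _) hδ)
    _ = _ := by ring

lemma IsNearDiagonal.coordNorm_le {κ b : ℝ} {F : RSpace d → RSpace d}
    (h : IsNearDiagonal β v κ F) (hκ : 0 ≤ κ) (hb : 0 ≤ b) (hβ : ∀ i, |β i| ≤ b) (x y : RSpace d) :
    coordNorm v (F x - F y) ≤ (b + κ) * coordNorm v (x - y) := by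
  have hN := coordNorm_nonneg (v := v) (x - y)
  refine _root_.coordNorm_le (by positivity) fun i => ?_
  have h1 := h x y i
  have h2 : |β i * v.repr (x - y) i| ≤ b * coordNorm v (x - y) := by
    rw [abs_mul]
    exact mul_le_mul (hβ i) (abs_repr_le _ i) (abs_nonneg _) hb
  have h3 := abs_add_le (v.repr (F x - F y) i - β i * v.repr (x - y) i) (β i * v.repr (x - y) i)
  rw [sub_add_cancel] at h3
  linarith

lemma IsNearDiagonal.le_coordNorm {κ b : ℝ} {F : RSpace d → RSpace d} (hd : 0 < d)
    (h : IsNearDiagonal β v κ F) (hβ : ∀ i, b ≤ |β i|) (x y : RSpace d) :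
    (b - κ) * coordNorm v (x - y) ≤ coordNorm v (F x - F y) := by
  have hN := coordNorm_nonneg (v := v) (x - y)
  obtain ⟨i, hi⟩ := exists_coordNorm_eq hd (v := v) (x - y)
  have h1 := h x y i
  have h2 : b * coordNorm v (x - y) ≤ |β i * v.repr (x - y) i| := by
    rw [abs_mul, hi]
    exact mul_le_mul_of_nonneg_right (hβ i) hN
  have h3 := abs_sub (v.repr (F x - F y) i) (v.repr (F x - F y) i - β i * v.repr (x - y) i)
  rw [sub_sub_cancel] at h3
  have h4 := abs_repr_le (v := v) (F x - F y) i
  linarith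

lemma exists_biLipschitz {κ : ℝ} (hd : 0 < d) (hκ0 : 0 ≤ κ) (hκ : ∀ i, κ < |β i|)
    {F : RSpace d ≃ₜ RSpace d} (h : IsNearDiagonal β v κ F) :
    ∃ K : ℝ, 1 ≤ K ∧ (∀ x y, dist (F x) (F y) ≤ K * dist x y) ∧
      ∀ x y, dist (F.symm x) (F.symm y) ≤ K * dist x y := by
  obtain ⟨C, hC1, hC, hC'⟩ := exists_coordNorm_equiv v
  have : Nonempty (Fin d) := ⟨⟨0, hd⟩⟩
  obtain ⟨i₀, hi₀⟩ := Finite.exists_min fun i => |β i|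
  obtain ⟨i₁, hi₁⟩ := Finite.exists_max fun i => |β i|
  have hpos : 0 < |β i₀| - κ := sub_pos.2 (hκ i₀)
  have h1 : ∀ x y, dist (F x) (F y) ≤ C ^ 2 * (|β i₁| + κ) * dist x y := fun x y => by
    rw [dist_eq_norm, dist_eq_norm]
    calc ‖F x - F y‖ ≤ C * coordNorm v (F x - F y) := hC' _
      _ ≤ C * ((|β i₁| + κ) * (C * ‖x - y‖)) := by
        gcongr
        refine (h.coordNorm_le hκ0 (abs_nonneg _) hi₁ x y).trans ?_
        gcongr
        exact hC _
      _ = _ := by ring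
  have h2 : ∀ x y, dist (F.symm x) (F.symm y) ≤ C ^ 2 * (|β i₀| - κ)⁻¹ * dist x y := fun x y => by
    rw [dist_eq_norm, dist_eq_norm]
    have := h.le_coordNorm hd hi₀ (F.symm x) (F.symm y)
    rw [F.apply_symm_apply, F.apply_symm_apply, ← le_inv_mul_iff₀ hpos] at this
    calc ‖F.symm x - F.symm y‖ ≤ C * coordNorm v (F.symm x - F.symm y) := hC' _
      _ ≤ C * ((|β i₀| - κ)⁻¹ * (C * ‖x - y‖)) := by
        gcongr
        refine this.trans ?_
        gcongr
        exact hC _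
      _ = _ := by ring
  refine ⟨C ^ 2 * (|β i₁| + κ) + C ^ 2 * (|β i₀| - κ)⁻¹ + 1, ?_, fun x y => (h1 x y).trans ?_,
    fun x y => (h2 x y).trans ?_⟩
  · have : 0 ≤ C ^ 2 * (|β i₁| + κ) + C ^ 2 * (|β i₀| - κ)⁻¹ := by positivity
    linarith
  · gcongr
    have : 0 ≤ C ^ 2 * (|β i₀| - κ)⁻¹ := by positivity
    linarith
  · gcongr
    have : 0 ≤ C ^ 2 * (|β i₁| + κ) := by positivity
    linarith

lemma fderiv_add_latticeVec {A : Matrix (Fin d) (Fin d) ℤ} {F : RSpace d → RSpace d}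
    (hper : ∀ x k, F (x + latticeVec k) = F x + linLift A (latticeVec k)) (x : RSpace d)
    (k : Fin d → ℤ) : fderiv ℝ F (x + latticeVec k) = fderiv ℝ F x := by
  have h1 : fderiv ℝ (fun z => F (z + latticeVec k)) x = fderiv ℝ F (x + latticeVec k) :=
    fderiv_comp_add_right _
  rw [← h1]
  simp only [hper]
  exact fderiv_add_const _

/-- As `θ` tends to `0` the factor `q * K ^ θ` tends to `q < 1`. This choice also fixes the Hölder
exponent in the final conclusion. -/
lemma exists_holder_exponent {q K α : ℝ} (hq1 : q < 1) (hK : 1 ≤ K) (hα : 0 < α) :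
    ∃ θ : ℝ, 0 < θ ∧ θ ≤ α ∧ q * K ^ θ < 1 := by
  have h1 : Filter.Tendsto (fun θ : ℝ => q * K ^ θ) (nhdsWithin 0 (Set.Ioi 0)) (nhds (q * K ^ (0:ℝ))) :=
    ((Real.continuous_const_rpow (by positivity)).const_mul q |>.tendsto 0).mono_left
      nhdsWithin_le_nhds
  rw [Real.rpow_zero, mul_one] at h1
  obtain ⟨θ, h2, h3, h4⟩ := ((h1.eventually (gt_mem_nhds hq1)).and
    ((eventually_mem_nhdsWithin).and (nhdsWithin_le_nhds (gt_mem_nhds hα)))).exists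
  exact ⟨θ, h3, le_of_lt h4, h2⟩

lemma holder_of_holder_of_bounded {t α θ C D a : ℝ} (ht : 0 ≤ t) (hθ : 0 < θ) (hθα : θ ≤ α)
    (h1 : a ≤ C * t ^ α) (h2 : a ≤ D) (hC : 0 ≤ C) (hD : 0 ≤ D) : a ≤ (C + D) * t ^ θ := by
  have h0 : 0 ≤ t ^ θ := Real.rpow_nonneg ht θ
  rcases le_total t 1 with h | h
  · have : t ^ α ≤ t ^ θ := by
      rcases ht.eq_or_lt with rfl | h'
      · rw [Real.zero_rpow hθ.ne', Real.zero_rpow (hθ.trans_le hθα).ne']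
      · exact Real.rpow_le_rpow_of_exponent_ge h' h hθα
    nlinarith [mul_le_mul_of_nonneg_left this hC, mul_nonneg hD h0]
  · have : 1 ≤ t ^ θ := Real.one_le_rpow h hθ.le
    nlinarith [mul_le_mul_of_nonneg_left this hD, mul_nonneg hC h0]

/-- The derivative read in the basis `v` is a cocycle over `F` that is `κ`-close to `diag β`; this
is what `δ` and `C ^ 2 * δ = κ` are for. The general theorem on invariant sections then applies once
for each `m`. -/
theorem exists_invariantFrame {A : Matrix (Fin d) (Fin d) ℤ} (hd : 0 < d)
    (hv : ∀ i, linLift A (v i) = β i • v i) {κ η q C δ α : ℝ} (G : SpectralGap β κ η q)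
    (hC : ∀ x, coordNorm v x ≤ C * ‖x‖) (hC' : ∀ x, ‖x‖ ≤ C * coordNorm v x) (hC0 : 0 ≤ C)
    (hδ : 0 ≤ δ) (hδκ : C ^ 2 * δ = κ) (hα : 0 < α) {f : Torus d ≃ₜ Torus d}
    {F : RSpace d ≃ₜ RSpace d} (hlift : IsTorusLift F f) (hF : IsC1Holder α F)
    (hclose : IsC1Close δ A F) :
    ∃ θ W c, 0 < θ ∧ θ ≤ α ∧ IsInvariantFrame β v κ η θ F W c := by
  have hdiff : Differentiable ℝ F := hF.1.differentiable one_ne_zero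
  have hnear := hclose.isNearDiagonal hv hC hC' hC0 hδ hdiff
  rw [hδκ] at hnear
  have hper := lift_add_latticeVec (A := A) F.continuous hlift fun x => (hclose x).1.le
  obtain ⟨K, hK1, hFK, hFK'⟩ := exists_biLipschitz hd G.κ_nonneg G.κ_lt hnear
  obtain ⟨θ, hθ, hθα, hqθ⟩ := exists_holder_exponent G.q_lt_one hK1 hα
  obtain ⟨D, hD⟩ := hF.2
  set e := v.equivFun with he
  have hNe : ∀ u, coordNorm v (e.symm u) = ‖u‖ := fun u => by
    rw [coordNorm, ← he, e.apply_symm_apply]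
  let M : RSpace d → (Fin d → ℝ) →ₗ[ℝ] (Fin d → ℝ) := fun x =>
    e.toLinearMap ∘ₗ (fderiv ℝ F x).toLinearMap ∘ₗ e.symm.toLinearMap
  have hMe : ∀ x u, M x u = e (fderiv ℝ F x (e.symm u)) := fun x u => rfl
  have hop : ∀ (T : RSpace d →L[ℝ] RSpace d) u, ‖e (T (e.symm u))‖ ≤ C ^ 2 * ‖T‖ * ‖u‖ :=
    fun T u => by
      calc ‖e (T (e.symm u))‖ ≤ C * ‖T (e.symm u)‖ := hC _
        _ ≤ C * (‖T‖ * (C * ‖u‖)) := by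
          gcongr
          refine (T.le_opNorm _).trans ?_
          gcongr
          rw [← hNe]; exact hC' _
        _ = _ := by ring
  have hM : ∀ x u i, |M x u i - β i * u i| ≤ κ * ‖u‖ := fun x u i => by
    have h1 : M x u i - β i * u i = e ((fderiv ℝ F x - linLift A) (e.symm u)) i := by
      have := repr_linLift hv (e.symm u) i
      have h3 : v.repr (e.symm u) i = u i := by
        rw [← Module.Basis.equivFun_apply, ← he, e.apply_symm_apply]
      rw [h3, ← Module.Basis.equivFun_apply, ← he] at this
      rw [sub_apply, map_sub, Pi.sub_apply, this, hMe]
    rw [h1]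
    refine (norm_le_pi_norm _ i).trans ((hop _ u).trans ?_)
    rw [← hδκ]
    gcongr
    exact (hclose x).2.le
  have hMC : ∀ x y u, ‖u‖ ≤ 1 → ‖M x u - M y u‖ ≤ C ^ 2 * (|D| + 2 * δ) * dist x y ^ θ := by
    intro x y u hu
    have h1 : M x u - M y u = e ((fderiv ℝ F x - fderiv ℝ F y) (e.symm u)) := by
      rw [sub_apply, map_sub, hMe, hMe]
    have h2 : ‖fderiv ℝ F x - fderiv ℝ F y‖ ≤ (|D| + 2 * δ) * dist x y ^ θ := by
      rw [dist_eq_norm]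
      refine holder_of_holder_of_bounded (norm_nonneg _) hθ hθα ((hD x y).trans ?_) ?_
        (abs_nonneg D) (by positivity)
      · gcongr
        exact le_abs_self D
      · have h3 : fderiv ℝ F x - fderiv ℝ F y
            = (fderiv ℝ F x - linLift A) - (fderiv ℝ F y - linLift A) := by abel
        rw [h3]
        have := norm_sub_le (fderiv ℝ F x - linLift A) (fderiv ℝ F y - linLift A)
        linarith [(hclose x).2, (hclose y).2]
    rw [h1, mul_assoc]
    refine (hop _ u).trans ?_
    calc _ ≤ C ^ 2 * ‖fderiv ℝ F x - fderiv ℝ F y‖ * 1 := by gcongr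
      _ ≤ _ := by rw [mul_one]; gcongr
  have hex := fun m => exists_invariant_section (m := m) (F := F.toEquiv) G hM
    (by linarith : (0:ℝ) ≤ K) hθ hFK hFK' hK1 hMC (by positivity) hqθ
  choose w hsec hinv H hH0 hH using hex
  have hproj : ∀ x y, torusProj x = torusProj y → torusProj (F x) = torusProj (F y) :=
    fun x y h => by rw [← hlift, ← hlift, h]
  have hproj' : ∀ x y, torusProj x = torusProj y →
      torusProj (F.symm x) = torusProj (F.symm y) := fun x y h => by
    apply f.injective
    rw [hlift, hlift, F.apply_symm_apply, F.apply_symm_apply, h]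
  have hfd : ∀ x y, torusProj x = torusProj y → fderiv ℝ F x = fderiv ℝ F y := fun x y h => by
    obtain ⟨k, rfl⟩ := torusProj_eq_iff.1 h
    exact fderiv_add_latticeVec hper y k
  have hMper : ∀ x y, torusProj x = torusProj y → M x = M y := fun x y h => by
    simp only [M, hfd x y h]
  have hwper : ∀ m x k, w m (x + latticeVec k) = w m x := fun m x k =>
    invariant_section_eq_of_rel G hM (hsec m) (hinv m)
      (r := fun x y => torusProj x = torusProj y) hproj hproj' hMper
      (torusProj_add_latticeVec x k)
  have hHsum : ∀ m, H m ≤ ∑ i, H i := fun m =>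
    Finset.single_le_sum (fun i _ => hH0 i) (Finset.mem_univ m)
  have hwn : ∀ m x, ‖w m x‖ ≤ 1 := fun m x => (hsec m).norm_le G.η_le_one x
  have hr : ∀ m x i, v.repr (e.symm (w m x)) i = w m x i := fun m x i => by
    rw [← Module.Basis.equivFun_apply, ← he, e.apply_symm_apply]
  refine ⟨θ, fun m x => e.symm (w m x), fun m x => M x (w m x) m, hθ, hθα, ?_, ?_, ?_, ?_, ?_, ?_,
    ?_, ?_⟩
  · intro m x; rw [hr]; exact (hsec m x).1
  · intro m x i hi; rw [hr]; exact (hsec m x).2 i hi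
  · intro m x
    apply e.injective
    rw [map_smul, e.apply_symm_apply]
    exact hinv m x
  · intro m x
    have := hM x (w m x) m
    rw [(hsec m x).1, mul_one] at this
    exact this.trans (mul_le_of_le_one_right G.κ_nonneg (hwn m x))
  · intro m x k; simp only [hwper]
  · intro m x k; simp only [hwper, hMper _ _ (torusProj_add_latticeVec x k)]
  · refine ⟨C * ∑ i, H i, mul_nonneg hC0 (Finset.sum_nonneg fun i _ => hH0 i), fun m x y => ?_⟩
    rw [← map_sub, mul_assoc]
    refine (hC' _).trans ?_
    rw [hNe]
    gcongr
    refine (hH m x y).trans ?_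
    rw [dist_eq_norm]
    gcongr
    exact hHsum m
  · obtain ⟨b, hb⟩ : ∃ b, ∀ i, |β i| ≤ b := by
      have : Nonempty (Fin d) := ⟨⟨0, hd⟩⟩
      obtain ⟨i₁, hi₁⟩ := Finite.exists_max fun i => |β i|
      exact ⟨_, hi₁⟩
    have hb0 : 0 ≤ b := (abs_nonneg _).trans (hb ⟨0, hd⟩)
    have hS := Finset.sum_nonneg fun i (_ : i ∈ Finset.univ) => hH0 i
    have hκ := G.κ_nonneg
    refine ⟨(b + κ) * ∑ i, H i + C ^ 2 * (|D| + 2 * δ), by positivity, fun m x y => ?_⟩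
    have h1 : M x (w m x) m - M y (w m y) m
        = M x (w m x - w m y) m + (M x (w m y) - M y (w m y)) m := by
      rw [map_sub, Pi.sub_apply, Pi.sub_apply]; ring
    rw [h1, add_mul]
    refine (abs_add_le _ _).trans (add_le_add ?_ ?_)
    · refine (abs_eval_le_of_close (hM x) _ m).trans ?_
      have h2 : ‖w m x - w m y‖ ≤ (∑ i, H i) * ‖x - y‖ ^ θ := by
        refine (hH m x y).trans ?_
        rw [dist_eq_norm]
        gcongr
        exact hHsum m
      have h3 : |(w m x - w m y) m| ≤ (∑ i, H i) * ‖x - y‖ ^ θ := (norm_le_pi_norm _ m).trans h2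
      have h4 := mul_le_mul (hb m) h3 (abs_nonneg _) hb0
      have h5 := mul_le_mul_of_nonneg_left h2 hκ
      linarith
    · rw [← dist_eq_norm]
      exact (norm_le_pi_norm _ m).trans (hMC x y _ (hwn m y))

end Frame

/-! ### From the invariant frame to a dominated splitting -/

section Iterates

variable {d : ℕ}

lemma fderiv_iterate_succ {F : RSpace d → RSpace d} (hF : Differentiable ℝ F) (n : ℕ)
    (x : RSpace d) : fderiv ℝ F^[n + 1] x = (fderiv ℝ F (F^[n] x)).comp (fderiv ℝ F^[n] x) := by
  rw [Function.iterate_succ']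
  exact fderiv_comp x (hF _) (hF.iterate n x)

lemma fderiv_iterate_of_invariant {F : RSpace d → RSpace d} (hF : Differentiable ℝ F)
    {W : RSpace d → RSpace d} {c : RSpace d → ℝ} (h : ∀ x, fderiv ℝ F x (W x) = c x • W (F x))
    (n : ℕ) (x : RSpace d) :
    fderiv ℝ F^[n] x (W x) = (∏ k ∈ Finset.range n, c (F^[k] x)) • W (F^[n] x) := by
  induction n with
  | zero => simp
  | succ n ih =>
    rw [fderiv_iterate_succ hF, ContinuousLinearMap.comp_apply, ih, map_smul, h, smul_smul,
      Finset.prod_range_succ, ← Function.iterate_succ_apply' F n x]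

end Iterates

section Splitting

variable {d : ℕ} {β : Fin d → ℝ} {v : Module.Basis (Fin d) ℝ (RSpace d)} {κ η θ : ℝ}
  {F : RSpace d → RSpace d} {W : Fin d → RSpace d → RSpace d} {c : Fin d → RSpace d → ℝ}

namespace IsInvariantFrame

lemma continuous (h : IsInvariantFrame β v κ η θ F W c) (hθ : 0 < θ) (m : Fin d) :
    Continuous (W m) := by
  obtain ⟨H, hH0, hH⟩ := h.holder
  rw [continuous_iff_continuousAt]
  intro x
  rw [ContinuousAt, tendsto_iff_norm_sub_tendsto_zero]
  refine squeeze_zero (fun _ => norm_nonneg _) (fun y => hH m y x) ?_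
  have : Continuous fun y : RSpace d => H * ‖y - x‖ ^ θ :=
    ((continuous_id.sub continuous_const).norm.rpow_const fun _ => Or.inr hθ.le).const_mul H
  have h2 := this.tendsto x
  simpa [Real.zero_rpow hθ.ne'] using h2

lemma ne_zero (h : IsInvariantFrame β v κ η θ F W c) (m : Fin d) (x : RSpace d) : W m x ≠ 0 := by
  intro h0
  have := h.repr_self m x
  simp [h0] at this

lemma le_abs_multiplier (h : IsInvariantFrame β v κ η θ F W c) (m : Fin d) (x : RSpace d) :
    |β m| - κ ≤ |c m x| := by
  have h1 := h.multiplier m x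
  have h2 := abs_sub (c m x) (c m x - β m)
  rw [sub_sub_cancel] at h2
  linarith

lemma abs_multiplier_le (h : IsInvariantFrame β v κ η θ F W c) (m : Fin d) (x : RSpace d) :
    |c m x| ≤ |β m| + κ := by
  have h1 := h.multiplier m x
  have h2 := abs_add_le (c m x - β m) (β m)
  rw [sub_add_cancel] at h2
  linarith

lemma coordNorm_le_one (h : IsInvariantFrame β v κ η θ F W c) (hη : η ≤ 1) (m : Fin d)
    (x : RSpace d) : coordNorm v (W m x) ≤ 1 :=
  norm_le_one_of_line hη (h.repr_self m x) (h.repr_ne m x)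

/-- The frame is uniformly transverse. -/
lemma abs_coeff_le (h : IsInvariantFrame β v κ η θ F W c) (hη : 2 * d * η ≤ 1) (hη0 : 0 ≤ η)
    (a : Fin d → ℝ) (x : RSpace d) (i : Fin d) :
    |a i| ≤ 2 * coordNorm v (∑ j, a j • W j x) := by
  have : Nonempty (Fin d) := ⟨i⟩
  obtain ⟨I, hI⟩ := Finite.exists_max fun i => |a i|
  suffices |a I| ≤ 2 * coordNorm v (∑ j, a j • W j x) from (hI i).trans this
  have h1 : v.repr (∑ j, a j • W j x) I = a I + ∑ j ∈ Finset.univ.erase I, a j * v.repr (W j x) I := by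
    rw [← Finset.add_sum_erase _ _ (Finset.mem_univ I)]
    simp [h.repr_self, Finsupp.coe_finsetSum]
  have h2 : |∑ j ∈ Finset.univ.erase I, a j * v.repr (W j x) I| ≤ d * (|a I| * η) := by
    refine (Finset.abs_sum_le_sum_abs _ _).trans ?_
    calc _ ≤ ∑ j ∈ Finset.univ.erase I, |a I| * η := by
          refine Finset.sum_le_sum fun j hj => ?_
          rw [abs_mul]
          exact mul_le_mul (hI j) (h.repr_ne j x I (Finset.ne_of_mem_erase hj).symm)
            (abs_nonneg _) (abs_nonneg _)
      _ ≤ ∑ j : Fin d, |a I| * η :=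
          Finset.sum_le_sum_of_subset_of_nonneg (Finset.erase_subset _ _)
            fun _ _ _ => mul_nonneg (abs_nonneg _) hη0
      _ = _ := by simp
  have h3 := abs_repr_le (v := v) (∑ j, a j • W j x) I
  rw [h1] at h3
  have h4 := abs_sub (a I + ∑ j ∈ Finset.univ.erase I, a j * v.repr (W j x) I)
    (∑ j ∈ Finset.univ.erase I, a j * v.repr (W j x) I)
  rw [add_sub_cancel_right] at h4
  -- Diagonal dominance at the largest coefficient: the cones are so thin that the other vectors
  -- cancel at most half of it.
  have h5 : (d : ℝ) * (|a I| * η) ≤ |a I| / 2 := by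
    have := mul_le_mul_of_nonneg_left hη (abs_nonneg (a I))
    linarith
  linarith

lemma linearIndependent (h : IsInvariantFrame β v κ η θ F W c) (hη : 2 * d * η ≤ 1) (hη0 : 0 ≤ η)
    (x : RSpace d) : LinearIndependent ℝ fun m => W m x := by
  rw [Fintype.linearIndependent_iff]
  intro a ha i
  have := h.abs_coeff_le hη hη0 a x i
  rw [ha] at this
  simpa [coordNorm] using this

end IsInvariantFrame

lemma isInternal_span_singleton {w : Fin d → RSpace d} (hw : LinearIndependent ℝ w) :
    DirectSum.IsInternal fun i => Submodule.span ℝ {w i} := by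
  have hcard : Fintype.card (Fin d) = Module.finrank ℝ (RSpace d) := by simp
  have hspan := hw.span_eq_top_of_card_eq_finrank' hcard
  rw [DirectSum.isInternal_submodule_iff_iSupIndep_and_iSup_eq_top]
  exact ⟨hw.iSupIndep_span_singleton, by rw [← Submodule.span_range_eq_iSup, hspan]⟩

theorem IsInvariantFrame.exists_splitting {q : ℝ} (G : SpectralGap β κ η q)
    (hη : 2 * d * η ≤ 1) (hθ : 0 < θ) (hF : Differentiable ℝ F)
    (h : IsInvariantFrame β v κ η θ F W c) :
    ∃ E : Fin d → Torus d → Submodule ℝ (RSpace d), IsDominatedLineSplitting F E ∧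
      ∀ m x, E m (torusProj x) = Submodule.span ℝ {W m x} := by
  have hψ := fun m => exists_descend (h.continuous hθ m) (h.periodic m)
  choose ψ hψc hψ using hψ
  have hne : ∀ m p, ψ m p ≠ 0 := fun m p => by
    obtain ⟨x, rfl⟩ := surjective_torusProj p
    rw [hψ]; exact h.ne_zero m x
  have hc0 : ∀ m x, c m x ≠ 0 := fun m x => abs_pos.1 <|
    (sub_pos.2 (G.κ_lt m)).trans_le (h.le_abs_multiplier m x)
  refine ⟨fun m p => Submodule.span ℝ {ψ m p}, ⟨fun m p => ?_, fun p => ?_, fun m x => ?_, ?_⟩,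
    fun m x => by simp only [hψ]⟩
  · exact ⟨Set.univ, Filter.univ_mem, ψ m, (hψc m).continuousOn, fun q _ => ⟨hne m q, rfl⟩⟩
  · obtain ⟨x, rfl⟩ := surjective_torusProj p
    simp only [hψ]
    exact isInternal_span_singleton (h.linearIndependent hη G.η_nonneg x)
  · rw [hψ, hψ, Submodule.map_span, Set.image_singleton]
    change Submodule.span ℝ {fderiv ℝ F x (W m x)} = _
    rw [h.fderiv_apply, Submodule.span_singleton_smul_eq (IsUnit.mk0 _ (hc0 m x))]
  · obtain ⟨C, hC1, hC, hC'⟩ := exists_coordNorm_equiv v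
    have hlow : ∀ m x, 1 ≤ C * ‖W m x‖ := fun m x => by
      have := abs_repr_le (v := v) (W m x) m
      rw [h.repr_self, abs_one] at this
      exact this.trans (hC _)
    have hup : ∀ m x, ‖W m x‖ ≤ C := fun m x => by
      refine (hC' _).trans ?_
      have := h.coordNorm_le_one G.η_le_one m x
      nlinarith
    refine ⟨C ^ 4, q, by positivity, G.q_pos, G.q_lt_one, fun i j hij x n a ha b hb => ?_⟩
    rw [hψ] at ha hb
    obtain ⟨s, rfl⟩ := Submodule.mem_span_singleton.1 ha
    obtain ⟨t, rfl⟩ := Submodule.mem_span_singleton.1 hb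
    rw [map_smul, map_smul, fderiv_iterate_of_invariant hF (h.fderiv_apply i),
      fderiv_iterate_of_invariant hF (h.fderiv_apply j)]
    simp only [norm_smul, Real.norm_eq_abs, Finset.abs_prod]
    set P := ∏ k ∈ Finset.range n, |c i (F^[k] x)|
    set Q := ∏ k ∈ Finset.range n, |c j (F^[k] x)|
    -- Domination is the gap between the multipliers, multiplied along the orbit; the lengths of the
    -- frame vectors only cost the constant `C ^ 4`.
    have hPQ : P ≤ q ^ n * Q := by
      have : q ^ n * Q = ∏ k ∈ Finset.range n, (q * |c j (F^[k] x)|) := by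
        rw [Finset.prod_mul_distrib]; simp [Q]
      rw [this]
      refine Finset.prod_le_prod (fun _ _ => abs_nonneg _) fun k _ => ?_
      have h1 := h.abs_multiplier_le i (F^[k] x)
      have h2 := mul_le_mul_of_nonneg_left (h.le_abs_multiplier j (F^[k] x)) G.q_pos.le
      linarith [G.rate i j hij, G.κ_nonneg]
    have hP0 : 0 ≤ P := Finset.prod_nonneg fun _ _ => abs_nonneg _
    have hQ0 : 0 ≤ Q := Finset.prod_nonneg fun _ _ => abs_nonneg _
    have hq0 := G.q_pos.le
    have h1 : ‖W i (F^[n] x)‖ * ‖W j x‖ ≤ C ^ 4 * (‖W j (F^[n] x)‖ * ‖W i x‖) := by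
      have e1 := mul_le_mul (hup i (F^[n] x)) (hup j x) (norm_nonneg _) (by linarith)
      have e2 := mul_le_mul (hlow j (F^[n] x)) (hlow i x) (by norm_num) (by positivity)
      calc _ ≤ C * C := e1
        _ ≤ C * C * (C * ‖W j (F^[n] x)‖ * (C * ‖W i x‖)) :=
          le_mul_of_one_le_right (by positivity) (by linarith)
        _ = _ := by ring
    calc |s| * (P * ‖W i (F^[n] x)‖) * (|t| * ‖W j x‖)
        = |s| * |t| * P * (‖W i (F^[n] x)‖ * ‖W j x‖) := by ring
      _ ≤ |s| * |t| * (q ^ n * Q) * (C ^ 4 * (‖W j (F^[n] x)‖ * ‖W i x‖)) := by gcongr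
      _ = _ := by ring

end Splitting

/-! ### Uniqueness of the dominated splitting -/

/-- The basis `e` is dominated along the sequence of linear maps `T`: the images of the basis vectors
are uniformly transverse, and the growth rates of different basis vectors are separated, in
increasing order. -/
structure IsDominatedBasis {d : ℕ} {V : Type*} [NormedAddCommGroup V] [NormedSpace ℝ V]
    (T : ℕ → V →ₗ[ℝ] V) (e : Module.Basis (Fin d) ℝ V) : Prop where
  pos : ∀ n i, 0 < ‖T n (e i)‖
  transverse : ∃ c : ℝ, 0 < c ∧ ∀ n (a : Fin d → ℝ) i,
    c * (|a i| * ‖T n (e i)‖) ≤ ‖T n (∑ j, a j • e j)‖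
  dominated : ∃ C ρ : ℝ, 0 ≤ C ∧ 0 ≤ ρ ∧ ρ < 1 ∧ ∀ i j, i < j → ∀ n,
    ‖T n (e i)‖ ≤ C * ρ ^ n * ‖T n (e j)‖

section Uniqueness

variable {d : ℕ} {V : Type*} [NormedAddCommGroup V] [NormedSpace ℝ V]

lemma IsDominatedBasis.exists_le {T : ℕ → V →ₗ[ℝ] V} {e : Module.Basis (Fin d) ℝ V}
    (h : IsDominatedBasis T e) :
    ∃ C : ℝ, 0 < C ∧ ∀ i j, i ≤ j → ∀ n, ‖T n (e i)‖ ≤ C * ‖T n (e j)‖ := by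
  obtain ⟨C, ρ, hC, hρ, hρ1, hdom⟩ := h.dominated
  refine ⟨C + 1, by linarith, fun i j hij n => ?_⟩
  have h0 := (h.pos n j).le
  rcases hij.eq_or_lt with rfl | hlt
  · nlinarith
  · have h1 := hdom i j hlt n
    have h2 : C * ρ ^ n ≤ C := mul_le_of_le_one_right hC (pow_le_one₀ hρ hρ1.le)
    nlinarith

/-- A dimension count: the span of `e j`, `j ≤ k`, has one dimension more than there are conditions
indexed by `j < k`. -/
lemma exists_mem_flags (e e' : Module.Basis (Fin d) ℝ V) (k : Fin d) :
    ∃ u : V, u ≠ 0 ∧ (∀ j, k < j → e.repr u j = 0) ∧ ∀ j, j < k → e'.repr u j = 0 := by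
  classical
  let ι : ({j : Fin d // j ≤ k} → ℝ) →ₗ[ℝ] V :=
    Fintype.linearCombination ℝ fun j : {j : Fin d // j ≤ k} => e j
  let L : ({j : Fin d // j ≤ k} → ℝ) →ₗ[ℝ] ({j : Fin d // j < k} → ℝ) :=
    LinearMap.pi fun i => (e'.coord i) ∘ₗ ι
  have hcard : Module.finrank ℝ ({j : Fin d // j < k} → ℝ)
      < Module.finrank ℝ ({j : Fin d // j ≤ k} → ℝ) := by
    rw [Module.finrank_pi, Module.finrank_pi]
    refine Fintype.card_lt_of_injective_of_notMem
      (fun j : {j : Fin d // j < k} => (⟨j, j.2.le⟩ : {j : Fin d // j ≤ k}))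
      (fun a b hab => Subtype.ext (by simpa using congrArg Subtype.val hab)) (b := ⟨k, le_rfl⟩) ?_
    rintro ⟨j, hj⟩
    exact absurd (congrArg Subtype.val hj) j.2.ne
  obtain ⟨b, hb, hb0⟩ := (Submodule.ne_bot_iff _).1 (LinearMap.ker_ne_bot_of_finrank_lt hcard (f := L))
  have hι : ι b = ∑ j : {j : Fin d // j ≤ k}, b j • e j := by
    simp [ι, Fintype.linearCombination_apply]
  refine ⟨ι b, fun h0 => hb0 ?_, fun j hj => ?_, fun j hj => ?_⟩
  · have hli : LinearIndependent ℝ fun j : {j : Fin d // j ≤ k} => e j :=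
      e.linearIndependent.comp _ Subtype.val_injective
    funext j
    exact Fintype.linearIndependent_iff.1 hli b (hι ▸ h0) j
  · rw [hι]
    simp only [map_sum, map_smul, Module.Basis.repr_self, Finsupp.coe_finsetSum, Finset.sum_apply,
      Finsupp.smul_apply, smul_eq_mul]
    refine Finset.sum_eq_zero fun i _ => ?_
    rw [Finsupp.single_eq_of_ne (i.2.trans_lt hj).ne', mul_zero]
  · exact congrFun (LinearMap.mem_ker.1 hb) ⟨j, hj⟩

/-- The vector `u` common to the two flags grows at most like `e k` and at least like `e' k`, so `e'
k` grows at most like `e k`. A component of `e' k` along some `e J` with `k < J` would force it to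
grow at least like `e J`, which is exponentially faster. -/
lemma IsDominatedBasis.repr_eq_zero {T : ℕ → V →ₗ[ℝ] V} {e e' : Module.Basis (Fin d) ℝ V}
    (h : IsDominatedBasis T e) (h' : IsDominatedBasis T e') {k J : Fin d} (hkJ : k < J) :
    e.repr (e' k) J = 0 := by
  by_contra hJ
  obtain ⟨u, hu0, hu, hu'⟩ := exists_mem_flags e e' k
  obtain ⟨c, hc, hang⟩ := h.transverse
  obtain ⟨c', hc', hang'⟩ := h'.transverse
  obtain ⟨C, ρ, hC, hρ, hρ1, hdom⟩ := h.dominated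
  obtain ⟨C₁, hC₁, hle⟩ := h.exists_le
  obtain ⟨C₂, hC₂, hle'⟩ := h'.exists_le
  obtain ⟨j, hj⟩ : ∃ j, e'.repr u j ≠ 0 := by
    by_contra hcon
    push Not at hcon
    exact hu0 (e'.repr.map_eq_zero_iff.1 (Finsupp.ext hcon))
  have hkj : k ≤ j := not_lt.1 fun hlt => hj (hu' j hlt)
  set S := ∑ i, |e.repr u i|
  have up : ∀ n, ‖T n u‖ ≤ S * (C₁ * ‖T n (e k)‖) := fun n => by
    conv_lhs => rw [← e.sum_repr u, map_sum]
    refine (norm_sum_le _ _).trans ?_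
    rw [Finset.sum_mul]
    refine Finset.sum_le_sum fun i _ => ?_
    rw [map_smul, norm_smul, Real.norm_eq_abs]
    rcases le_or_gt i k with hik | hik
    · exact mul_le_mul_of_nonneg_left (hle i k hik n) (abs_nonneg _)
    · simp [hu i hik]
  have low : ∀ n, c' * (|e'.repr u j| * ‖T n (e' j)‖) ≤ ‖T n u‖ := fun n => by
    have := hang' n (fun i => e'.repr u i) j
    rwa [e'.sum_repr] at this
  have low2 : ∀ n, c * (|e.repr (e' k) J| * ‖T n (e J)‖) ≤ ‖T n (e' k)‖ := fun n => by
    have := hang n (fun i => e.repr (e' k) i) J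
    rwa [e.sum_repr] at this
  have hj' : 0 < |e'.repr u j| := abs_pos.2 hj
  have hJ' : 0 < |e.repr (e' k) J| := abs_pos.2 hJ
  have hlim : Filter.Tendsto (fun n : ℕ => C₂ * (S * (C₁ * (C * ρ ^ n)))) Filter.atTop
      (nhds (C₂ * (S * (C₁ * (C * 0))))) :=
    ((((tendsto_pow_atTop_nhds_zero_of_lt_one hρ hρ1).const_mul C).const_mul C₁).const_mul
      S).const_mul C₂
  simp only [mul_zero] at hlim
  have hpos : 0 < c * |e.repr (e' k) J| * (c' * |e'.repr u j|) := by positivity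
  obtain ⟨n, hn⟩ := (hlim.eventually (gt_mem_nhds hpos)).exists
  have hS : 0 ≤ S := Finset.sum_nonneg fun _ _ => abs_nonneg _
  have hTJ := h.pos n J
  have key : c * |e.repr (e' k) J| * (c' * |e'.repr u j|) * ‖T n (e J)‖
      ≤ C₂ * (S * (C₁ * (C * ρ ^ n))) * ‖T n (e J)‖ := by
    calc c * |e.repr (e' k) J| * (c' * |e'.repr u j|) * ‖T n (e J)‖
        = c' * |e'.repr u j| * (c * (|e.repr (e' k) J| * ‖T n (e J)‖)) := by ring
      _ ≤ c' * |e'.repr u j| * (C₂ * ‖T n (e' j)‖) := by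
        exact mul_le_mul_of_nonneg_left ((low2 n).trans (hle' k j hkj n)) (by positivity)
      _ = C₂ * (c' * (|e'.repr u j| * ‖T n (e' j)‖)) := by ring
      _ ≤ C₂ * (S * (C₁ * (C * ρ ^ n * ‖T n (e J)‖))) := by
        refine mul_le_mul_of_nonneg_left ((low n).trans ((up n).trans ?_)) hC₂.le
        exact mul_le_mul_of_nonneg_left (mul_le_mul_of_nonneg_left (hdom k J hkJ n) hC₁.le) hS
      _ = _ := by ring
  exact absurd (le_of_mul_le_mul_right key hTJ) (not_le.2 hn)

/-- Uniform transversality of a continuous splitting into lines. -/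
lemma exists_transversality {E : Fin d → Torus d → Submodule ℝ (RSpace d)}
    (hcont : ∀ i, IsContinuousLineField (E i)) (hintl : ∀ p, DirectSum.IsInternal fun i => E i p) :
    ∃ c : ℝ, 0 < c ∧ ∀ p (u : Fin d → RSpace d), (∀ i, u i ∈ E i p) →
      ∀ i, c * ‖u i‖ ≤ ‖∑ j, u j‖ := by
  suffices ∃ c : ℝ, 0 < c ∧ ∀ p ∈ (Set.univ : Set (Torus d)), ∀ (u : Fin d → RSpace d),
      (∀ i, u i ∈ E i p) → ∀ i, c * ‖u i‖ ≤ ‖∑ j, u j‖ by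
    obtain ⟨c, hc, h⟩ := this
    exact ⟨c, hc, fun p => h p (Set.mem_univ p)⟩
  refine isCompact_univ.induction_on (p := fun S => ∃ c : ℝ, 0 < c ∧ ∀ p ∈ S,
    ∀ (u : Fin d → RSpace d), (∀ i, u i ∈ E i p) → ∀ i, c * ‖u i‖ ≤ ‖∑ j, u j‖) ?_ ?_ ?_ ?_
  · exact ⟨1, one_pos, fun p hp => absurd hp (Set.notMem_empty p)⟩
  · rintro s t hst ⟨c, hc, h⟩
    exact ⟨c, hc, fun p hp => h p (hst hp)⟩
  · rintro s t ⟨c, hc, h⟩ ⟨c', hc', h'⟩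
    refine ⟨min c c', lt_min hc hc', fun p hp u hu i => ?_⟩
    rcases hp with hp | hp
    · exact (mul_le_mul_of_nonneg_right (min_le_left _ _) (norm_nonneg _)).trans (h p hp u hu i)
    · exact (mul_le_mul_of_nonneg_right (min_le_right _ _) (norm_nonneg _)).trans (h' p hp u hu i)
  intro p _
  rw [nhdsWithin_univ]
  have hc := fun i => hcont i p
  choose U hU w hwc hw using hc
  have hpU : ∀ i, p ∈ U i := fun i => mem_of_mem_nhds (hU i)
  have hli : LinearIndependent ℝ fun i => w i p :=
    (hintl p).submodule_iSupIndep.linearIndependent _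
      (fun i => by rw [(hw i p (hpU i)).2]; exact Submodule.mem_span_singleton_self _)
      fun i => (hw i p (hpU i)).1
  obtain ⟨K, hK0, hK⟩ := (Fintype.linearCombination ℝ fun i => w i p).exists_antilipschitzWith
    (LinearMap.ker_eq_bot.2 (linearIndependent_iff_injective_fintypeLinearCombination.1 hli))
  have hK0' : (0 : ℝ) < K := hK0
  have hK' : ∀ a : Fin d → ℝ, ‖a‖ ≤ K * ‖∑ i, a i • w i p‖ := fun a => by
    have := hK.le_mul_dist a 0
    simpa [Fintype.linearCombination_apply] using this
  -- Small enough that replacing the spanning vectors at `p` by those at a nearby `q` can be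
  -- absorbed into half of `‖a‖`.
  set ε : ℝ := 1 / (2 * K * (d + 1)) with hε
  have hε0 : 0 < ε := by positivity
  have hev : ∀ i, ∀ᶠ q in nhds p, ‖w i q - w i p‖ < ε ∧ ‖w i q‖ < ‖w i p‖ + 1 ∧ q ∈ U i := fun i => by
    have hca : ContinuousAt (w i) p := (hwc i).continuousAt (hU i)
    have h1 : Filter.Tendsto (fun q => ‖w i q - w i p‖) (nhds p) (nhds 0) :=
      tendsto_iff_norm_sub_tendsto_zero.1 hca
    exact (h1.eventually (gt_mem_nhds hε0)).and
      ((hca.norm.eventually (gt_mem_nhds (lt_add_one _))).and (hU i))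
  set D : ℝ := ∑ i, ‖w i p‖ + 1 with hD
  have hD0 : 0 < D := by
    have := Finset.sum_nonneg fun i (_ : i ∈ Finset.univ) => norm_nonneg (w i p)
    linarith
  refine ⟨{q | ∀ i, ‖w i q - w i p‖ < ε ∧ ‖w i q‖ < ‖w i p‖ + 1 ∧ q ∈ U i},
    Filter.eventually_all.2 hev, 1 / (2 * K * D), by positivity, fun q hq u hu i => ?_⟩
  have ha : ∀ i, ∃ a : ℝ, a • w i q = u i := fun i => by
    have := hu i
    rw [(hw i q (hq i).2.2).2] at this
    exact Submodule.mem_span_singleton.1 this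
  choose a ha using ha
  have h1 : ‖∑ j, a j • (w j p - w j q)‖ ≤ d * (‖a‖ * ε) := by
    refine (norm_sum_le _ _).trans ?_
    calc _ ≤ ∑ _j : Fin d, ‖a‖ * ε := Finset.sum_le_sum fun j _ => by
          rw [norm_smul, norm_sub_rev]
          exact mul_le_mul (norm_le_pi_norm a j) (hq j).1.le (norm_nonneg _) (norm_nonneg _)
      _ = _ := by simp
  have h2 : ‖a‖ ≤ 2 * K * ‖∑ j, u j‖ := by
    have h3 := hK' a
    have h4 : ∑ j, a j • w j p = ∑ j, u j + ∑ j, a j • (w j p - w j q) := by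
      rw [← Finset.sum_add_distrib]
      exact Finset.sum_congr rfl fun j _ => by rw [← ha j, smul_sub]; abel
    rw [h4] at h3
    have h5 := h3.trans (mul_le_mul_of_nonneg_left (norm_add_le _ _) hK0'.le)
    have h6 : (K : ℝ) * (d * (‖a‖ * ε)) ≤ ‖a‖ / 2 := by
      have : (K : ℝ) * (d * (‖a‖ * ε)) = ‖a‖ / 2 * (d / (d + 1)) := by
        rw [hε]; field_simp
      rw [this]
      refine mul_le_of_le_one_right (by positivity) ?_
      rw [div_le_one (by positivity)]; linarith
    nlinarith [mul_le_mul_of_nonneg_left h1 hK0'.le]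
  have h3 : ‖u i‖ ≤ ‖a‖ * D := by
    rw [← ha i, norm_smul]
    refine mul_le_mul (norm_le_pi_norm a i) ((hq i).2.1.le.trans ?_) (norm_nonneg _) (norm_nonneg _)
    rw [hD]
    gcongr
    exact Finset.single_le_sum (f := fun i => ‖w i p‖) (fun i _ => norm_nonneg _)
      (Finset.mem_univ i)
  rw [one_div, inv_mul_le_iff₀ (by positivity)]
  nlinarith

lemma div_le_sum_div {a : Fin d → ℝ} (ha : ∀ i, 0 ≤ a i) (i j : Fin d) :
    a i / a j ≤ ∑ i, ∑ j, a i / a j :=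
  (Finset.single_le_sum (f := fun j => a i / a j) (fun j _ => div_nonneg (ha i) (ha j))
    (Finset.mem_univ j)).trans
    (Finset.single_le_sum (f := fun i => ∑ j, a i / a j)
      (fun i _ => Finset.sum_nonneg fun j _ => div_nonneg (ha i) (ha j)) (Finset.mem_univ i))

variable {F : RSpace d ≃ₜ RSpace d} {E E' : Fin d → Torus d → Submodule ℝ (RSpace d)}

namespace IsDominatedLineSplitting

lemma exists_basis {F : RSpace d → RSpace d} (h : IsDominatedLineSplitting F E) (p : Torus d) :
    ∃ e : Module.Basis (Fin d) ℝ (RSpace d), ∀ i, E i p = Submodule.span ℝ {e i} := by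
  have hc := fun i => h.continuous i p
  choose U hU w hwc hw using hc
  have hpU : ∀ i, p ∈ U i := fun i => mem_of_mem_nhds (hU i)
  have hli : LinearIndependent ℝ fun i => w i p :=
    (h.internal p).submodule_iSupIndep.linearIndependent _
      (fun i => by rw [(hw i p (hpU i)).2]; exact Submodule.mem_span_singleton_self _)
      fun i => (hw i p (hpU i)).1
  by_cases hd : d = 0
  · subst hd
    have : Subsingleton (RSpace 0) := by infer_instance
    exact ⟨Module.Basis.empty _, fun i => i.elim0⟩
  have : Nonempty (Fin d) := ⟨⟨0, Nat.pos_of_ne_zero hd⟩⟩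
  refine ⟨basisOfLinearIndependentOfCardEqFinrank hli (by simp), fun i => ?_⟩
  rw [coe_basisOfLinearIndependentOfCardEqFinrank]
  exact (hw i p (hpU i)).2

lemma map_iterate {F : RSpace d → RSpace d} (h : IsDominatedLineSplitting F E)
    (hF : Differentiable ℝ F) (i : Fin d) (n : ℕ) (x : RSpace d) :
    (E i (torusProj x)).map (fderiv ℝ F^[n] x).toLinearMap = E i (torusProj (F^[n] x)) := by
  induction n with
  | zero =>
    have : (fderiv ℝ F^[0] x).toLinearMap = LinearMap.id := by
      ext u
      simp
    rw [this, Submodule.map_id]; rfl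
  | succ n ih =>
    rw [fderiv_iterate_succ hF, ContinuousLinearMap.toLinearMap_comp, Submodule.map_comp, ih, h.invariant,
      Function.iterate_succ_apply']

lemma surjective_fderiv_iterate {F : RSpace d → RSpace d} (h : IsDominatedLineSplitting F E)
    (hF : Differentiable ℝ F) (n : ℕ) (x : RSpace d) :
    Function.Surjective (fderiv ℝ F^[n] x).toLinearMap := by
  have h1 : (⊤ : Submodule ℝ (RSpace d)).map (fderiv ℝ F^[n] x).toLinearMap = ⊤ := by
    conv_lhs => rw [← (h.internal (torusProj x)).submodule_iSup_eq_top]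
    rw [Submodule.map_iSup]
    simp only [h.map_iterate hF]
    exact (h.internal _).submodule_iSup_eq_top
  rw [← LinearMap.range_eq_top, ← Submodule.map_top, h1]

lemma isDominatedBasis_forward {F : RSpace d → RSpace d} (h : IsDominatedLineSplitting F E)
    (hF : Differentiable ℝ F) {x : RSpace d} {e : Module.Basis (Fin d) ℝ (RSpace d)}
    (he : ∀ i, E i (torusProj x) = Submodule.span ℝ {e i}) :
    IsDominatedBasis (fun n => (fderiv ℝ F^[n] x).toLinearMap) e := by
  have hmem : ∀ i, e i ∈ E i (torusProj x) := fun i => by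
    rw [he]; exact Submodule.mem_span_singleton_self _
  have hinj : ∀ n, Function.Injective (fderiv ℝ F^[n] x).toLinearMap := fun n =>
    LinearMap.injective_iff_surjective.2 (h.surjective_fderiv_iterate hF n x)
  refine ⟨fun n i => ?_, ?_, ?_⟩
  · rw [norm_pos_iff]
    exact fun h0 => e.ne_zero i (hinj n (h0.trans (map_zero _).symm))
  · obtain ⟨c, hc, hang⟩ := exists_transversality h.continuous h.internal
    refine ⟨c, hc, fun n a i => ?_⟩
    have := hang (torusProj (F^[n] x))
      (fun j => (fderiv ℝ F^[n] x).toLinearMap (a j • e j)) (fun j => by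
        rw [← h.map_iterate hF j n x]
        exact Submodule.mem_map_of_mem (Submodule.smul_mem _ _ (hmem j))) i
    rw [← map_sum, map_smul, norm_smul, Real.norm_eq_abs] at this
    exact this
  · obtain ⟨C, ρ, hC, hρ, hρ1, hdom⟩ := h.dominated
    refine ⟨C * ∑ i, ∑ j, ‖e i‖ / ‖e j‖, ρ, by positivity, hρ.le, hρ1, fun i j hij n => ?_⟩
    set S := ∑ i, ∑ j, ‖e i‖ / ‖e j‖
    have h1 := hdom i j hij x n _ (hmem i) _ (hmem j)
    have hj : 0 < ‖e j‖ := norm_pos_iff.2 (e.ne_zero j)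
    have h2 : ‖e i‖ / ‖e j‖ ≤ S :=
      div_le_sum_div (fun i => norm_nonneg (e i)) i j
    rw [← le_div_iff₀ hj] at h1
    refine h1.trans ?_
    calc _ = C * (‖e i‖ / ‖e j‖) * ρ ^ n * ‖fderiv ℝ F^[n] x (e j)‖ := by ring
      _ ≤ _ := by
        change _ ≤ C * S * ρ ^ n * ‖fderiv ℝ F^[n] x (e j)‖
        gcongr

/-- Under inverse iterates the strongest line becomes the weakest, so the same basis is dominated
after its order is reversed. -/
lemma isDominatedBasis_backward (h : IsDominatedLineSplitting F E) (hF : Differentiable ℝ F)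
    {x : RSpace d} {e : Module.Basis (Fin d) ℝ (RSpace d)}
    (he : ∀ i, E i (torusProj x) = Submodule.span ℝ {e i}) {T : ℕ → RSpace d →ₗ[ℝ] RSpace d}
    (hT : ∀ n u, fderiv ℝ (⇑F)^[n] ((⇑F.symm)^[n] x) (T n u) = u) :
    IsDominatedBasis T (e.reindex Fin.revPerm) := by
  have hmem : ∀ i, e i ∈ E i (torusProj x) := fun i => by
    rw [he]; exact Submodule.mem_span_singleton_self _
  have hinj : ∀ n, Function.Injective (fderiv ℝ (⇑F)^[n] ((⇑F.symm)^[n] x)).toLinearMap := fun n =>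
    LinearMap.injective_iff_surjective.2 (h.surjective_fderiv_iterate hF n _)
  have hFF : ∀ n, (⇑F)^[n] ((⇑F.symm)^[n] x) = x := fun n =>
    (Function.LeftInverse.iterate (g := F) (f := F.symm) F.apply_symm_apply n) x
  have hTmem : ∀ n i, T n (e i) ∈ E i (torusProj ((⇑F.symm)^[n] x)) := fun n i => by
    have h1 := hmem i
    have h2 := h.map_iterate hF i n ((⇑F.symm)^[n] x)
    rw [hFF] at h2
    rw [← h2] at h1
    obtain ⟨u, hu, hu'⟩ := h1
    have : T n (e i) = u := hinj n ((hT n (e i)).trans hu'.symm)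
    rwa [this]
  have hpos : ∀ n i, 0 < ‖T n (e i)‖ := fun n i => by
    rw [norm_pos_iff]
    intro h0
    have := hT n (e i)
    rw [h0, map_zero] at this
    exact e.ne_zero i this.symm
  refine ⟨fun n i => by simpa using hpos n (Fin.rev i), ?_, ?_⟩
  · obtain ⟨c, hc, hang⟩ := exists_transversality h.continuous h.internal
    refine ⟨c, hc, fun n a i => ?_⟩
    have := hang (torusProj ((⇑F.symm)^[n] x)) (fun j => T n (a (Fin.rev j) • e j)) (fun j => by
        rw [map_smul]
        exact Submodule.smul_mem _ _ (hTmem n j)) (Fin.rev i)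
    rw [← map_sum, map_smul, norm_smul, Real.norm_eq_abs, Fin.rev_rev] at this
    have h3 : ∑ j, a j • (e.reindex Fin.revPerm) j = ∑ j, a (Fin.rev j) • e j := by
      rw [← Equiv.sum_comp Fin.revPerm]
      simp
    rw [h3]
    simpa using this
  · obtain ⟨C, ρ, hC, hρ, hρ1, hdom⟩ := h.dominated
    refine ⟨C * ∑ i, ∑ j, ‖e i‖ / ‖e j‖, ρ, by positivity, hρ.le, hρ1, fun i j hij n => ?_⟩
    set S := ∑ i, ∑ j, ‖e i‖ / ‖e j‖
    simp only [Module.Basis.coe_reindex, Function.comp, Fin.revPerm_symm, Fin.revPerm_apply]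
    have h1 := hdom (Fin.rev j) (Fin.rev i) (Fin.rev_lt_rev.2 hij) ((⇑F.symm)^[n] x) n _
      (hTmem n _) _ (hTmem n _)
    rw [hT, hT] at h1
    have hj : 0 < ‖e (Fin.rev j)‖ := norm_pos_iff.2 (e.ne_zero _)
    have h2 : ‖e (Fin.rev i)‖ / ‖e (Fin.rev j)‖ ≤ S :=
      div_le_sum_div (fun i => norm_nonneg (e i)) _ _
    rw [mul_comm, ← le_div_iff₀ hj] at h1
    refine h1.trans ?_
    calc _ = C * (‖e (Fin.rev i)‖ / ‖e (Fin.rev j)‖) * ρ ^ n * ‖T n (e (Fin.rev j))‖ := by ring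
      _ ≤ _ := by gcongr

/-- Forward time kills the components of `e' k` of index above `k`, backward time those below, and
only the multiple of `e k` survives. -/
theorem unique (h : IsDominatedLineSplitting F E) (h' : IsDominatedLineSplitting F E')
    (hF : Differentiable ℝ F) : E = E' := by
  funext k p
  obtain ⟨x, rfl⟩ := surjective_torusProj p
  obtain ⟨e, he⟩ := h.exists_basis (torusProj x)
  obtain ⟨e', he'⟩ := h'.exists_basis (torusProj x)
  have hfwd : ∀ J, k < J → e.repr (e' k) J = 0 := fun J hJ =>
    (h.isDominatedBasis_forward hF he).repr_eq_zero (h'.isDominatedBasis_forward hF he') hJ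
  have hsurj := fun n => h.surjective_fderiv_iterate hF n ((⇑F.symm)^[n] x)
  have hbij : ∀ n, Function.Bijective (fderiv ℝ (⇑F)^[n] ((⇑F.symm)^[n] x)).toLinearMap :=
    fun n => ⟨LinearMap.injective_iff_surjective.2 (hsurj n), hsurj n⟩
  let T : ℕ → RSpace d →ₗ[ℝ] RSpace d := fun n => (LinearEquiv.ofBijective _ (hbij n)).symm
  have hT : ∀ n u, fderiv ℝ (⇑F)^[n] ((⇑F.symm)^[n] x) (T n u) = u := fun n u =>
    (LinearEquiv.ofBijective _ (hbij n)).apply_symm_apply u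
  have hbwd : ∀ J, J < k → e.repr (e' k) J = 0 := fun J hJ => by
    have := (h.isDominatedBasis_backward hF he hT).repr_eq_zero
      (h'.isDominatedBasis_backward hF he' hT) (Fin.rev_lt_rev.2 hJ)
    simpa using this
  have hek : e' k = e.repr (e' k) k • e k := by
    conv_lhs => rw [← e.sum_repr (e' k)]
    refine Finset.sum_eq_single k (fun J _ hJ => ?_) (by simp)
    rcases lt_or_gt_of_ne hJ with hlt | hlt
    · rw [hbwd J hlt, zero_smul]
    · rw [hfwd J hlt, zero_smul]
  have hne : e.repr (e' k) k ≠ 0 := fun h0 => e'.ne_zero k (by rw [hek, h0, zero_smul])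
  rw [he, he', hek, Submodule.span_singleton_smul_eq (IsUnit.mk0 _ hne)]

end IsDominatedLineSplitting

end Uniqueness

/-! ### Hyperbolicity, shadowing and bounded Birkhoff sums -/

/-- A perturbation of size `κ` of `diag β` is hyperbolic with rate `μ`. -/
structure IsHyperbolicGap {d : ℕ} (β : Fin d → ℝ) (κ μ : ℝ) : Prop where
  one_lt : 1 < μ
  ne_one : ∀ i, |β i| ≠ 1
  unstable : ∀ i, 1 < |β i| → μ + κ ≤ |β i|
  stable : ∀ i, |β i| < 1 → |β i| + κ ≤ μ⁻¹

/-- `H` is a lift to `ℝ^d` of a conjugacy between the linear map of `A` and the torus map with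
lift `F`, and `B` is its action on the lattice. -/
structure IsConjugacyLift {d : ℕ} (A : Matrix (Fin d) (Fin d) ℤ) (F H : RSpace d → RSpace d)
    (B : RSpace d →L[ℝ] RSpace d) : Prop where
  continuous : Continuous H
  semiconj : ∃ k, ∀ x, H (linLift A x) = F (H x) + latticeVec k
  translate : ∀ x k, H (x + latticeVec k) = H x + B (latticeVec k)
  lattice : ∀ k, ∃ l, B (latticeVec k) = latticeVec l
  bounded : ∃ C : ℝ, 0 ≤ C ∧ ∀ x, ‖H x - B x‖ ≤ C

/-- The Birkhoff sums of `φ ∘ H` along the linear map of `A`. -/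
noncomputable def birkhoff {d : ℕ} (A : Matrix (Fin d) (Fin d) ℤ) (H : RSpace d → RSpace d)
    (φ : RSpace d → ℝ) (n : ℕ) (x : RSpace d) : ℝ :=
  ∑ k ∈ Finset.range n, φ (H ((linLift A)^[k] x))

section Hyperbolicity

variable {d : ℕ} {β : Fin d → ℝ} {v : Module.Basis (Fin d) ℝ (RSpace d)} {κ μ : ℝ}

/-- The coordinate of largest modulus of `z` may be chosen unstable. -/
def IsUnstableDominant (β : Fin d → ℝ) (v : Module.Basis (Fin d) ℝ (RSpace d)) (z : RSpace d) :
    Prop := ∃ i, 1 < |β i| ∧ |v.repr z i| = coordNorm v z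

namespace IsHyperbolicGap

/-- Cone argument in the supremum norm: a dominating unstable coordinate is multiplied by at least
`μ`, while every stable coordinate of the image is at most `coordNorm v z` in modulus, so an
unstable coordinate dominates again. -/
lemma mul_coordNorm_le (G : IsHyperbolicGap β κ μ) (hd : 0 < d) {z z' : RSpace d}
    (h : ∀ i, |v.repr z' i - β i * v.repr z i| ≤ κ * coordNorm v z)
    (hz : IsUnstableDominant β v z) :
    μ * coordNorm v z ≤ coordNorm v z' ∧ IsUnstableDominant β v z' := by
  obtain ⟨i, hi, hiz⟩ := hz
  have hN := coordNorm_nonneg (v := v) z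
  have h1 : μ * coordNorm v z ≤ |v.repr z' i| := by
    have e1 := abs_sub (v.repr z' i) (v.repr z' i - β i * v.repr z i)
    rw [sub_sub_cancel, abs_mul, hiz] at e1
    nlinarith [h i, G.unstable i hi]
  refine ⟨h1.trans (abs_repr_le _ i), ?_⟩
  obtain ⟨j, hj⟩ := exists_coordNorm_eq hd (v := v) z'
  rcases lt_or_gt_of_ne (G.ne_one j) with hlt | hgt
  · refine ⟨i, hi, le_antisymm (abs_repr_le _ i) ?_⟩
    rw [← hj]
    have e1 := abs_add_le (v.repr z' j - β j * v.repr z j) (β j * v.repr z j)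
    rw [sub_add_cancel, abs_mul] at e1
    have e2 := mul_le_mul_of_nonneg_left (abs_repr_le (v := v) z j) (abs_nonneg (β j))
    have e3 : |β j| + κ ≤ μ := (G.stable j hlt).trans
      ((inv_le_one_of_one_le₀ G.one_lt.le).trans G.one_lt.le)
    nlinarith [h j]
  · exact ⟨j, hgt, hj⟩

lemma coordNorm_le_of_not (G : IsHyperbolicGap β κ μ) (hd : 0 < d) {z z' : RSpace d}
    (h : ∀ i, |v.repr z' i - β i * v.repr z i| ≤ κ * coordNorm v z)
    (hz : ¬IsUnstableDominant β v z') : coordNorm v z' ≤ μ⁻¹ * coordNorm v z := by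
  obtain ⟨j, hj⟩ := exists_coordNorm_eq hd (v := v) z'
  have hN := coordNorm_nonneg (v := v) z
  rcases lt_or_gt_of_ne (G.ne_one j) with hlt | hgt
  · have e1 := abs_add_le (v.repr z' j - β j * v.repr z j) (β j * v.repr z j)
    rw [sub_add_cancel, abs_mul] at e1
    have e2 := mul_le_mul_of_nonneg_left (abs_repr_le (v := v) z j) (abs_nonneg (β j))
    have e3 := G.stable j hlt
    rw [← hj]
    nlinarith [h j]
  · exact absurd ⟨j, hgt, hj⟩ hz

/-- If an unstable coordinate dominates at time `k`, it does so until time `n`, and the expansion up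
to the bound `C` gives the factor `μ⁻¹ ^ (n - k)`. Otherwise no unstable coordinate dominated at any
earlier time, and contraction from time `0` gives `μ⁻¹ ^ k`. -/
lemma coordNorm_le_of_bounded (G : IsHyperbolicGap β κ μ) (hd : 0 < d) {Z : ℕ → RSpace d} {n : ℕ}
    (h : ∀ k < n, ∀ i, |v.repr (Z (k + 1)) i - β i * v.repr (Z k) i| ≤ κ * coordNorm v (Z k))
    {C : ℝ} (hC : ∀ k ≤ n, coordNorm v (Z k) ≤ C) {k : ℕ} (hk : k ≤ n) :
    coordNorm v (Z k) ≤ C * (μ⁻¹ ^ k + μ⁻¹ ^ (n - k)) := by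
  have hμ : 0 < μ := one_pos.trans G.one_lt
  have hC0 : 0 ≤ C := (coordNorm_nonneg _).trans (hC 0 (Nat.zero_le n))
  by_cases hu : IsUnstableDominant β v (Z k)
  · have key : ∀ j, k + j ≤ n → μ ^ j * coordNorm v (Z k) ≤ coordNorm v (Z (k + j)) ∧
        IsUnstableDominant β v (Z (k + j)) := by
      intro j
      induction j with
      | zero => intro _; simpa using hu
      | succ j ih =>
        intro hj
        obtain ⟨h1, h2⟩ := ih (by omega)
        obtain ⟨h3, h4⟩ := G.mul_coordNorm_le hd (h (k + j) (by omega)) h2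
        refine ⟨?_, h4⟩
        calc μ ^ (j + 1) * coordNorm v (Z k) = μ * (μ ^ j * coordNorm v (Z k)) := by ring
          _ ≤ μ * coordNorm v (Z (k + j)) := mul_le_mul_of_nonneg_left h1 hμ.le
          _ ≤ _ := h3
    have h1 := (key (n - k) (by omega)).1.trans (hC _ (by omega))
    have h2 : coordNorm v (Z k) ≤ C * μ⁻¹ ^ (n - k) := by
      rw [inv_pow, ← div_eq_mul_inv, le_div_iff₀ (by positivity), mul_comm]
      exact h1
    have h3 : 0 ≤ C * μ⁻¹ ^ k := by positivity
    linarith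
  · have key : ∀ j, j ≤ n → ¬IsUnstableDominant β v (Z j) →
        coordNorm v (Z j) ≤ C * μ⁻¹ ^ j := by
      intro j
      induction j with
      | zero => intro _ _; simpa using hC 0 (Nat.zero_le n)
      | succ j ih =>
        intro hj hnot
        have h1 := G.coordNorm_le_of_not hd (h j (by omega)) hnot
        have h2 := ih (by omega) fun hu => hnot (G.mul_coordNorm_le hd (h j (by omega)) hu).2
        calc _ ≤ μ⁻¹ * coordNorm v (Z j) := h1
          _ ≤ μ⁻¹ * (C * μ⁻¹ ^ j) := mul_le_mul_of_nonneg_left h2 (by positivity)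
          _ = _ := by ring
    have h1 := key k hk hu
    have h3 : 0 ≤ C * μ⁻¹ ^ (n - k) := by positivity
    linarith

end IsHyperbolicGap

lemma sum_geom_two_sided_le {s : ℝ} (hs : 0 ≤ s) (hs1 : s < 1) (n : ℕ) :
    ∑ k ∈ Finset.range n, (s ^ k + s ^ (n - k)) ≤ 2 / (1 - s) := by
  have h1 : ∀ n : ℕ, ∑ k ∈ Finset.range n, s ^ k ≤ 1 / (1 - s) := fun n => by
    have := Summable.sum_le_tsum (Finset.range n) (fun k _ => pow_nonneg hs k)
      (summable_geometric_of_lt_one hs hs1)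
    rwa [tsum_geometric_of_lt_one hs hs1, ← one_div] at this
  have h2 : ∑ k ∈ Finset.range n, s ^ (n - k) ≤ 1 / (1 - s) := by
    refine le_trans ?_ (h1 n)
    rw [← Finset.sum_range_reflect (fun k => s ^ k) n]
    refine Finset.sum_le_sum fun k _ => pow_le_pow_of_le_one hs hs1.le (by omega)
  rw [Finset.sum_add_distrib]
  have := h1 n
  have h3 : 2 / (1 - s) = 1 / (1 - s) + 1 / (1 - s) := by ring
  linarith

variable {A : Matrix (Fin d) (Fin d) ℤ}

lemma repr_linLift_iterate (hv : ∀ i, linLift A (v i) = β i • v i) (k : ℕ) (x : RSpace d)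
    (i : Fin d) : v.repr ((linLift A)^[k] x) i = β i ^ k * v.repr x i := by
  induction k with
  | zero => simp
  | succ k ih => rw [Function.iterate_succ_apply', repr_linLift hv, ih]; ring

lemma linLift_iterate_sub (k : ℕ) (x y : RSpace d) :
    (linLift A)^[k] (x - y) = (linLift A)^[k] x - (linLift A)^[k] y := by
  induction k with
  | zero => rfl
  | succ k ih => rw [Function.iterate_succ_apply', Function.iterate_succ_apply',
      Function.iterate_succ_apply', ih, map_sub]

lemma IsConjugacyLift.exists_norm_sub_le {F H : RSpace d → RSpace d} {B : RSpace d →L[ℝ] RSpace d}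
    (hH : IsConjugacyLift A F H B) :
    ∃ D : ℝ, 0 ≤ D ∧ ∀ x y, ‖H x - H y‖ ≤ D * (1 + ‖x - y‖) := by
  obtain ⟨C, hC0, hC⟩ := hH.bounded
  refine ⟨2 * C + ‖B‖, by positivity, fun x y => ?_⟩
  have h1 : H x - H y = (H x - B x) - (H y - B y) + B (x - y) := by rw [map_sub]; abel
  rw [h1]
  have h2 := norm_add_le ((H x - B x) - (H y - B y)) (B (x - y))
  have h3 := norm_sub_le (H x - B x) (H y - B y)
  have h4 := B.le_opNorm (x - y)
  have := norm_nonneg (x - y)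
  have := norm_nonneg B
  nlinarith [hC x, hC y, mul_nonneg hC0 (norm_nonneg (x - y))]

/-- Two linear orbits that stay at bounded distance from each other have Birkhoff sums at bounded
distance. -/
theorem exists_birkhoff_sub_le (G : IsHyperbolicGap β κ μ) (hd : 0 < d)
    {F H : RSpace d → RSpace d} {B : RSpace d →L[ℝ] RSpace d} (hF : IsNearDiagonal β v κ F)
    (hH : IsConjugacyLift A F H B) {φ : RSpace d → ℝ} {L θ : ℝ} (hL : 0 ≤ L) (hθ : 0 < θ)
    (hθ1 : θ ≤ 1) (hφ : ∀ x y, |φ x - φ y| ≤ L * ‖x - y‖ ^ θ) (C : ℝ) (hC0 : 0 ≤ C) :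
    ∃ K : ℝ, 0 ≤ K ∧ ∀ n x y, (∀ k ≤ n, coordNorm v ((linLift A)^[k] (x - y)) ≤ C) →
      |birkhoff A H φ n x - birkhoff A H φ n y| ≤ K := by
  obtain ⟨Cv, hCv1, hCv, hCv'⟩ := exists_coordNorm_equiv v
  obtain ⟨D, hD0, hD⟩ := hH.exists_norm_sub_le
  obtain ⟨k₀, hk₀⟩ := hH.semiconj
  have hμ : 0 < μ := one_pos.trans G.one_lt
  set s : ℝ := μ⁻¹ ^ θ with hs
  have hs0 : 0 ≤ s := by positivity
  have hs1 : s < 1 := Real.rpow_lt_one (by positivity) (inv_lt_one_of_one_lt₀ G.one_lt) hθ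
  set C₁ : ℝ := Cv * (D * (1 + Cv * C)) with hC₁
  have hC₁0 : 0 ≤ C₁ := by positivity
  refine ⟨L * (Cv * C₁) ^ θ * (2 / (1 - s)), mul_nonneg (by positivity)
    (div_nonneg two_pos.le (by linarith)), fun n x y hxy => ?_⟩
  -- The lattice vector in the semiconjugacy cancels in the difference, so `Z` evolves exactly by
  -- differences of `F`; it is bounded because `H` is coarsely Lipschitz, hence small away from both
  -- ends.
  set Z : ℕ → RSpace d := fun k => H ((linLift A)^[k] x) - H ((linLift A)^[k] y) with hZ
  have hstep : ∀ k < n, ∀ i,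
      |v.repr (Z (k + 1)) i - β i * v.repr (Z k) i| ≤ κ * coordNorm v (Z k) := fun k _ i => by
    have : Z (k + 1) = F (H ((linLift A)^[k] x)) - F (H ((linLift A)^[k] y)) := by
      simp only [hZ, Function.iterate_succ_apply', hk₀]
      abel
    rw [this]
    exact hF _ _ i
  have hbd : ∀ k ≤ n, coordNorm v (Z k) ≤ C₁ := fun k hk => by
    refine (hCv _).trans ?_
    rw [hC₁]
    gcongr
    refine (hD _ _).trans ?_
    gcongr
    rw [← linLift_iterate_sub]
    exact (hCv' _).trans (mul_le_mul_of_nonneg_left (hxy k hk) (by linarith))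
  rw [birkhoff, birkhoff, ← Finset.sum_sub_distrib]
  refine (Finset.abs_sum_le_sum_abs _ _).trans ?_
  refine le_trans ?_ (mul_le_mul_of_nonneg_left (sum_geom_two_sided_le hs0 hs1 n) (by positivity))
  rw [Finset.mul_sum]
  refine Finset.sum_le_sum fun k hk => ?_
  have hk' := (Finset.mem_range.1 hk).le
  refine (hφ _ _).trans ?_
  rw [mul_assoc]
  refine mul_le_mul_of_nonneg_left ?_ hL
  have h1 : ‖Z k‖ ≤ Cv * C₁ * (μ⁻¹ ^ k + μ⁻¹ ^ (n - k)) := by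
    refine (hCv' _).trans ?_
    rw [mul_assoc]
    exact mul_le_mul_of_nonneg_left (G.coordNorm_le_of_bounded hd hstep hbd hk') (by linarith)
  have h2 : ∀ j : ℕ, (μ⁻¹ ^ j) ^ θ = s ^ j := fun j => by
    rw [hs, ← Real.rpow_natCast, ← Real.rpow_natCast, ← Real.rpow_mul (by positivity),
      ← Real.rpow_mul (by positivity), mul_comm]
  calc ‖Z k‖ ^ θ ≤ (Cv * C₁ * (μ⁻¹ ^ k + μ⁻¹ ^ (n - k))) ^ θ :=
        Real.rpow_le_rpow (norm_nonneg _) h1 hθ.le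
    _ = (Cv * C₁) ^ θ * (μ⁻¹ ^ k + μ⁻¹ ^ (n - k)) ^ θ :=
        Real.mul_rpow (by positivity) (by positivity)
    _ ≤ (Cv * C₁) ^ θ * (s ^ k + s ^ (n - k)) := by
        refine mul_le_mul_of_nonneg_left ?_ (by positivity)
        rw [← h2, ← h2]
        exact Real.rpow_add_le_add_rpow (by positivity) (by positivity) hθ.le hθ1

/-- Uniform bound, over all lengths `n`, for the orbit that corrects the closing error: small near
time `0` in unstable directions and near time `n` in stable ones. -/
lemma exists_pow_div_le {b : ℝ} (hb : |b| ≠ 1) :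
    ∃ D : ℝ, 0 ≤ D ∧ ∀ k n : ℕ, k ≤ n → 1 ≤ n → b ^ n - 1 ≠ 0 ∧ |b ^ k / (b ^ n - 1)| ≤ D := by
  rcases lt_or_gt_of_ne hb with h | h
  · refine ⟨1 / (1 - |b|), div_nonneg zero_le_one (by linarith), fun k n hk hn => ?_⟩
    have h1 : |b| ^ n ≤ |b| := by
      simpa using pow_le_pow_of_le_one (abs_nonneg b) h.le hn
    have h2 : 1 - |b| ≤ |b ^ n - 1| := by
      have := abs_sub_abs_le_abs_sub 1 (b ^ n)
      rw [abs_one, abs_pow, abs_sub_comm] at this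
      linarith
    refine ⟨abs_pos.1 (by linarith), ?_⟩
    rw [abs_div]
    exact div_le_div₀ zero_le_one (by rw [abs_pow]; exact pow_le_one₀ (abs_nonneg b) h.le)
      (by linarith) h2
  · refine ⟨1 / (1 - |b|⁻¹), div_nonneg zero_le_one
      (by linarith [inv_lt_one_of_one_lt₀ h]), fun k n hk hn => ?_⟩
    have hinv := inv_lt_one_of_one_lt₀ h
    have hb0 : 0 < |b| := by linarith
    have h1 : 1 ≤ |b| ^ n * |b|⁻¹ := by
      obtain ⟨j, rfl⟩ := Nat.exists_eq_add_of_le hn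
      rw [pow_add, pow_one, mul_comm |b|, mul_assoc, mul_inv_cancel₀ hb0.ne', mul_one]
      exact one_le_pow₀ h.le
    have h2 : |b| ^ n * (1 - |b|⁻¹) ≤ |b ^ n - 1| := by
      have := abs_sub_abs_le_abs_sub (b ^ n) 1
      rw [abs_one, abs_pow] at this
      linarith
    have h3 : 0 < |b| ^ n * (1 - |b|⁻¹) := mul_pos (by positivity) (by linarith)
    refine ⟨abs_pos.1 (h3.trans_le h2), ?_⟩
    rw [abs_div, abs_pow, div_le_div_iff₀ (h3.trans_le h2) (by linarith)]
    have h4 : |b| ^ k ≤ |b| ^ n := pow_le_pow_right₀ h.le hk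
    nlinarith [mul_le_mul_of_nonneg_right h4 (by linarith : 0 ≤ 1 - |b|⁻¹)]

/-- Closing lemma for the linear map: every orbit segment is followed at bounded distance by a
periodic orbit of the same length. -/
lemma exists_closing (hv : ∀ i, linLift A (v i) = β i • v i) (hβ : ∀ i, |β i| ≠ 1) :
    ∃ C : ℝ, 0 ≤ C ∧ ∀ n, 1 ≤ n → ∀ x, ∃ y, (∃ k, (linLift A)^[n] y = y + latticeVec k) ∧
      ∀ k ≤ n, coordNorm v ((linLift A)^[k] (x - y)) ≤ C := by
  obtain ⟨Cv, hCv1, hCv, -⟩ := exists_coordNorm_equiv v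
  obtain ⟨R, hR⟩ := (isCompact_unitCube (d := d)).isBounded.exists_norm_le
  choose D hD0 hD using fun i => exists_pow_div_le (hβ i)
  have hS := Finset.sum_nonneg fun i (_ : i ∈ Finset.univ) => hD0 i
  refine ⟨(∑ i, D i) * (Cv * |R|), by positivity, fun n hn x => ?_⟩
  obtain ⟨l, hl⟩ := exists_latticeVec_bounded ((linLift A)^[n] x - x)
  set e := (linLift A)^[n] x - x + latticeVec l with he
  have heN : coordNorm v e ≤ Cv * |R| := (hCv e).trans
    (mul_le_mul_of_nonneg_left ((hR e hl).trans (le_abs_self R)) (by linarith))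
  -- The solution of `A ^ n z - z = e`; subtracting it from `x` leaves exactly a lattice vector as
  -- the displacement after `n` steps.
  set z : RSpace d := ∑ i, (v.repr e i / (β i ^ n - 1)) • v i with hz
  have hzr : ∀ i, v.repr z i = v.repr e i / (β i ^ n - 1) := fun i => by
    rw [hz, v.repr_sum_self]
  have hze : (linLift A)^[n] z - z = e := by
    apply v.repr.injective
    ext i
    rw [map_sub, Finsupp.sub_apply, repr_linLift_iterate hv, hzr]
    have := (hD i 0 n (Nat.zero_le n) hn).1
    field_simp
  refine ⟨x - z, ⟨-l, ?_⟩, fun k hk => ?_⟩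
  · rw [linLift_iterate_sub, latticeVec_neg]
    have h1 : (linLift A)^[n] z = z + e := by rw [← hze]; abel
    rw [h1, he]; abel
  · rw [sub_sub_cancel]
    refine coordNorm_le (by positivity) fun i => ?_
    rw [repr_linLift_iterate hv, hzr]
    have h1 : β i ^ k * (v.repr e i / (β i ^ n - 1)) = β i ^ k / (β i ^ n - 1) * v.repr e i := by
      ring
    rw [h1, abs_mul]
    exact mul_le_mul ((hD i k n hk hn).2.trans (Finset.single_le_sum (fun i _ => hD0 i)
      (Finset.mem_univ i))) ((abs_repr_le e i).trans heN) (abs_nonneg _) hS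

/-- Every orbit segment is accompanied at bounded distance by a periodic orbit of the same length,
whose Birkhoff sum is `n * lam`. -/
theorem exists_birkhoff_sub_const_le (G : IsHyperbolicGap β κ μ) (hd : 0 < d)
    (hv : ∀ i, linLift A (v i) = β i • v i)
    {F H : RSpace d → RSpace d} {B : RSpace d →L[ℝ] RSpace d} (hF : IsNearDiagonal β v κ F)
    (hH : IsConjugacyLift A F H B) {φ : RSpace d → ℝ} {L θ lam : ℝ} (hL : 0 ≤ L) (hθ : 0 < θ)
    (hθ1 : θ ≤ 1) (hφ : ∀ x y, |φ x - φ y| ≤ L * ‖x - y‖ ^ θ)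
    (hper : ∀ n y, 1 ≤ n → (∃ k, (linLift A)^[n] y = y + latticeVec k) →
      birkhoff A H φ n y = n * lam) :
    ∃ K : ℝ, 0 ≤ K ∧ ∀ n x, |birkhoff A H φ n x - n * lam| ≤ K := by
  obtain ⟨C, hC0, hC⟩ := exists_closing hv G.ne_one
  obtain ⟨K, hK0, hK⟩ := exists_birkhoff_sub_le G hd hF hH hL hθ hθ1 hφ C hC0
  refine ⟨K, hK0, fun n x => ?_⟩
  rcases Nat.eq_zero_or_pos n with rfl | hn
  · simpa [birkhoff] using hK0
  · obtain ⟨y, hy, hxy⟩ := hC n hn x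
    rw [← hper n y hn hy]
    exact hK n x y hxy

end Hyperbolicity

/-! ### Equality of the periodic data with those of the fixed point -/

/-- The identity is the only order automorphism of `Fin d`. Thus spectra known to coincide as sets
coincide line by line. -/
lemma eq_of_strictMono_of_forall_exists_eq {d : ℕ} {p q : Fin d → ℝ} (hp : StrictMono p)
    (hq : StrictMono q) (h : ∀ i, ∃ j, p i = q j) : p = q := by
  choose σ hσ using h
  have hmono : StrictMono σ := fun i j hij => by
    rw [← hq.lt_iff_lt, ← hσ, ← hσ]
    exact hp hij
  have hsurj : Function.Surjective σ := Finite.injective_iff_surjective.1 hmono.injective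
  have : hmono.orderIsoOfSurjective σ hsurj = OrderIso.refl _ := Subsingleton.elim _ _
  have hid : ∀ i, σ i = i := fun i => congrArg (fun e : Fin d ≃o Fin d => e i) this
  funext i
  rw [hσ, hid]

lemma tendsto_inv_mul_of_abs_sub_le {a : ℕ → ℝ} {s K : ℝ} (h : ∀ n, |a n - n * s| ≤ K) :
    Filter.Tendsto (fun n : ℕ => 1 / (n : ℝ) * a n) Filter.atTop (nhds s) := by
  have hK : Filter.Tendsto (fun n : ℕ => K / (n : ℝ)) Filter.atTop (nhds 0) :=
    tendsto_const_div_atTop_nhds_zero_nat K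
  rw [tendsto_iff_norm_sub_tendsto_zero]
  refine squeeze_zero' (Filter.Eventually.of_forall fun _ => norm_nonneg _) ?_ hK
  filter_upwards [Filter.eventually_gt_atTop 0] with n hn
  have hn' : (0 : ℝ) < n := Nat.cast_pos.2 hn
  have : 1 / (n : ℝ) * a n - s = (a n - n * s) / n := by field_simp
  rw [this, Real.norm_eq_abs, abs_div, abs_of_pos hn']
  exact div_le_div_of_nonneg_right (h n) hn'.le

section PeriodicData

variable {d : ℕ} {β : Fin d → ℝ} {v : Module.Basis (Fin d) ℝ (RSpace d)} {κ η θ q μ : ℝ}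
  {A : Matrix (Fin d) (Fin d) ℤ} {W : Fin d → RSpace d → RSpace d} {c : Fin d → RSpace d → ℝ}

namespace IsInvariantFrame

variable {F : RSpace d → RSpace d}

lemma multiplier_ne_zero (h : IsInvariantFrame β v κ η θ F W c) (G : SpectralGap β κ η q)
    (i : Fin d) (x : RSpace d) : c i x ≠ 0 := abs_pos.1 <|
  (sub_pos.2 (G.κ_lt i)).trans_le (h.le_abs_multiplier i x)

lemma abs_multiplier_lt (h : IsInvariantFrame β v κ η θ F W c) (G : SpectralGap β κ η q)
    {i j : Fin d} (hij : i < j) (x y : RSpace d) : |c i x| < |c j y| := by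
  have h1 := h.abs_multiplier_le i x
  have h2 := h.le_abs_multiplier j y
  have h3 := G.rate i j hij
  have h4 : 0 < |β j| - κ := sub_pos.2 (G.κ_lt j)
  have h5 : q * (|β j| - κ) < |β j| - κ := mul_lt_of_lt_one_left h4 G.q_lt_one
  linarith [G.κ_nonneg]

lemma multiplier_eq (h : IsInvariantFrame β v κ η θ F W c) (i : Fin d) {x y : RSpace d}
    (hxy : torusProj x = torusProj y) : c i x = c i y := by
  obtain ⟨k, rfl⟩ := torusProj_eq_iff.1 hxy
  exact h.multiplier_periodic i y k

lemma frame_eq (h : IsInvariantFrame β v κ η θ F W c) (i : Fin d) {x y : RSpace d}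
    (hxy : torusProj x = torusProj y) : W i x = W i y := by
  obtain ⟨k, rfl⟩ := torusProj_eq_iff.1 hxy
  exact h.periodic i y k

lemma exists_coeff (h : IsInvariantFrame β v κ η θ F W c) (G : SpectralGap β κ η q)
    (hη : 2 * d * η ≤ 1) (x u : RSpace d) : ∃ a : Fin d → ℝ, ∑ i, a i • W i x = u := by
  have hspan := (h.linearIndependent hη G.η_nonneg x).span_eq_top_of_card_eq_finrank' (by simp)
  have : u ∈ Submodule.span ℝ (Set.range fun m => W m x) := by rw [hspan]; trivial
  exact (Submodule.mem_span_range_iff_exists_fun ℝ).1 this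

lemma coeff_eq_zero (h : IsInvariantFrame β v κ η θ F W c) (G : SpectralGap β κ η q)
    (hη : 2 * d * η ≤ 1) {x : RSpace d} {a : Fin d → ℝ} (ha : ∑ i, a i • W i x = 0) (i : Fin d) :
    a i = 0 :=
  Fintype.linearIndependent_iff.1 (h.linearIndependent hη G.η_nonneg x) a ha i

/-- The exponential growth rate of a vector is that of its dominating component in the frame. -/
lemma tendsto_log_norm_fderiv_iterate (h : IsInvariantFrame β v κ η θ F W c)
    (G : SpectralGap β κ η q) (hη : 2 * d * η ≤ 1) {T : RSpace d → RSpace d}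
    {b : Fin d → RSpace d → ℝ} (hT : Differentiable ℝ T)
    (hb : ∀ i x, fderiv ℝ T x (W i x) = b i x • W i (T x)) (hb0 : ∀ i x, b i x ≠ 0)
    {x u : RSpace d} {a : Fin d → ℝ} (hu : ∑ i, a i • W i x = u) {I : Fin d} (hI : a I ≠ 0)
    (hdom : ∀ i, a i ≠ 0 → ∀ y, |b i y| ≤ |b I y|) {s K : ℝ}
    (hs : ∀ n : ℕ, |∑ k ∈ Finset.range n, Real.log |b I (T^[k] x)| - n * s| ≤ K) :
    Filter.Tendsto (fun n : ℕ => 1 / (n : ℝ) * Real.log ‖fderiv ℝ T^[n] x u‖) Filter.atTop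
      (nhds s) := by
  obtain ⟨C, hC1, hC, hC'⟩ := exists_coordNorm_equiv v
  have hC0 : 0 < C := by linarith
  set S := ∑ i, |a i| with hS
  have hI' : 0 < |a I| := abs_pos.2 hI
  have hS0 : 0 < S := hI'.trans_le
    (Finset.single_le_sum (f := fun i => |a i|) (fun i _ => abs_nonneg _) (Finset.mem_univ I))
  set P : ℕ → Fin d → ℝ := fun n i => ∏ k ∈ Finset.range n, b i (T^[k] x) with hP
  have hPI : ∀ n, 0 < |P n I| := fun n => abs_pos.2 (Finset.prod_ne_zero_iff.2 fun k _ => hb0 I _)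
  have hval : ∀ n, fderiv ℝ T^[n] x u = ∑ i, (a i * P n i) • W i (T^[n] x) := fun n => by
    rw [← hu, map_sum]
    refine Finset.sum_congr rfl fun i _ => ?_
    rw [map_smul, fderiv_iterate_of_invariant hT (hb i), smul_smul]
  have low : ∀ n, |a I| * |P n I| ≤ 2 * C * ‖fderiv ℝ T^[n] x u‖ := fun n => by
    have h1 := h.abs_coeff_le hη G.η_nonneg (fun i => a i * P n i) (T^[n] x) I
    rw [← hval, abs_mul] at h1
    nlinarith [hC (fderiv ℝ T^[n] x u)]
  have up : ∀ n, ‖fderiv ℝ T^[n] x u‖ ≤ S * C * |P n I| := fun n => by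
    rw [hval]
    refine (norm_sum_le _ _).trans ?_
    rw [hS, Finset.sum_mul, Finset.sum_mul]
    refine Finset.sum_le_sum fun i _ => ?_
    rw [norm_smul, Real.norm_eq_abs, abs_mul]
    by_cases hi : a i = 0
    · simp [hi]
    have h1 : |P n i| ≤ |P n I| := by
      simp only [hP, Finset.abs_prod]
      exact Finset.prod_le_prod (fun _ _ => abs_nonneg _) fun k _ => hdom i hi _
    have h2 : ‖W i (T^[n] x)‖ ≤ C := (hC' _).trans
      (mul_le_of_le_one_right hC0.le (h.coordNorm_le_one G.η_le_one i _))
    calc |a i| * |P n i| * ‖W i (T^[n] x)‖ ≤ |a i| * |P n I| * C := by gcongr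
      _ = _ := by ring
  have hlogP : ∀ n, Real.log |P n I| = ∑ k ∈ Finset.range n, Real.log |b I (T^[k] x)| := fun n => by
    simp only [hP, Finset.abs_prod]
    exact Real.log_prod fun k _ => (abs_pos.2 (hb0 I _)).ne'
  refine tendsto_inv_mul_of_abs_sub_le
    (K := K + |Real.log (2 * C / |a I|)| + |Real.log (S * C)|) fun n => ?_
  have hpos : 0 < ‖fderiv ℝ T^[n] x u‖ := by
    have h1 := low n
    have h2 := mul_pos hI' (hPI n)
    by_contra hcon
    rw [le_antisymm (not_lt.1 hcon) (norm_nonneg _), mul_zero] at h1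
    exact absurd h2 (not_lt.2 h1)
  have e1 : Real.log ‖fderiv ℝ T^[n] x u‖ ≤ Real.log (S * C) + Real.log |P n I| := by
    rw [← Real.log_mul (by positivity) (hPI n).ne']
    exact Real.log_le_log hpos (up n)
  have e2 : Real.log |P n I| ≤ Real.log (2 * C / |a I|) + Real.log ‖fderiv ℝ T^[n] x u‖ := by
    rw [← Real.log_mul (by positivity) hpos.ne']
    refine Real.log_le_log (hPI n) ?_
    rw [div_mul_eq_mul_div, le_div_iff₀ hI', mul_comm]
    exact low n
  have e3 := hs n
  rw [← hlogP, abs_le] at e3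
  rw [abs_le]
  constructor
  · linarith [le_abs_self (Real.log (2 * C / |a I|)), abs_nonneg (Real.log (S * C))]
  · linarith [le_abs_self (Real.log (S * C)), abs_nonneg (Real.log (2 * C / |a I|))]

end IsInvariantFrame

namespace IsConjugacyLift

variable {F : RSpace d → RSpace d} {H : RSpace d → RSpace d} {B : RSpace d →L[ℝ] RSpace d}

lemma torusProj_eq (hH : IsConjugacyLift A F H B) {x y : RSpace d}
    (h : torusProj x = torusProj y) : torusProj (H x) = torusProj (H y) := by
  obtain ⟨k, rfl⟩ := torusProj_eq_iff.1 h
  obtain ⟨l, hl⟩ := hH.lattice k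
  rw [hH.translate, hl, torusProj_add_latticeVec]

lemma torusProj_iterate (hH : IsConjugacyLift A F H B) {f : Torus d → Torus d}
    (hlift : IsTorusLift F f) (k : ℕ) (x : RSpace d) :
    torusProj (H ((linLift A)^[k] x)) = f^[k] (torusProj (H x)) := by
  obtain ⟨l, hl⟩ := hH.semiconj
  induction k with
  | zero => rfl
  | succ k ih =>
    rw [Function.iterate_succ_apply', hl, torusProj_add_latticeVec, ← hlift, ih,
      Function.iterate_succ_apply']

end IsConjugacyLift

lemma torusProj_lift_iterate {F : RSpace d → RSpace d} {f : Torus d → Torus d}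
    (hlift : IsTorusLift F f) (k : ℕ) (x : RSpace d) :
    torusProj (F^[k] x) = f^[k] (torusProj x) := by
  induction k with
  | zero => rfl
  | succ k ih => rw [Function.iterate_succ_apply', ← hlift, ih, Function.iterate_succ_apply']

variable {F : RSpace d ≃ₜ RSpace d} {f : Torus d ≃ₜ Torus d} {H : RSpace d → RSpace d}
  {B : RSpace d →L[ℝ] RSpace d}

lemma birkhoff_eq_sum_iterate (h : IsInvariantFrame β v κ η θ F W c)
    (hH : IsConjugacyLift A F H B) (hlift : IsTorusLift F f) (i : Fin d) (n : ℕ) (x : RSpace d) :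
    birkhoff A H (fun z => Real.log |c i z|) n x
      = ∑ k ∈ Finset.range n, Real.log |c i ((⇑F)^[k] (H x))| := by
  refine Finset.sum_congr rfl fun k _ => ?_
  dsimp only
  rw [h.multiplier_eq i (y := (⇑F)^[k] (H x))]
  rw [hH.torusProj_iterate hlift, torusProj_lift_iterate hlift]

lemma birkhoff_add (φ : RSpace d → ℝ) (m n : ℕ) (x : RSpace d) :
    birkhoff A H φ (m + n) x = birkhoff A H φ m x + birkhoff A H φ n ((linLift A)^[m] x) := by
  rw [birkhoff, Finset.sum_range_add]
  congr 1
  refine Finset.sum_congr rfl fun k _ => ?_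
  rw [add_comm m k, Function.iterate_add_apply]

lemma birkhoff_congr (h : IsInvariantFrame β v κ η θ F W c)
    (hH : IsConjugacyLift A F H B) (hlift : IsTorusLift F f) (i : Fin d) (n : ℕ) {x y : RSpace d}
    (hxy : torusProj x = torusProj y) : birkhoff A H (fun z => Real.log |c i z|) n x
      = birkhoff A H (fun z => Real.log |c i z|) n y := by
  refine Finset.sum_congr rfl fun k _ => ?_
  dsimp only
  rw [h.multiplier_eq i (y := H ((linLift A)^[k] y))]
  rw [hH.torusProj_iterate hlift, hH.torusProj_iterate hlift, hH.torusProj_eq hxy]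

lemma birkhoff_strictMono (h : IsInvariantFrame β v κ η θ F W c) (G : SpectralGap β κ η q)
    {n : ℕ} (hn : 1 ≤ n) (x : RSpace d) :
    StrictMono fun i => birkhoff A H (fun z => Real.log |c i z|) n x := fun i _ hij =>
  Finset.sum_lt_sum_of_nonempty ⟨0, Finset.mem_range.2 hn⟩ fun _ _ =>
    Real.log_lt_log (abs_pos.2 (h.multiplier_ne_zero G i _)) (h.abs_multiplier_lt G hij _ _)

lemma birkhoff_zero (φ : RSpace d → ℝ) (n : ℕ) : birkhoff A H φ n 0 = n * φ (H 0) := by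
  have : ∀ k, (linLift A)^[k] 0 = 0 := fun k => by
    induction k with
    | zero => rfl
    | succ k ih => rw [Function.iterate_succ_apply', ih, map_zero]
  simp [birkhoff, this]

/-- At a periodic point the frame consists of eigenvectors of the return map, with the products of
the multipliers as eigenvalues. The conjugacy matches the eigenvalues at `H y` with those at `H 0`,
and the order of their moduli fixes the matching. -/
theorem birkhoff_periodic_of_constantPeriodicData (h : IsInvariantFrame β v κ η θ F W c)
    (G : SpectralGap β κ η q) (hη : 2 * d * η ≤ 1) (hF : Differentiable ℝ F)
    (hH : IsConjugacyLift A F H B) (hlift : IsTorusLift F f)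
    (hcpd : HasConstantPeriodicData f F) (i : Fin d) {n : ℕ} {y : RSpace d} (hn : 1 ≤ n)
    (hy : ∃ k, (linLift A)^[n] y = y + latticeVec k) :
    birkhoff A H (fun z => Real.log |c i z|) n y = n * Real.log |c i (H 0)| := by
  obtain ⟨k, hk⟩ := hy
  have hfix : ∀ x, torusProj ((linLift A)^[n] x) = torusProj x →
      f^[n] (torusProj (H x)) = torusProj (H x) := fun x hx => by
    rw [← hH.torusProj_iterate hlift, hH.torusProj_eq hx]
  have h1 := hfix y (by rw [hk, torusProj_add_latticeVec])
  have h0 := hfix 0 (by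
    congr 1
    have : ∀ j, (linLift A)^[j] 0 = 0 := fun j => by
      induction j with
      | zero => rfl
      | succ j ih => rw [Function.iterate_succ_apply', ih, map_zero]
    exact this n)
  obtain ⟨P, hP⟩ := hcpd n (H y) (H 0) h1 h0
  set Λ : RSpace d → Fin d → ℝ := fun x i => ∏ k ∈ Finset.range n, c i ((⇑F)^[k] x) with hΛ
  have heig : ∀ x, f^[n] (torusProj x) = torusProj x → ∀ i,
      fderiv ℝ (⇑F)^[n] x (W i x) = Λ x i • W i x := fun x hx i => by
    rw [fderiv_iterate_of_invariant hF (h.fderiv_apply i), h.frame_eq i (y := x)]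
    rw [torusProj_lift_iterate hlift, hx]
  have hlog : ∀ x i, Real.log |Λ (H x) i| = birkhoff A H (fun z => Real.log |c i z|) n x :=
    fun x i => by
      rw [birkhoff_eq_sum_iterate h hH hlift]
      simp only [hΛ, Finset.abs_prod]
      exact Real.log_prod fun k _ => (abs_pos.2 (h.multiplier_ne_zero G i _)).ne'
  have hmatch : ∀ i, ∃ j, Λ (H y) i = Λ (H 0) j := fun i => by
    obtain ⟨a, ha⟩ := h.exists_coeff G hη (H 0) (P (W i (H y)))
    have hne : P (W i (H y)) ≠ 0 := fun h0 => h.ne_zero i (H y) (P.map_eq_zero_iff.1 h0)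
    obtain ⟨j, hj⟩ : ∃ j, a j ≠ 0 := by
      by_contra hcon
      push Not at hcon
      apply hne
      rw [← ha]
      simp [hcon]
    refine ⟨j, ?_⟩
    have e1 := hP (W i (H y))
    rw [heig _ h1, map_smul, ← ha, map_sum, Finset.smul_sum] at e1
    have e2 : ∑ j, (Λ (H y) i * a j - Λ (H 0) j * a j) • W j (H 0) = 0 := by
      simp only [sub_smul, Finset.sum_sub_distrib]
      rw [sub_eq_zero]
      simp only [mul_smul]
      rw [e1]
      refine Finset.sum_congr rfl fun j _ => ?_
      rw [map_smul, heig _ h0, smul_comm]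
    have e3 := h.coeff_eq_zero G hη e2 j
    rw [← sub_mul] at e3
    exact sub_eq_zero.1 ((mul_eq_zero.1 e3).resolve_right hj)
  have := eq_of_strictMono_of_forall_exists_eq (birkhoff_strictMono (A := A) (H := H) h G hn y)
    (birkhoff_strictMono (A := A) (H := H) h G hn 0) fun i => by
      obtain ⟨j, hj⟩ := hmatch i
      exact ⟨j, by rw [← hlog, ← hlog, hj]⟩
  rw [← birkhoff_zero (A := A) (H := H) fun z => Real.log |c i z|]
  exact congrFun this i

lemma IsInvariantFrame.hasFDerivAt_symm (h : IsInvariantFrame β v κ η θ F W c)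
    (G : SpectralGap β κ η q) (hη : 2 * d * η ≤ 1) (hF : Differentiable ℝ F) (x : RSpace d) :
    ∃ L : RSpace d →L[ℝ] RSpace d, HasFDerivAt F.symm L x ∧
      ∀ i, L (W i x) = (c i (F.symm x))⁻¹ • W i (F.symm x) := by
  have hinj : Function.Injective (fderiv ℝ F (F.symm x)).toLinearMap := by
    rw [← LinearMap.ker_eq_bot, LinearMap.ker_eq_bot']
    intro u hu
    obtain ⟨a, ha⟩ := h.exists_coeff G hη (F.symm x) u
    have h1 : ∑ i, (a i * c i (F.symm x)) • W i (F (F.symm x)) = 0 := by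
      rw [← hu, ← ha, map_sum]
      refine Finset.sum_congr rfl fun i _ => ?_
      change _ = fderiv ℝ F (F.symm x) (a i • W i (F.symm x))
      rw [map_smul, h.fderiv_apply, smul_smul]
    have h2 : ∀ i, a i = 0 := fun i =>
      (mul_eq_zero.1 (h.coeff_eq_zero G hη h1 i)).resolve_right (h.multiplier_ne_zero G i _)
    rw [← ha]
    simp [h2]
  let e : RSpace d ≃L[ℝ] RSpace d :=
    (LinearEquiv.ofInjectiveEndo _ hinj).toContinuousLinearEquiv
  have he : (e : RSpace d →L[ℝ] RSpace d) = fderiv ℝ F (F.symm x) := by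
    ext1 u; rfl
  refine ⟨e.symm, ?_, fun i => ?_⟩
  · refine HasFDerivAt.of_local_left_inverse (f := F) F.symm.continuous.continuousAt ?_
      (Filter.Eventually.of_forall F.apply_symm_apply)
    rw [he]
    exact (hF _).hasFDerivAt
  · change e.symm (W i x) = _
    rw [e.symm_apply_eq, map_smul]
    have h1 : e (W i (F.symm x)) = c i (F.symm x) • W i x := by
      have := h.fderiv_apply i (F.symm x)
      rw [F.apply_symm_apply] at this
      exact this
    rw [h1, smul_smul, inv_mul_cancel₀ (h.multiplier_ne_zero G i _), one_smul]

/-- At a Lyapunov regular point, forward and backward exponents along the frame agree. -/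
lemma IsInvariantFrame.forward_eq_backward_of_regular (h : IsInvariantFrame β v κ η θ F W c)
    (G : SpectralGap β κ η q) (hη : 2 * d * η ≤ 1) (hF : Differentiable ℝ F) {x : RSpace d}
    (hreg : IsLyapunovRegular F x) {s t : Fin d → ℝ} (hs : StrictMono s) (ht : StrictMono t)
    {K : ℝ} (hfwd : ∀ i (n : ℕ),
      |∑ k ∈ Finset.range n, Real.log |c i ((⇑F)^[k] x)| - n * s i| ≤ K)
    (hbwd : ∀ i (n : ℕ),
      |∑ k ∈ Finset.range n, Real.log |c i ((⇑F.symm)^[k + 1] x)| - n * t i| ≤ K) : s = t := by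
  classical
  obtain ⟨r, O, χ, hχ, hO, hintl, hlim⟩ := hreg
  choose L hL hLW using h.hasFDerivAt_symm G hη hF
  have hFs : Differentiable ℝ F.symm := fun y => (hL y).differentiableAt
  have hbs : ∀ i y, fderiv ℝ F.symm y (W i y) = (c i (F.symm y))⁻¹ • W i (F.symm y) :=
    fun i y => by rw [(hL y).fderiv, hLW]
  have hc0 := h.multiplier_ne_zero G
  have hle : ∀ {i j}, i ≤ j → ∀ y, |c i y| ≤ |c j y| := fun {i j} hij y => by
    rcases hij.eq_or_lt with rfl | hlt
    · exact le_rfl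
    · exact (h.abs_multiplier_lt G hlt y y).le
  -- The forward exponent of a vector sees its strongest nonzero component; the backward exponent
  -- (`hmin`) sees the weakest.
  have hmax : ∀ j, ∀ u ∈ O j, ∀ a : Fin d → ℝ, ∑ i, a i • W i x = u → ∀ I, a I ≠ 0 →
      (∀ i, a i ≠ 0 → i ≤ I) → χ j = s I := fun j u hu a ha I hI hmaxI => by
    have hu0 : u ≠ 0 := fun h0 => hI (h.coeff_eq_zero G hη (ha.trans h0) I)
    refine tendsto_nhds_unique (hlim j u hu hu0).1
      (h.tendsto_log_norm_fderiv_iterate G hη hF h.fderiv_apply hc0 ha hI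
        (fun i hi => hle (hmaxI i hi)) (hfwd I))
  have hmin : ∀ j, ∀ u ∈ O j, ∀ a : Fin d → ℝ, ∑ i, a i • W i x = u → ∀ I, a I ≠ 0 →
      (∀ i, a i ≠ 0 → I ≤ i) → χ j = t I := fun j u hu a ha I hI hminI => by
    have hu0 : u ≠ 0 := fun h0 => hI (h.coeff_eq_zero G hη (ha.trans h0) I)
    have h1 := h.tendsto_log_norm_fderiv_iterate G hη hFs (b := fun i y => (c i (F.symm y))⁻¹)
      hbs (fun i y => inv_ne_zero (hc0 i _)) ha hI
      (fun i hi y => by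
        rw [abs_inv, abs_inv]
        exact inv_anti₀ (abs_pos.2 (hc0 I _)) (hle (hminI i hi) _)) (s := -t I) (K := K)
      (fun n => by
        have := hbwd I n
        rw [← abs_neg] at this
        convert this using 2
        simp only [abs_inv, Real.log_inv, Finset.sum_neg_distrib, ← Function.iterate_succ_apply' F.symm]
        ring)
    have h2 := (hlim j u hu hu0).2
    have h3 := h1.neg
    rw [neg_neg] at h3
    refine tendsto_nhds_unique h2 (h3.congr fun n => ?_)
    rw [one_div_neg_eq_neg_one_div]; ring
  have hcoef : ∀ j, ∃ u ∈ O j, u ≠ 0 := fun j => (Submodule.ne_bot_iff _).1 (hO j)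
  choose o ho ho0 using hcoef
  choose a ha using fun j => h.exists_coeff G hη x (o j)
  have hsupp : ∀ {b : Fin d → ℝ} {u : RSpace d}, ∑ i, b i • W i x = u → u ≠ 0 →
      (Finset.univ.filter fun i => b i ≠ 0).Nonempty := fun {b u} hb hu => by
    by_contra hcon
    rw [Finset.not_nonempty_iff_eq_empty, Finset.filter_eq_empty_iff] at hcon
    apply hu
    rw [← hb]
    refine Finset.sum_eq_zero fun i hi => ?_
    rw [not_not.1 (hcon hi), zero_smul]
  have hexmax : ∀ {b : Fin d → ℝ} {u : RSpace d}, ∑ i, b i • W i x = u → u ≠ 0 →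
      ∃ I, b I ≠ 0 ∧ ∀ i, b i ≠ 0 → i ≤ I := fun {b u} hb hu =>
    ⟨_, (Finset.mem_filter.1 (Finset.max'_mem _ (hsupp hb hu))).2, fun i hi =>
      Finset.le_max' _ i (Finset.mem_filter.2 ⟨Finset.mem_univ i, hi⟩)⟩
  have hexmin : ∀ {b : Fin d → ℝ} {u : RSpace d}, ∑ i, b i • W i x = u → u ≠ 0 →
      ∃ I, b I ≠ 0 ∧ ∀ i, b i ≠ 0 → I ≤ i := fun {b u} hb hu =>
    ⟨_, (Finset.mem_filter.1 (Finset.min'_mem _ (hsupp hb hu))).2, fun i hi =>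
      Finset.min'_le _ i (Finset.mem_filter.2 ⟨Finset.mem_univ i, hi⟩)⟩
  choose M hM hM' using fun j => hexmax (ha j) (ho0 j)
  choose N hN hN' using fun j => hexmin (ha j) (ho0 j)
  have hχM : ∀ j, χ j = s (M j) := fun j => hmax j _ (ho j) _ (ha j) _ (hM j) (hM' j)
  have hχN : ∀ j, χ j = t (N j) := fun j => hmin j _ (ho j) _ (ha j) _ (hN j) (hN' j)
  -- Subtracting a multiple of `o j` removes the component of index `M j`. A nonzero remainder still
  -- has exponent `χ j = s (M j)`, hence leading index `M j`, where its coefficient is zero. So each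
  -- `O j` is a line and there are `d` of them.
  have hline : ∀ j, O j ≤ Submodule.span ℝ {o j} := fun j u hu => by
    obtain ⟨b, hb⟩ := h.exists_coeff G hη x u
    rw [Submodule.mem_span_singleton]
    refine ⟨b (M j) / a j (M j), ?_⟩
    by_contra hne
    set r := b (M j) / a j (M j) with hr
    have hw : ∑ i, (b i - r * a j i) • W i x = u - r • o j := by
      rw [← hb, ← ha j, Finset.smul_sum, ← Finset.sum_sub_distrib]
      exact Finset.sum_congr rfl fun i _ => by rw [sub_smul, mul_smul]
    have hw0 : u - r • o j ≠ 0 := fun h0 => hne (sub_eq_zero.1 h0).symm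
    obtain ⟨I, hI, hI'⟩ := hexmax hw hw0
    have e1 := hmax j _ (Submodule.sub_mem _ hu (Submodule.smul_mem _ _ (ho j))) _ hw I hI hI'
    rw [hχM j] at e1
    have e2 := hs.injective e1
    apply hI
    rw [← e2, hr, div_mul_cancel₀ _ (hM j), sub_self]
  have hspan : Submodule.span ℝ (Set.range o) = ⊤ := by
    rw [eq_top_iff, ← hintl.submodule_iSup_eq_top, iSup_le_iff]
    intro j
    exact (hline j).trans (Submodule.span_mono (Set.singleton_subset_iff.2 ⟨j, rfl⟩))
  have hMinj : Function.Injective M := fun i j hij => hχ.injective (by rw [hχM, hχM, hij])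
  have hrd : r = d := by
    apply le_antisymm
    · simpa using Fintype.card_le_of_injective M hMinj
    · have := finrank_range_le_card (R := ℝ) o
      rw [Set.finrank, hspan, finrank_top] at this
      simpa using this
  subst hrd
  rw [← eq_of_strictMono_of_forall_exists_eq hχ hs fun j => ⟨_, hχM j⟩]
  exact eq_of_strictMono_of_forall_exists_eq hχ ht fun j => ⟨_, hχN j⟩

/-- The deviation from the linear function of slope the mean over a period is `N`-periodic in `n`,
hence bounded. -/
lemma exists_birkhoff_periodic_sub_le (h : IsInvariantFrame β v κ η θ F W c)
    (hH : IsConjugacyLift A F H B) (hlift : IsTorusLift F f) (i : Fin d) {N : ℕ} {y : RSpace d}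
    (hN : 1 ≤ N) (hy : ∃ k, (linLift A)^[N] y = y + latticeVec k) :
    ∃ K : ℝ, ∀ n : ℕ, |birkhoff A H (fun z => Real.log |c i z|) n y
      - n * (birkhoff A H (fun z => Real.log |c i z|) N y / N)| ≤ K := by
  obtain ⟨k, hk⟩ := hy
  set S : ℕ → ℝ := fun n => birkhoff A H (fun z => Real.log |c i z|) n y with hS
  set D : ℕ → ℝ := fun n => S n - n * (S N / N) with hD
  have hN0 : (N : ℝ) ≠ 0 := Nat.cast_ne_zero.2 (by omega)
  have hper : Function.Periodic D N := fun n => by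
    have h1 : S (n + N) = S N + S n := by
      simp only [hS]
      rw [add_comm n N, birkhoff_add, birkhoff_congr h hH hlift i n (x := (linLift A)^[N] y) (y := y)]
      rw [hk, torusProj_add_latticeVec]
    simp only [hD, h1]
    push_cast
    field_simp
    ring
  refine ⟨∑ j ∈ Finset.range N, |D j|, fun n => ?_⟩
  change |D n| ≤ _
  rw [← hper.map_mod_nat n]
  exact Finset.single_le_sum (f := fun j => |D j|) (fun _ _ => abs_nonneg _)
    (Finset.mem_range.2 (Nat.mod_lt _ hN))

/-- Periodic orbits are linked to the fixed point by a heteroclinic point, and regularity is used at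
its image `H z`, which is why it is assumed beyond the periodic points. -/
theorem birkhoff_periodic_of_regular (h : IsInvariantFrame β v κ η θ F W c)
    (G : SpectralGap β κ η q) (hη : 2 * d * η ≤ 1) (hF : Differentiable ℝ F)
    (G' : IsHyperbolicGap β κ μ) (hd : 0 < d) (hv : ∀ i, linLift A (v i) = β i • v i)
    (hnear : IsNearDiagonal β v κ F) (hθ : 0 < θ) (hθ1 : θ ≤ 1)
    (hhol : ∀ i, ∃ L : ℝ, 0 ≤ L ∧ ∀ x y,
      |Real.log (|c i x|) - Real.log (|c i y|)| ≤ L * ‖x - y‖ ^ θ)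
    (hH : IsConjugacyLift A F H B) (hlift : IsTorusLift F f)
    (hreg : ∀ x, IsLyapunovRegular F x) (i : Fin d) {N : ℕ} {y : RSpace d} (hN : 1 ≤ N)
    (hy : ∃ k, (linLift A)^[N] y = y + latticeVec k) :
    birkhoff A H (fun z => Real.log |c i z|) N y = N * Real.log |c i (H 0)| := by
  classical
  have hN0 : (0 : ℝ) < N := Nat.cast_pos.2 (by omega)
  have hβ0 : ∀ i, β i ≠ 0 := fun i => abs_pos.1 (G.κ_nonneg.trans_lt (G.κ_lt i))
  -- The unstable part of `y`: `z - y` is stable, so the future orbit stays near that of `y`; `z` is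
  -- unstable, so the past orbit stays near `0`.
  set z : RSpace d := ∑ i, (if 1 < |β i| then v.repr y i else 0) • v i with hz
  have hzr : ∀ i, v.repr z i = if 1 < |β i| then v.repr y i else 0 := fun i => by
    rw [hz, v.repr_sum_self]
  -- The backward orbit of `z` under the linear map, written in coordinates.
  set zb : ℕ → RSpace d := fun n => ∑ i, ((β i)⁻¹ ^ n * v.repr z i) • v i with hzb
  have hzbr : ∀ n i, v.repr (zb n) i = (β i)⁻¹ ^ n * v.repr z i := fun n i => by
    rw [hzb, v.repr_sum_self]
  have hzbA : ∀ k n, k ≤ n → (linLift A)^[k] (zb n) = zb (n - k) := fun k n hk => by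
    apply v.repr.injective
    ext i
    rw [repr_linLift_iterate hv, hzbr, hzbr]
    have : β i ^ k * (β i)⁻¹ ^ n = (β i)⁻¹ ^ (n - k) := by
      obtain ⟨j, rfl⟩ := Nat.exists_eq_add_of_le hk
      rw [pow_add, ← mul_assoc, ← mul_pow, mul_inv_cancel₀ (hβ0 i), one_pow, one_mul,
        Nat.add_sub_cancel_left]
    rw [← mul_assoc, this]
  have hzb0 : zb 0 = z := by
    apply v.repr.injective
    ext i
    rw [hzbr, pow_zero, one_mul]
  set C := coordNorm v y with hCdef
  have hC0 : 0 ≤ C := coordNorm_nonneg y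
  have hfwdb : ∀ k, coordNorm v ((linLift A)^[k] (z - y)) ≤ C := fun k => by
    refine coordNorm_le hC0 fun i => ?_
    rw [repr_linLift_iterate hv, map_sub, Finsupp.sub_apply, hzr]
    split_ifs with hi
    · simpa using hC0
    · rw [zero_sub, abs_mul, abs_neg, abs_pow]
      exact (mul_le_of_le_one_left (abs_nonneg _)
        (pow_le_one₀ (abs_nonneg _) (not_lt.1 hi))).trans (abs_repr_le y i)
  have hbwdb : ∀ n, ∀ k ≤ n, coordNorm v ((linLift A)^[k] (zb n - 0)) ≤ C := fun n k hk => by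
    rw [sub_zero, hzbA k n hk]
    refine coordNorm_le hC0 fun i => ?_
    rw [hzbr, hzr]
    split_ifs with hi
    · rw [abs_mul, abs_pow, abs_inv]
      exact (mul_le_of_le_one_left (abs_nonneg _)
        (pow_le_one₀ (by positivity) (inv_le_one_of_one_le₀ hi.le))).trans (abs_repr_le y i)
    · simpa using hC0
  choose L hL0 hL using hhol
  choose K hK0 hK using fun i =>
    exists_birkhoff_sub_le G' hd hnear hH (hL0 i) hθ hθ1 (hL i) C hC0
  choose Kp hKp using fun i => exists_birkhoff_periodic_sub_le h hH hlift i hN hy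
  have hsum : ∀ i, K i + |Kp i| ≤ ∑ j, (K j + |Kp j|) := fun i =>
    Finset.single_le_sum (f := fun j => K j + |Kp j|)
      (fun j _ => add_nonneg (hK0 j) (abs_nonneg _)) (Finset.mem_univ i)
  have hproj : ∀ n, torusProj ((⇑F.symm)^[n] (H z)) = torusProj (H (zb n)) := fun n => by
    apply (f.injective.iterate n)
    rw [← torusProj_lift_iterate hlift, ← hH.torusProj_iterate hlift, hzbA n n le_rfl,
      Nat.sub_self, hzb0]
    congr 1
    exact (Function.LeftInverse.iterate (g := F) (f := F.symm) F.apply_symm_apply n) _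
  have hst := h.forward_eq_backward_of_regular G hη hF (hreg (H z))
    (s := fun i => birkhoff A H (fun z => Real.log |c i z|) N y / N)
    (t := fun i => Real.log |c i (H 0)|)
    (fun i j hij => div_lt_div_of_pos_right (birkhoff_strictMono h G hN y hij) hN0)
    (fun i j hij => Real.log_lt_log (abs_pos.2 (h.multiplier_ne_zero G i _))
      (h.abs_multiplier_lt G hij _ _)) (K := ∑ j, (K j + |Kp j|))
    (fun i n => by
      rw [← birkhoff_eq_sum_iterate h hH hlift]
      have e1 := hK i n z y fun k _ => hfwdb k
      have e2 := hKp i n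
      have e3 := hsum i
      have e4 := le_abs_self (Kp i)
      rw [abs_le] at e1 e2 ⊢
      constructor <;> linarith [e1.1, e1.2, e2.1, e2.2])
    (fun i n => by
      have e1 := hK i n (zb n) 0 (hbwdb n)
      rw [birkhoff_zero] at e1
      have e5 : ∑ k ∈ Finset.range n, Real.log |c i ((⇑F.symm)^[k + 1] (H z))|
          = birkhoff A H (fun z => Real.log |c i z|) n (zb n) := by
        rw [birkhoff, ← Finset.sum_range_reflect]
        refine Finset.sum_congr rfl fun k hk => ?_
        have hk' := Finset.mem_range.1 hk
        rw [hzbA _ n (by omega), h.multiplier_eq i (hproj _)]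
        congr 5
        omega
      rw [e5]
      exact e1.trans ((le_add_of_nonneg_right (abs_nonneg _)).trans (hsum i)))
  have := congrFun hst i
  rw [div_eq_iff hN0.ne'] at this
  rw [this, mul_comm]

end PeriodicData

/-! ### Lifts of the conjugacy and linear leaves -/

section Lifts

variable {d : ℕ} {β : Fin d → ℝ} {v : Module.Basis (Fin d) ℝ (RSpace d)} {κ η θ q : ℝ}
  {A : Matrix (Fin d) (Fin d) ℤ} {W : Fin d → RSpace d → RSpace d} {c : Fin d → RSpace d → ℝ}

lemma IsInvariantFrame.exists_log_holder {F : RSpace d → RSpace d}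
    (h : IsInvariantFrame β v κ η θ F W c) (G : SpectralGap β κ η q) (i : Fin d) :
    ∃ L : ℝ, 0 ≤ L ∧ ∀ x y, |Real.log (|c i x|) - Real.log (|c i y|)| ≤ L * ‖x - y‖ ^ θ := by
  obtain ⟨D, hD0, hD⟩ := h.multiplier_holder
  have hr : 0 < |β i| - κ := sub_pos.2 (G.κ_lt i)
  have key : ∀ x y, Real.log (|c i x|) - Real.log (|c i y|)
      ≤ D / (|β i| - κ) * ‖x - y‖ ^ θ := fun x y => by
    have hx : 0 < |c i x| := hr.trans_le (h.le_abs_multiplier i x)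
    have hy : 0 < |c i y| := hr.trans_le (h.le_abs_multiplier i y)
    rw [← Real.log_div hx.ne' hy.ne']
    refine (Real.log_le_sub_one_of_pos (div_pos hx hy)).trans ?_
    have h1 : |c i x| / |c i y| - 1 = (|c i x| - |c i y|) / |c i y| := by field_simp
    rw [h1, div_mul_eq_mul_div]
    exact div_le_div₀ (by positivity) ((abs_sub_abs_le_abs_sub _ _).trans (hD i x y)) hr
      (h.le_abs_multiplier i y)
  refine ⟨D / (|β i| - κ), by positivity, fun x y => abs_le.2 ⟨?_, key x y⟩⟩
  have := key y x
  rw [norm_sub_rev] at this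
  linarith

lemma exists_conjugacyLift {F : RSpace d ≃ₜ RSpace d} {f h : Torus d ≃ₜ Torus d}
    (hlift : IsTorusLift F f) (hconj : ∀ p, h (toralMap A p) = f (h p)) :
    ∃ H B, IsConjugacyLift A F H B ∧ ∀ x, torusProj (H x) = h (torusProj x) := by
  obtain ⟨e₀, he₀⟩ := surjective_torusProj (h (torusProj 0))
  have : SimplyConnectedSpace (RSpace d) := inferInstance
  obtain ⟨H, hHc, hH, -⟩ := exists_torus_lift (X := RSpace d)
    (h.continuous.comp continuous_torusProj) 0 e₀ he₀
  obtain ⟨B, h1, h2, h3⟩ := exists_linear_part hHc hH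
  refine ⟨H, B, ⟨hHc, ?_, h1, h2, h3⟩, hH⟩
  refine eq_add_of_torusProj_eq (hHc.comp (linLift A).continuous) (F.continuous.comp hHc) fun x => ?_
  simp only [Function.comp] at hH ⊢
  rw [hH, ← toralMap_torusProj, hconj, ← hH, hlift]

lemma IsConjugacyLift.exists_iterate_eq {F H : RSpace d → RSpace d} {B : RSpace d →L[ℝ] RSpace d}
    (hH : IsConjugacyLift A F H B)
    (hper : ∀ x k, F (x + latticeVec k) = F x + linLift A (latticeVec k)) (n : ℕ) :
    ∃ l, ∀ x, H ((linLift A)^[n] x) = F^[n] (H x) + latticeVec l := by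
  obtain ⟨k, hk⟩ := hH.semiconj
  induction n with
  | zero => exact ⟨0, fun x => by rw [latticeVec_zero, add_zero]; rfl⟩
  | succ n ih =>
    obtain ⟨l, hl⟩ := ih
    refine ⟨A.mulVec l + k, fun x => ?_⟩
    rw [Function.iterate_succ_apply', hk, hl, hper, Function.iterate_succ_apply', latticeVec_add,
      linLift_latticeVec, add_assoc]

lemma linLift_injective (hdet : IsUnit A.det) : Function.Injective (linLift A) := by
  have hleft : ∀ x, linLift A⁻¹ (linLift A x) = x := fun x => by
    ext i
    have h1 : ∀ (M : Matrix (Fin d) (Fin d) ℤ) (z : RSpace d),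
        (linLift M z).ofLp = (M.map (Int.cast : ℤ → ℝ)).mulVec z.ofLp := fun M z =>
      Matrix.ofLp_toEuclideanCLM _ _
    have h2 : (A⁻¹).map (Int.cast : ℤ → ℝ) * A.map (Int.cast : ℤ → ℝ) = 1 := by
      have := congrArg (fun M : Matrix (Fin d) (Fin d) ℤ => M.map (Int.cast : ℤ → ℝ))
        (Matrix.nonsing_inv_mul A hdet)
      simp only [Matrix.map_mul_intCast] at this
      rw [this]
      exact Matrix.map_one _ Int.cast_zero Int.cast_one
    rw [h1, h1, Matrix.mulVec_mulVec, h2, Matrix.one_mulVec]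
  exact Function.LeftInverse.injective hleft

/-- An expanding eigenline of an invertible integer matrix contains no lattice point but zero. -/
lemma smul_eq_zero_of_eq_latticeVec (hdet : IsUnit A.det) {u : RSpace d} {b : ℝ} (hb : 1 < |b|)
    (hu : linLift A u = b • u) {s : ℝ} {k : Fin d → ℤ} (h : s • u = latticeVec k) : s • u = 0 := by
  have hb0 : b ≠ 0 := abs_pos.1 (by linarith)
  have hinv : ∀ l : Fin d → ℤ, linLift A (latticeVec (A⁻¹.mulVec l)) = latticeVec l := fun l => by
    rw [linLift_latticeVec, Matrix.mulVec_mulVec, Matrix.mul_nonsing_inv _ hdet, Matrix.one_mulVec]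
  have hinj := linLift_injective hdet
  -- The inverse matrix is integral too, so all backward images of the lattice point are lattice
  -- points, yet they tend to `0`; integer coordinates of modulus below `1` vanish.
  have key : ∀ n : ℕ, ∃ l, (b⁻¹ ^ n * s) • u = latticeVec l := by
    intro n
    induction n with
    | zero => exact ⟨k, by simpa using h⟩
    | succ n ih =>
      obtain ⟨l, hl⟩ := ih
      refine ⟨A⁻¹.mulVec l, hinj ?_⟩
      rw [hinv, ← hl, map_smul, hu, smul_smul]
      congr 1
      linear_combination (b⁻¹ ^ n * s) * (inv_mul_cancel₀ hb0)
  ext i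
  by_contra hne
  have hlim : Filter.Tendsto (fun n : ℕ => |b⁻¹ ^ n * s * u i|) Filter.atTop (nhds 0) := by
    have h1 : |b⁻¹| < 1 := by rw [abs_inv]; exact inv_lt_one_of_one_lt₀ hb
    have := ((tendsto_pow_atTop_nhds_zero_of_abs_lt_one h1).mul_const (s * u i)).abs
    simpa [mul_assoc] using this
  obtain ⟨n, hn⟩ := (hlim.eventually (gt_mem_nhds one_pos)).exists
  obtain ⟨l, hl⟩ := key n
  have h2 : b⁻¹ ^ n * s * u i = l i := by
    have := congrArg (fun x : RSpace d => x i) hl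
    simpa using this
  rw [h2] at hn
  have h3 : l i = 0 := Int.abs_lt_one_iff.1 (by exact_mod_cast hn)
  rw [h3] at h2
  have h4 : s * u i = 0 := by
    have : b⁻¹ ^ n ≠ 0 := pow_ne_zero _ (inv_ne_zero hb0)
    have h5 : b⁻¹ ^ n * (s * u i) = 0 := by rw [← mul_assoc, h2]; simp
    exact (mul_eq_zero.1 h5).resolve_left this
  exact hne (by simpa using h4)

/-- The displacement along a tangent curve is the integral of a velocity proportional to `u`. -/
lemma mem_tangentLeaf_const_iff {u : RSpace d} {x : RSpace d} {p : Torus d} :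
    p ∈ tangentLeaf (fun _ => Submodule.span ℝ {u}) (torusProj x) ↔
      ∃ t : ℝ, p = torusProj (x + t • u) := by
  constructor
  · rintro ⟨γ, hγ, htan, h0, h1⟩
    have hd : ∀ t, HasDerivAt γ (deriv γ t) t := fun t =>
      (hγ.differentiable one_ne_zero t).hasDerivAt
    have hker : ∀ t, γ t - γ 0 ∈ Submodule.span ℝ {u} := by
      intro t
      set S := Submodule.span ℝ {u}
      have hcl : IsClosed (S : Set (RSpace d)) := S.closed_of_finiteDimensional
      have hI : ∫ s in (0 : ℝ)..t, deriv γ s = γ t - γ 0 :=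
        intervalIntegral.integral_eq_sub_of_hasDerivAt (fun s _ => hd s)
          ((hγ.continuous_deriv le_rfl).intervalIntegrable _ _)
      choose a ha using fun s => Submodule.mem_span_singleton.1 (htan s)
      by_cases hu : u = 0
      · have hz : ∀ s, deriv γ s = 0 := fun s => by rw [← ha s, hu, smul_zero]
        rw [← hI]
        simp [hz]
      have hac : Continuous a := by
        have h2 : a = fun s => inner ℝ u (deriv γ s) / ‖u‖ ^ 2 := by
          funext s
          rw [← ha s, inner_smul_right, real_inner_self_eq_norm_sq,
            mul_div_cancel_right₀ _ (by simpa using hu)]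
        rw [h2]
        exact (continuous_const.inner (hγ.continuous_deriv le_rfl)).div_const _
      rw [← hI]
      simp only [← ha]
      rw [intervalIntegral.integral_smul_const]
      exact Submodule.smul_mem _ _ (Submodule.mem_span_singleton_self u)
    obtain ⟨t, ht⟩ := Submodule.mem_span_singleton.1 (hker 1)
    refine ⟨t, ?_⟩
    rw [torusProj_add, ← h0, ← torusProj_add, ht, ← h1]
    congr 1
    abel
  · rintro ⟨t, rfl⟩
    refine ⟨fun s => x + (s * t) • u, by fun_prop, fun s => ?_, by simp, by simp⟩
    have : HasDerivAt (fun s : ℝ => x + (s * t) • u) ((1 * t) • u) s :=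
      (((hasDerivAt_id s).mul_const t).smul_const u).const_add x
    rw [this.deriv]
    exact Submodule.smul_mem _ _ (Submodule.mem_span_singleton_self u)

end Lifts

/-! ### Tangent curves inside the images of lines -/

/-- `γ` is a `C¹` curve tangent to `W`, where the functional `π` is `1` on `W`, moving along the
image under `H` of the line through `x` of direction `u`, with parameter `τ`. -/
structure IsTangentCurve {d : ℕ} (H W : RSpace d → RSpace d) (π : RSpace d →L[ℝ] ℝ)
    (x u : RSpace d) (γ : ℝ → RSpace d) (τ : ℝ → ℝ) : Prop where
  contDiff : ContDiff ℝ 1 γ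
  continuous : Continuous τ
  eq : ∀ s, γ s = H (x + τ s • u)
  tangent : ∀ s, deriv γ s = deriv (fun r => π (γ r)) s • W (γ s)

section Curves

variable {d : ℕ} {β : Fin d → ℝ} {v : Module.Basis (Fin d) ℝ (RSpace d)} {κ η θ q : ℝ}
  {A : Matrix (Fin d) (Fin d) ℤ} {F : RSpace d → RSpace d} {W : Fin d → RSpace d → RSpace d}
  {c : Fin d → RSpace d → ℝ}

/-- The coordinate functionals of a basis, as continuous linear maps. -/
noncomputable def coordCLM (v : Module.Basis (Fin d) ℝ (RSpace d)) (m : Fin d) :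
    RSpace d →L[ℝ] ℝ := LinearMap.toContinuousLinearMap (v.coord m)

@[simp] lemma coordCLM_apply (m : Fin d) (x : RSpace d) : coordCLM v m x = v.repr x m := rfl

lemma deriv_eq_of_mem_span {γ : ℝ → RSpace d} (hγ : ContDiff ℝ 1 γ) {π : RSpace d →L[ℝ] ℝ} {s : ℝ}
    {w : RSpace d} (hw : π w = 1) (h : deriv γ s ∈ Submodule.span ℝ {w}) :
    deriv γ s = deriv (fun r => π (γ r)) s • w := by
  obtain ⟨a, ha⟩ := Submodule.mem_span_singleton.1 h
  have hd : HasDerivAt γ (deriv γ s) s := (hγ.differentiable one_ne_zero s).hasDerivAt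
  have h1 : HasDerivAt (fun r => π (γ r)) (π (deriv γ s)) s := π.hasFDerivAt.comp_hasDerivAt s hd
  rw [h1.deriv, ← ha, map_smul, hw, smul_eq_mul, mul_one]

lemma eq_of_countable_range {g : ℝ → ℝ} (hg : Continuous g) {S : Set ℝ} (hS : S.Countable)
    (h : ∀ s, g s ∈ S) (s t : ℝ) : g s = g t :=
  hS.isTotallyDisconnected (Set.range g) (Set.range_subset_iff.2 h) (isPreconnected_range hg)
    ⟨s, rfl⟩ ⟨t, rfl⟩

/-- A tangent curve joining two points of a leaf is pulled back by `h` to a continuous curve in the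
projected line, and then lifted. Nothing prevents it from backtracking, so `τ` is only continuous.
The scalar `ε` leaves the orientation of the line free. -/
theorem exists_tangentCurve (hfr : IsInvariantFrame β v κ η θ F W c) {H : RSpace d → RSpace d}
    {B : RSpace d →L[ℝ] RSpace d} (hH : IsConjugacyLift A F H B) {h : Torus d ≃ₜ Torus d}
    (hHh : ∀ x, torusProj (H x) = h (torusProj x)) (hdet : IsUnit A.det) {m : Fin d}
    (hm : 1 < |β m|) (hv : linLift A (v m) = β m • v m)
    {E : Torus d → Submodule ℝ (RSpace d)} (hE : ∀ x, E (torusProj x) = Submodule.span ℝ {W m x})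
    (hleaf : ∀ p, h '' tangentLeaf (fun _ => Submodule.span ℝ {v m}) p = tangentLeaf E (h p))
    {ε : ℝ} (hε : ε ≠ 0) (x : RSpace d) (t₁ t₂ : ℝ) :
    ∃ γ τ, IsTangentCurve H (W m) (coordCLM v m) x (ε • v m) γ τ ∧ τ 0 = t₁ ∧ τ 1 = t₂ := by
  set u := ε • v m with hu
  have hspan : Submodule.span ℝ {v m} = Submodule.span ℝ {u} :=
    (Submodule.span_singleton_smul_eq (IsUnit.mk0 _ hε) _).symm
  rw [hspan] at hleaf
  have hu0 : u ≠ 0 := smul_ne_zero hε (v.ne_zero m)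
  have hAu : linLift A u = β m • u := by rw [hu, map_smul, hv, smul_comm]
  set p := torusProj (x + t₁ • u) with hp
  have hq : h (torusProj (x + t₂ • u)) ∈ tangentLeaf E (h p) := by
    rw [← hleaf]
    refine ⟨_, mem_tangentLeaf_const_iff.2 ⟨t₂ - t₁, ?_⟩, rfl⟩
    congr 1
    rw [sub_smul]; abel
  obtain ⟨γ₀, hγ₀, htan, h0, h1⟩ := hq
  have hmem : ∀ s, ∃ t : ℝ, h.symm (torusProj (γ₀ s)) = torusProj (x + t₁ • u + t • u) := fun s => by
    have : torusProj (γ₀ s) ∈ tangentLeaf E (h p) := by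
      refine ⟨fun r => γ₀ (r * s), hγ₀.comp (by fun_prop), fun r => ?_, by simpa using h0, by simp⟩
      have hd : HasDerivAt (fun r => γ₀ (r * s)) ((1 * s) • deriv γ₀ (r * s)) r :=
        ((hγ₀.differentiable one_ne_zero (r * s)).hasDerivAt).scomp r
          ((hasDerivAt_id r).mul_const s)
      rw [hd.deriv]
      exact Submodule.smul_mem _ _ (htan _)
    rw [← hleaf] at this
    obtain ⟨p', hp', hp''⟩ := this
    obtain ⟨t, ht⟩ := mem_tangentLeaf_const_iff.1 hp'
    exact ⟨t, by rw [← hp'', h.symm_apply_apply, ht]⟩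
  obtain ⟨σ, hσc, hσ, hσ0⟩ := exists_torus_lift (X := ℝ)
    (a := fun s => h.symm (torusProj (γ₀ s)))
    (h.symm.continuous.comp (continuous_torusProj.comp hγ₀.continuous)) 0 (x + t₁ • u)
    (by rw [h0, h.symm_apply_apply])
  set τ : ℝ → ℝ := fun s => v.repr (σ s - x) m / ε with hτ
  have hστ : ∀ s, σ s = x + τ s • u := by
    intro s
    -- In the torus the curve lies on a line that may be dense, so its lift might a priori jump
    -- among countably many parallel lines; a continuous coordinate with countable range is
    -- constant.
    have hcoord : ∀ i, i ≠ m → v.repr (σ s - x) i = 0 := fun i hi => by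
      have hc : Continuous fun s => v.repr (σ s - x) i :=
        (coordCLM v i).continuous.comp (hσc.sub continuous_const)
      have hrange : ∀ s, v.repr (σ s - x) i ∈ Set.range fun k => v.repr (latticeVec k) i := fun s => by
        obtain ⟨t, ht⟩ := hmem s
        obtain ⟨k, hk⟩ := torusProj_eq_iff.1 ((hσ s).trans ht)
        refine ⟨k, ?_⟩
        have : σ s - x = (t₁ * ε + t * ε) • v m + latticeVec k := by
          rw [hk, hu, smul_smul, smul_smul, add_smul]; abel
        simp [this, Finsupp.single_eq_of_ne hi]
      have := eq_of_countable_range hc (Set.countable_range _) hrange s 0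
      rw [this, hσ0]
      simp [hu, Finsupp.single_eq_of_ne hi]
    have h2 : σ s - x = τ s • u := by
      apply v.repr.injective
      ext i
      by_cases hi : i = m
      · subst hi
        simp [hu, hτ, hε]
      · rw [hcoord i hi]
        simp [hu, Finsupp.single_eq_of_ne hi]
    rw [← h2]; abel
  have hτc : Continuous τ :=
    ((coordCLM v m).continuous.comp (hσc.sub continuous_const)).div_const ε
  obtain ⟨k, hk⟩ := eq_add_of_torusProj_eq (g := γ₀) (g' := fun s => H (σ s)) hγ₀.continuous
    (hH.continuous.comp hσc) fun s => by rw [hHh, hσ, h.apply_symm_apply]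
  have hγd : ∀ s, deriv (fun s => γ₀ s - latticeVec k) s = deriv γ₀ s := fun s =>
    deriv_sub_const _
  refine ⟨fun s => γ₀ s - latticeVec k, τ, ⟨hγ₀.sub contDiff_const, hτc, fun s => ?_, fun s => ?_⟩,
    ?_, ?_⟩
  · rw [hk, hστ]; abel
  · refine deriv_eq_of_mem_span (hγ₀.sub contDiff_const) (hfr.repr_self m _) ?_
    rw [hγd]
    have := htan s
    rw [hE] at this
    have h2 : W m (γ₀ s) = W m (γ₀ s - latticeVec k) := by
      have := hfr.periodic m (γ₀ s - latticeVec k) k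
      rwa [sub_add_cancel] at this
    rwa [← h2]
  · have h2 := hστ 0
    rw [hσ0] at h2
    exact (smul_left_injective ℝ hu0 (add_left_cancel h2)).symm
  · have h2 : torusProj (σ 1) = torusProj (x + t₂ • u) := by
      rw [hσ, h1, h.symm_apply_apply]
    rw [hστ] at h2
    obtain ⟨l, hl⟩ := torusProj_eq_iff.1 h2
    -- The endpoint is known only in the torus; injectivity of the line there recovers the
    -- parameter.
    have h3 : (τ 1 - t₂) • u = latticeVec l := by
      rw [sub_smul, sub_eq_iff_eq_add, add_comm, ← add_right_inj x, hl]; abel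
    have h4 := smul_eq_zero_of_eq_latticeVec hdet hm hAu h3
    exact sub_eq_zero.1 ((smul_eq_zero.1 h4).resolve_right hu0)

end Curves

/-! ### Monotonicity of the conjugacy along unstable lines -/

lemma volume_criticalValues_eq_zero {q : ℝ → ℝ} (hq : ContDiff ℝ 1 q) :
    MeasureTheory.volume (q '' {s | deriv q s = 0}) = 0 := by
  refine MeasureTheory.addHaar_image_eq_zero_of_det_fderivWithin_eq_zero _
    (f' := fun _ => (0 : ℝ →L[ℝ] ℝ)) (fun s hs => ?_) fun s _ => ?_
  · have h1 : HasDerivAt q (deriv q s) s := (hq.differentiable one_ne_zero s).hasDerivAt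
    have h0 : deriv q s = 0 := hs
    rw [h0] at h1
    have := h1.hasFDerivAt.hasFDerivWithinAt (s := {s | deriv q s = 0})
    simpa using this
  · change LinearMap.det (0 : ℝ →ₗ[ℝ] ℝ) = 0
    simp

/-- A continuous function `y` that has the same direction of motion as `τ` along `q = y ∘ τ` is
nondecreasing. -/
lemma le_of_monotone_crossings {y τ q : ℝ → ℝ} (hy : Continuous y) (hτ : Continuous τ)
    (hq : ContDiff ℝ 1 q) (hqy : ∀ s, q s = y (τ s))
    (hpos : ∀ s₁ s₂, s₁ < s₂ → (∀ s ∈ Set.Icc s₁ s₂, 0 < deriv q s) → τ s₁ < τ s₂)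
    (hneg : ∀ s₁ s₂, s₁ < s₂ → (∀ s ∈ Set.Icc s₁ s₂, deriv q s < 0) → τ s₂ < τ s₁)
    (h : τ 0 < τ 1) : y (τ 0) ≤ y (τ 1) := by
  by_contra hcon
  rw [not_le] at hcon
  -- A regular value of `q`, by the one-dimensional Sard theorem. At the last parameter `t` where `y
  -- ≥ r`, the curve crosses level `r` transversally, so moving `τ` up raises `y` above `r`, against
  -- the choice of `t`.
  obtain ⟨r, hr, hrreg⟩ : ∃ r ∈ Set.Ioo (y (τ 1)) (y (τ 0)), r ∉ q '' {s | deriv q s = 0} := by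
    by_contra hall
    push Not at hall
    have h1 : MeasureTheory.volume (Set.Ioo (y (τ 1)) (y (τ 0))) = 0 :=
      MeasureTheory.measure_mono_null hall (volume_criticalValues_eq_zero hq)
    rw [Real.volume_Ioo, ENNReal.ofReal_eq_zero] at h1
    linarith
  set S := {t ∈ Set.Icc (τ 0) (τ 1) | r ≤ y t} with hS
  have hSc : IsCompact S := isCompact_Icc.inter_right (isClosed_le continuous_const hy)
  have hSne : S.Nonempty := ⟨τ 0, ⟨le_rfl, h.le⟩, hr.2.le⟩
  obtain ⟨t, ht, htmax⟩ := hSc.exists_isGreatest hSne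
  have hafter : ∀ t', t < t' → t' ≤ τ 1 → y t' < r := fun t' h1 h2 => by
    by_contra hc
    exact absurd (htmax ⟨⟨ht.1.1.trans h1.le, h2⟩, not_lt.1 hc⟩) (not_le.2 h1)
  have ht1 : t < τ 1 := lt_of_le_of_ne ht.1.2 fun heq => by
    have := ht.2
    rw [heq] at this
    linarith [hr.1]
  have hyt : y t = r := by
    refine le_antisymm ?_ ht.2
    refine le_of_tendsto (x := nhdsWithin t (Set.Ioi t)) (hy.tendsto t |>.mono_left nhdsWithin_le_nhds) ?_
    filter_upwards [Ioo_mem_nhdsGT ht1] with t' ht'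
    exact (hafter t' ht'.1 ht'.2.le).le
  obtain ⟨s, -, hs⟩ := intermediate_value_Icc zero_le_one hτ.continuousOn ht.1
  have hds : deriv q s ≠ 0 := fun h0 => hrreg ⟨s, h0, by rw [hqy, hs, hyt]⟩
  have hqs : q s = r := by rw [hqy, hs, hyt]
  have hdc : Continuous (deriv q) := hq.continuous_deriv le_rfl
  have hnear : ∀ᶠ s' in nhds s, τ s' < τ 1 := (hτ.tendsto s).eventually (gt_mem_nhds (hs ▸ ht1))
  rcases lt_or_gt_of_ne hds with hlt | hgt
  · have hev : ∀ᶠ s' in nhds s, deriv q s' < 0 := (hdc.tendsto s).eventually (gt_mem_nhds hlt)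
    obtain ⟨δ, hδ, hball⟩ := Metric.eventually_nhds_iff.1 (hev.and hnear)
    have hin : ∀ r ∈ Set.Icc (s - δ / 2) s, dist r s < δ := fun r hr => by
      rw [Real.dist_eq, abs_lt]; constructor <;> linarith [hr.1, hr.2]
    have hlt' : s - δ / 2 < s := by linarith
    have h1 := hneg (s - δ / 2) s hlt' fun r hr => (hball (hin r hr)).1
    have h2 : q s < q (s - δ / 2) := by
      refine strictAntiOn_of_deriv_neg (convex_Icc _ _) hq.continuous.continuousOn (fun r hr => ?_)
        (Set.left_mem_Icc.2 hlt'.le) (Set.right_mem_Icc.2 hlt'.le) hlt'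
      rw [interior_Icc] at hr
      exact (hball (hin r ⟨hr.1.le, hr.2.le⟩)).1
    have h3 := hafter (τ (s - δ / 2)) (hs ▸ h1)
      (hball (hin _ (Set.left_mem_Icc.2 hlt'.le))).2.le
    rw [← hqy] at h3
    linarith
  · have hev : ∀ᶠ s' in nhds s, 0 < deriv q s' := (hdc.tendsto s).eventually (lt_mem_nhds hgt)
    obtain ⟨δ, hδ, hball⟩ := Metric.eventually_nhds_iff.1 (hev.and hnear)
    have hin : ∀ r ∈ Set.Icc s (s + δ / 2), dist r s < δ := fun r hr => by
      rw [Real.dist_eq, abs_lt]; constructor <;> linarith [hr.1, hr.2]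
    have hlt' : s < s + δ / 2 := by linarith
    have h1 := hpos s (s + δ / 2) hlt' fun r hr => (hball (hin r hr)).1
    have h2 : q s < q (s + δ / 2) := by
      refine strictMonoOn_of_deriv_pos (convex_Icc _ _) hq.continuous.continuousOn (fun r hr => ?_)
        (Set.left_mem_Icc.2 hlt'.le) (Set.right_mem_Icc.2 hlt'.le) hlt'
      rw [interior_Icc] at hr
      exact (hball (hin r ⟨hr.1.le, hr.2.le⟩)).1
    have h3 := hafter (τ (s + δ / 2)) (hs ▸ h1)
      (hball (hin _ (Set.right_mem_Icc.2 hlt'.le))).2.le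
    rw [← hqy] at h3
    linarith

/-- Last time at the lower level, then the first time afterwards at the upper level; this discards
the excursions of `τ` outside its end values. -/
lemma exists_subinterval {τ : ℝ → ℝ} (hτ : Continuous τ) (h : τ 0 < τ 1) :
    ∃ s₁ s₂, s₁ < s₂ ∧ τ s₁ = τ 0 ∧ τ s₂ = τ 1 ∧
      ∀ s ∈ Set.Icc s₁ s₂, τ s ∈ Set.Icc (τ 0) (τ 1) := by
  have hS : IsCompact {s ∈ Set.Icc (0 : ℝ) 1 | τ s ≤ τ 0} :=
    isCompact_Icc.inter_right (isClosed_le hτ continuous_const)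
  obtain ⟨s₁, hs₁, hmax⟩ := hS.exists_isGreatest ⟨0, ⟨le_rfl, zero_le_one⟩, le_rfl⟩
  have hgt : ∀ s, s₁ < s → s ≤ 1 → τ 0 < τ s := fun s h1 h2 => by
    by_contra hc
    exact absurd (hmax ⟨⟨hs₁.1.1.trans h1.le, h2⟩, not_lt.1 hc⟩) (not_le.2 h1)
  have hs₁1 : s₁ < 1 := lt_of_le_of_ne hs₁.1.2 fun heq => by
    have := hs₁.2
    rw [heq] at this
    linarith
  have hτ₁ : τ s₁ = τ 0 := by
    refine le_antisymm hs₁.2 ?_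
    refine ge_of_tendsto (x := nhdsWithin s₁ (Set.Ioi s₁))
      (hτ.tendsto s₁ |>.mono_left nhdsWithin_le_nhds) ?_
    filter_upwards [Ioo_mem_nhdsGT hs₁1] with s hs
    exact (hgt s hs.1 hs.2.le).le
  have hS' : IsCompact {s ∈ Set.Icc s₁ 1 | τ 1 ≤ τ s} :=
    isCompact_Icc.inter_right (isClosed_le continuous_const hτ)
  obtain ⟨s₂, hs₂, hmin⟩ := hS'.exists_isLeast ⟨1, ⟨hs₁1.le, le_rfl⟩, le_rfl⟩
  have hlt : ∀ s, s₁ ≤ s → s < s₂ → τ s < τ 1 := fun s h1 h2 => by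
    by_contra hc
    exact absurd (hmin ⟨⟨h1, h2.le.trans hs₂.1.2⟩, not_lt.1 hc⟩) (not_le.2 h2)
  have h12 : s₁ < s₂ := lt_of_le_of_ne hs₂.1.1 fun heq => by
    have := hs₂.2
    rw [← heq, hτ₁] at this
    linarith
  have hτ₂ : τ s₂ = τ 1 := by
    refine le_antisymm ?_ hs₂.2
    refine le_of_tendsto (x := nhdsWithin s₂ (Set.Iio s₂))
      (hτ.tendsto s₂ |>.mono_left nhdsWithin_le_nhds) ?_
    filter_upwards [Ioo_mem_nhdsLT h12] with s hs
    exact (hlt s hs.1.le hs.2).le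
  refine ⟨s₁, s₂, h12, hτ₁, hτ₂, fun s hs => ⟨?_, ?_⟩⟩
  · rcases hs.1.eq_or_lt with rfl | h1
    · exact hτ₁.ge
    · exact (hgt s h1 (hs.2.trans hs₂.1.2)).le
  · rcases hs.2.eq_or_lt with rfl | h1
    · exact hτ₂.le
    · exact (hlt s hs.1 h1).le

section Monotone

variable {d : ℕ} {β : Fin d → ℝ} {v : Module.Basis (Fin d) ℝ (RSpace d)} {κ η θ q μ : ℝ}
  {A : Matrix (Fin d) (Fin d) ℤ} {F : RSpace d → RSpace d} {W : Fin d → RSpace d → RSpace d}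
  {c : Fin d → RSpace d → ℝ} {H : RSpace d → RSpace d} {B : RSpace d →L[ℝ] RSpace d} {m : Fin d}

lemma IsInvariantFrame.multiplier_div_eq (h : IsInvariantFrame β v κ η θ F W c)
    (G : SpectralGap β κ η q) (m : Fin d) (x : RSpace d) :
    c m x / β m = |c m x| / |β m| := by
  have h1 := h.multiplier m x
  have h2 := G.κ_lt m
  rw [← abs_div, abs_of_nonneg]
  rcases le_or_gt 0 (β m) with hb | hb
  · rw [abs_of_nonneg hb] at h2
    rw [abs_le] at h1
    exact div_nonneg (by linarith) hb
  · rw [abs_of_neg hb] at h2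
    rw [abs_le] at h1
    exact div_nonneg_of_nonpos (by linarith) hb.le

/-- Motion of the `m`-th coordinate under the iterates of `F` along a curve tangent to `W m`. -/
lemma IsInvariantFrame.hasDerivAt_coord_iterate (h : IsInvariantFrame β v κ η θ F W c)
    (hF : Differentiable ℝ F) {g : ℝ → RSpace d} {a s : ℝ}
    (hg : HasDerivAt g (a • W m (g s)) s) (n : ℕ) :
    HasDerivAt (fun r => coordCLM v m (F^[n] (g r)))
      (a * ∏ k ∈ Finset.range n, c m (F^[k] (g s))) s := by
  have h1 : HasFDerivAt F^[n] (fderiv ℝ F^[n] (g s)) (g s) := (hF.iterate n (g s)).hasFDerivAt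
  have h2 := (coordCLM v m).hasFDerivAt.comp_hasDerivAt s (h1.comp_hasDerivAt s hg)
  rw [map_smul, fderiv_iterate_of_invariant hF (h.fderiv_apply m), map_smul, map_smul,
    coordCLM_apply, h.repr_self, smul_eq_mul, smul_eq_mul, mul_one] at h2
  exact h2

lemma IsConjugacyLift.exists_coord_sub_le (hH : IsConjugacyLift A F H B) (π : RSpace d →L[ℝ] ℝ) :
    ∃ D : ℝ, 0 ≤ D ∧ ∀ x y, |π (H x) - π (H y) - π (B (x - y))| ≤ D := by
  obtain ⟨C, hC0, hC⟩ := hH.bounded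
  refine ⟨‖π‖ * (2 * C), by positivity, fun x y => ?_⟩
  have h1 : π (H x) - π (H y) - π (B (x - y)) = π ((H x - B x) - (H y - B y)) := by
    simp only [map_sub]; ring
  rw [h1]
  refine (π.le_opNorm _).trans (mul_le_mul_of_nonneg_left ?_ (norm_nonneg _))
  linarith [norm_sub_le (H x - B x) (H y - B y), hC x, hC y]

lemma linLift_iterate_add_smul {u : RSpace d} {b : ℝ} (hu : linLift A u = b • u) (n : ℕ)
    (x : RSpace d) (t : ℝ) :
    (linLift A)^[n] (x + t • u) = (linLift A)^[n] x + (b ^ n * t) • u := by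
  induction n with
  | zero => simp
  | succ n ih =>
    rw [Function.iterate_succ_apply', ih, map_add, map_smul, hu, Function.iterate_succ_apply',
      smul_smul]
    congr 2
    ring

/-- The image curve moves in the direction in which the linear part of `H` moves the parameter. -/
lemma IsTangentCurve.mul_sub_pos (h : IsInvariantFrame β v κ η θ F W c) (G : SpectralGap β κ η q)
    (G' : IsHyperbolicGap β κ μ) (hF : Differentiable ℝ F) (hH : IsConjugacyLift A F H B)
    (hper : ∀ x k, F (x + latticeVec k) = F x + linLift A (latticeVec k)) (hm : 1 < |β m|)
    {x u : RSpace d} (hu : linLift A u = β m • u) {γ : ℝ → RSpace d} {τ : ℝ → ℝ}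
    (hγ : IsTangentCurve H (W m) (coordCLM v m) x u γ τ) {s₁ s₂ : ℝ} (hs : s₁ < s₂)
    (hpos : ∀ s ∈ Set.Icc s₁ s₂, 0 < deriv (fun r => coordCLM v m (γ r)) s) :
    0 < coordCLM v m (B u) * (τ s₂ - τ s₁) := by
  set π := coordCLM v m with hπ
  set Q : ℝ → ℝ := fun r => π (γ r) with hQ
  obtain ⟨D, hD0, hD⟩ := hH.exists_coord_sub_le π
  have hβ0 : 0 < |β m| := by linarith
  have hβne : β m ≠ 0 := abs_pos.1 hβ0
  set r : ℝ := (|β m| - κ) / |β m| with hr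
  have hρ : 1 < |β m| - κ := by linarith [G'.unstable m hm, G'.one_lt]
  have hr0 : 0 < r := div_pos (by linarith) hβ0
  have hQd : ContDiff ℝ 1 Q := π.contDiff.comp hγ.contDiff
  have hΔ : 0 < Q s₂ - Q s₁ := by
    refine sub_pos.2 (strictMonoOn_of_deriv_pos (convex_Icc s₁ s₂) hQd.continuous.continuousOn
      (fun s hs' => ?_) (Set.left_mem_Icc.2 hs.le) (Set.right_mem_Icc.2 hs.le) hs)
    rw [interior_Icc] at hs'
    exact hpos s ⟨hs'.1.le, hs'.2.le⟩
  -- Left: `F^[n]` stretches the tangent curve by at least `(|β m| - κ) ^ n`. Right: the same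
  -- displacement computed through `H`, which is within `D` of linear. Both are divided by `β m ^
  -- n`. As `|β m| - κ > 1`, the error `D` loses for large `n`.
  have key : ∀ n : ℕ, r ^ n * (Q s₂ - Q s₁) ≤ π (B u) * (τ s₂ - τ s₁) + D / |β m| ^ n := by
    intro n
    have hd : ∀ s, HasDerivAt (fun r' => π (F^[n] (γ r')) / β m ^ n - r ^ n * Q r')
        (deriv Q s * (∏ k ∈ Finset.range n, c m (F^[k] (γ s))) / β m ^ n - r ^ n * deriv Q s) s :=
      fun s => by
        have hg : HasDerivAt γ (deriv Q s • W m (γ s)) s := by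
          have := (hγ.contDiff.differentiable one_ne_zero s).hasDerivAt
          rwa [hγ.tangent s] at this
        exact ((h.hasDerivAt_coord_iterate hF hg n).div_const _).sub
          ((hQd.differentiable one_ne_zero s).hasDerivAt.const_mul _)
    have hmono : MonotoneOn (fun r' => π (F^[n] (γ r')) / β m ^ n - r ^ n * Q r')
        (Set.Icc s₁ s₂) := by
      refine monotoneOn_of_deriv_nonneg (convex_Icc _ _)
        (fun s _ => (hd s).continuousAt.continuousWithinAt)
        (fun s _ => (hd s).differentiableAt.differentiableWithinAt) fun s hs' => ?_
      rw [(hd s).deriv]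
      rw [interior_Icc] at hs'
      have h1 : (∏ k ∈ Finset.range n, c m (F^[k] (γ s))) / β m ^ n
          = ∏ k ∈ Finset.range n, (c m (F^[k] (γ s)) / β m) := by
        rw [Finset.prod_div_distrib]; simp
      have h2 : r ^ n ≤ (∏ k ∈ Finset.range n, c m (F^[k] (γ s))) / β m ^ n := by
        rw [h1]
        calc r ^ n = ∏ k ∈ Finset.range n, r := by simp
          _ ≤ _ := by
            refine Finset.prod_le_prod (fun _ _ => hr0.le) fun k _ => ?_
            rw [h.multiplier_div_eq G, hr]
            exact div_le_div_of_nonneg_right (h.le_abs_multiplier m _) hβ0.le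
      have h3 := hpos s ⟨hs'.1.le, hs'.2.le⟩
      rw [mul_div_assoc, mul_comm (r ^ n), ← mul_sub]
      exact mul_nonneg h3.le (sub_nonneg.2 h2)
    have h1 := hmono (Set.left_mem_Icc.2 hs.le) (Set.right_mem_Icc.2 hs.le) hs.le
    obtain ⟨l, hl⟩ := hH.exists_iterate_eq hper n
    have h2 : ∀ s, π (F^[n] (γ s))
        = π (H ((linLift A)^[n] x + (β m ^ n * τ s) • u)) - π (latticeVec l) := fun s => by
      rw [hγ.eq, ← linLift_iterate_add_smul hu, hl, map_add]; ring
    have h3 := hD ((linLift A)^[n] x + (β m ^ n * τ s₂) • u)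
      ((linLift A)^[n] x + (β m ^ n * τ s₁) • u)
    have h4 : (linLift A)^[n] x + (β m ^ n * τ s₂) • u - ((linLift A)^[n] x + (β m ^ n * τ s₁) • u)
        = (β m ^ n * (τ s₂ - τ s₁)) • u := by
      rw [mul_sub, sub_smul]; abel
    rw [h4, map_smul, map_smul, smul_eq_mul] at h3
    have h5 : (π (F^[n] (γ s₂)) - π (F^[n] (γ s₁))) / β m ^ n
        ≤ π (B u) * (τ s₂ - τ s₁) + D / |β m| ^ n := by
      rw [h2, h2]
      have hn : β m ^ n ≠ 0 := pow_ne_zero _ hβne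
      have e1 : ∀ X Y Z : ℝ, (X - Z - (Y - Z)) / β m ^ n
          = π (B u) * (τ s₂ - τ s₁) + (X - Y - β m ^ n * (τ s₂ - τ s₁) * π (B u)) / β m ^ n :=
        fun X Y Z => by field_simp; ring
      rw [e1]
      refine add_le_add le_rfl ((le_abs_self _).trans ?_)
      rw [abs_div, abs_pow]
      exact div_le_div_of_nonneg_right h3 (by positivity)
    dsimp only at h1
    rw [sub_div] at h5
    linarith
  have hlim : Filter.Tendsto (fun n : ℕ => (|β m| - κ) ^ n * (Q s₂ - Q s₁)) Filter.atTop
      Filter.atTop := (tendsto_pow_atTop_atTop_of_one_lt hρ).atTop_mul_const hΔ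
  obtain ⟨n, hn⟩ := (hlim.eventually (Filter.eventually_gt_atTop D)).exists
  have h1 := key n
  have hbn : 0 < |β m| ^ n := by positivity
  rw [hr, div_pow, div_mul_eq_mul_div] at h1
  have h2 : D / |β m| ^ n < (|β m| - κ) ^ n * (Q s₂ - Q s₁) / |β m| ^ n :=
    div_lt_div_of_pos_right hn hbn
  linarith

lemma IsTangentCurve.comp_neg {W : RSpace d → RSpace d} {π : RSpace d →L[ℝ] ℝ} {x u : RSpace d}
    {γ : ℝ → RSpace d} {τ : ℝ → ℝ} (hγ : IsTangentCurve H W π x u γ τ) :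
    IsTangentCurve H W π x u (fun s => γ (-s)) fun s => τ (-s) := by
  refine ⟨hγ.contDiff.comp contDiff_neg, hγ.continuous.comp continuous_neg,
    fun s => hγ.eq _, fun s => ?_⟩
  rw [deriv_comp_neg, deriv_comp_neg (f := fun r => π (γ r)), hγ.tangent, neg_smul]

lemma IsTangentCurve.mul_sub_neg (h : IsInvariantFrame β v κ η θ F W c) (G : SpectralGap β κ η q)
    (G' : IsHyperbolicGap β κ μ) (hF : Differentiable ℝ F) (hH : IsConjugacyLift A F H B)
    (hper : ∀ x k, F (x + latticeVec k) = F x + linLift A (latticeVec k)) (hm : 1 < |β m|)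
    {x u : RSpace d} (hu : linLift A u = β m • u) {γ : ℝ → RSpace d} {τ : ℝ → ℝ}
    (hγ : IsTangentCurve H (W m) (coordCLM v m) x u γ τ) {s₁ s₂ : ℝ} (hs : s₁ < s₂)
    (hneg : ∀ s ∈ Set.Icc s₁ s₂, deriv (fun r => coordCLM v m (γ r)) s < 0) :
    0 < coordCLM v m (B u) * (τ s₁ - τ s₂) := by
  have := hγ.comp_neg.mul_sub_pos h G G' hF hH hper hm hu (neg_lt_neg hs) fun s hs' => by
    rw [deriv_comp_neg (f := fun r => coordCLM v m (γ r))]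
    exact neg_pos.2 (hneg (-s) ⟨by linarith [hs'.2], by linarith [hs'.1]⟩)
  simpa using this

lemma IsTangentCurve.exists_deriv_ne_zero {W : RSpace d → RSpace d} {π : RSpace d →L[ℝ] ℝ}
    {x u : RSpace d} {γ : ℝ → RSpace d} {τ : ℝ → ℝ} (hγ : IsTangentCurve H W π x u γ τ) {s₁ s₂ : ℝ}
    (hs : s₁ < s₂) (hne : γ s₁ ≠ γ s₂) : ∃ s ∈ Set.Ioo s₁ s₂, deriv (fun r => π (γ r)) s ≠ 0 := by
  by_contra hcon
  push Not at hcon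
  apply hne
  have h0 : ∀ s ∈ Set.Ico s₁ s₂, HasDerivWithinAt γ 0 (Set.Ici s) s := by
    have hd : ∀ s, HasDerivAt γ (deriv γ s) s := fun s =>
      (hγ.contDiff.differentiable one_ne_zero s).hasDerivAt
    have hc : Continuous (deriv γ) := hγ.contDiff.continuous_deriv le_rfl
    have hcl : IsClosed {s | deriv γ s = 0} := isClosed_eq hc continuous_const
    have hsub : Set.Icc s₁ s₂ ⊆ {s | deriv γ s = 0} := by
      rw [← closure_Ioo hs.ne]
      refine hcl.closure_subset_iff.2 fun s hs' => ?_
      change deriv γ s = 0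
      rw [hγ.tangent, hcon s hs', zero_smul]
    intro s hs'
    have h1 : deriv γ s = 0 := hsub ⟨hs'.1, hs'.2.le⟩
    exact h1 ▸ (hd s).hasDerivWithinAt
  exact (constant_of_has_deriv_right_zero hγ.contDiff.continuous.continuousOn h0 s₂
    (Set.right_mem_Icc.2 hs.le)).symm

end Monotone

lemma exists_interval_deriv_sign {Q : ℝ → ℝ} (hQ : ContDiff ℝ 1 Q) {s : ℝ} (hne : deriv Q s ≠ 0) :
    ∃ r, s < r ∧ ((∀ t ∈ Set.Icc s r, 0 < deriv Q t) ∨ ∀ t ∈ Set.Icc s r, deriv Q t < 0) := by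
  have hc : Continuous (deriv Q) := hQ.continuous_deriv le_rfl
  have hin : ∀ δ > 0, ∀ r ∈ Set.Icc s (s + δ / 2), dist r s < δ := fun δ hδ r hr => by
    rw [Real.dist_eq, abs_lt]; constructor <;> linarith [hr.1, hr.2]
  rcases lt_or_gt_of_ne hne with hlt | hgt
  · obtain ⟨δ, hδ, hball⟩ := Metric.eventually_nhds_iff.1
      ((hc.tendsto s).eventually (gt_mem_nhds hlt))
    exact ⟨s + δ / 2, by linarith, Or.inr fun t ht => hball (hin δ hδ t ht)⟩
  · obtain ⟨δ, hδ, hball⟩ := Metric.eventually_nhds_iff.1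
      ((hc.tendsto s).eventually (lt_mem_nhds hgt))
    exact ⟨s + δ / 2, by linarith, Or.inl fun t ht => hball (hin δ hδ t ht)⟩

/-! ### Parametrization of the unstable leaves by a coordinate -/

/-- `H` maps the lines of direction `u` to curves tangent to `W`, parametrized by the functional
`π`, and the action of the dynamics on them is governed by the Birkhoff sums of `φ`. -/
structure IsLeafMap {d : ℕ} (A : Matrix (Fin d) (Fin d) ℤ) (H W : RSpace d → RSpace d)
    (π : RSpace d →L[ℝ] ℝ) (φ : RSpace d → ℝ) (u : RSpace d) (b a D : ℝ) : Prop where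
  one_lt : 1 < |b|
  pos : 0 < a
  strictMono : ∀ x, StrictMono fun t : ℝ => π (H (x + t • u))
  coarse : ∀ x t₁ t₂, |π (H (x + t₂ • u)) - π (H (x + t₁ • u)) - a * (t₂ - t₁)| ≤ D
  param : ∀ x, ∃ Γ : ℝ → RSpace d, (∀ t : ℝ, H (x + t • u) = Γ (π (H (x + t • u)))) ∧
    ∀ r, HasDerivAt Γ (W (Γ r)) r
  expand : ∀ (n : ℕ) x t₁ t₂, ∃ t ∈ Set.uIcc t₁ t₂,
    π (H ((linLift A)^[n] x + (b ^ n * t₂) • u)) - π (H ((linLift A)^[n] x + (b ^ n * t₁) • u))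
      = b ^ n * Real.exp (birkhoff A H φ n (x + t • u) - n * Real.log |b|)
        * (π (H (x + t₂ • u)) - π (H (x + t₁ • u)))

section Charts

variable {d : ℕ} {β : Fin d → ℝ} {v : Module.Basis (Fin d) ℝ (RSpace d)} {κ η θ q μ : ℝ}
  {A : Matrix (Fin d) (Fin d) ℤ} {F : RSpace d → RSpace d} {W : Fin d → RSpace d → RSpace d}
  {c : Fin d → RSpace d → ℝ} {H : RSpace d → RSpace d} {B : RSpace d →L[ℝ] RSpace d} {m : Fin d}

lemma injective_along_line {h : Torus d ≃ₜ Torus d}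
    (hHh : ∀ x, torusProj (H x) = h (torusProj x)) (hdet : IsUnit A.det) {b : ℝ} (hb : 1 < |b|)
    {u : RSpace d} (hu : linLift A u = b • u) (hu0 : u ≠ 0) (x : RSpace d) :
    Function.Injective fun t : ℝ => H (x + t • u) := by
  intro t₁ t₂ ht
  have h1 : torusProj (x + t₁ • u) = torusProj (x + t₂ • u) :=
    h.injective (by rw [← hHh, ← hHh]; exact congrArg torusProj ht)
  obtain ⟨l, hl⟩ := torusProj_eq_iff.1 h1
  have h3 : (t₁ - t₂) • u = latticeVec l := by
    rw [sub_smul, sub_eq_iff_eq_add, add_comm, ← add_right_inj x, hl]; abel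
  have h4 := smul_eq_zero_of_eq_latticeVec hdet hb hu h3
  exact sub_eq_zero.1 ((smul_eq_zero.1 h4).resolve_right hu0)

/-- Injectivity of `H` on the line yields a nonconstant tangent curve, hence a piece on which its
coordinate moves strictly; on that piece the product with `coordCLM v m (B u)` is positive. -/
lemma coord_linearPart_ne_zero (h : IsInvariantFrame β v κ η θ F W c) (G : SpectralGap β κ η q)
    (G' : IsHyperbolicGap β κ μ) (hF : Differentiable ℝ F) (hH : IsConjugacyLift A F H B)
    (hper : ∀ x k, F (x + latticeVec k) = F x + linLift A (latticeVec k)) (hm : 1 < |β m|)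
    {u : RSpace d} (hu : linLift A u = β m • u)
    (hinj : ∀ x, Function.Injective fun t : ℝ => H (x + t • u))
    (hcurve : ∀ x t₁ t₂, ∃ γ τ, IsTangentCurve H (W m) (coordCLM v m) x u γ τ ∧ τ 0 = t₁ ∧ τ 1 = t₂) :
    coordCLM v m (B u) ≠ 0 := by
  obtain ⟨γ, τ, hγ, h0, h1⟩ := hcurve 0 0 1
  have hne : γ 0 ≠ γ 1 := fun heq => by
    rw [hγ.eq, hγ.eq] at heq
    have := hinj 0 heq
    rw [h0, h1] at this
    exact zero_ne_one this
  obtain ⟨s, -, hs⟩ := hγ.exists_deriv_ne_zero one_pos hne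
  obtain ⟨r, hr, hsign⟩ := exists_interval_deriv_sign
    ((coordCLM v m).contDiff.comp hγ.contDiff) hs
  intro ha
  rcases hsign with hpos | hneg
  · have := hγ.mul_sub_pos h G G' hF hH hper hm hu hr hpos
    rw [ha, zero_mul] at this
    exact lt_irrefl _ this
  · have := hγ.mul_sub_neg h G G' hF hH hper hm hu hr hneg
    rw [ha, zero_mul] at this
    exact lt_irrefl _ this

lemma strictMono_coord (h : IsInvariantFrame β v κ η θ F W c) (G : SpectralGap β κ η q)
    (G' : IsHyperbolicGap β κ μ) (hF : Differentiable ℝ F) (hH : IsConjugacyLift A F H B)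
    (hper : ∀ x k, F (x + latticeVec k) = F x + linLift A (latticeVec k)) (hm : 1 < |β m|)
    {u : RSpace d} (hu : linLift A u = β m • u)
    (hinj : ∀ x, Function.Injective fun t : ℝ => H (x + t • u))
    (hcurve : ∀ x t₁ t₂, ∃ γ τ, IsTangentCurve H (W m) (coordCLM v m) x u γ τ ∧ τ 0 = t₁ ∧ τ 1 = t₂)
    (ha : 0 < coordCLM v m (B u)) (x : RSpace d) :
    StrictMono fun t : ℝ => coordCLM v m (H (x + t • u)) := by
  set π := coordCLM v m with hπ
  set y : ℝ → ℝ := fun t => π (H (x + t • u)) with hy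
  have hyc : Continuous y := π.continuous.comp (hH.continuous.comp (by fun_prop))
  have hmono : Monotone y := by
    intro t₁ t₂ ht
    rcases ht.eq_or_lt with rfl | ht
    · exact le_rfl
    obtain ⟨γ, τ, hγ, h0, h1⟩ := hcurve x t₁ t₂
    have := le_of_monotone_crossings (y := y) (q := fun s => π (γ s)) hyc hγ.continuous
      (π.contDiff.comp hγ.contDiff) (fun s => by rw [hγ.eq])
      (fun s₁ s₂ hs hpos => sub_pos.1 <| pos_of_mul_pos_right
        (hγ.mul_sub_pos h G G' hF hH hper hm hu hs hpos) ha.le)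
      (fun s₁ s₂ hs hneg => sub_pos.1 <| pos_of_mul_pos_right
        (hγ.mul_sub_neg h G G' hF hH hper hm hu hs hneg) ha.le) (by rwa [h0, h1])
    rwa [h0, h1] at this
  intro t₁ t₂ ht
  refine lt_of_le_of_ne (hmono ht.le) fun heq => ?_
  obtain ⟨γ, τ, hγ, h0, h1⟩ := hcurve x t₁ t₂
  -- If the coordinate were equal at both ends, monotonicity would make it constant in between, so
  -- the tangent curve would stand still there, contradicting injectivity.
  obtain ⟨s₁, s₂, hs, hs₁, hs₂, hmem⟩ := exists_subinterval hγ.continuous (by rwa [h0, h1])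
  rw [h0] at hs₁ hmem
  rw [h1] at hs₂ hmem
  have hne : γ s₁ ≠ γ s₂ := fun he => by
    rw [hγ.eq, hγ.eq] at he
    have := hinj x he
    rw [hs₁, hs₂] at this
    exact ht.ne this
  obtain ⟨s, hs', hds⟩ := hγ.exists_deriv_ne_zero hs hne
  apply hds
  have hev : (fun r => π (γ r)) =ᶠ[nhds s] fun _ => y t₁ := by
    filter_upwards [Icc_mem_nhds hs'.1 hs'.2] with r hr
    have h2 : π (γ r) = y (τ r) := by rw [hγ.eq]
    rw [h2]
    exact le_antisymm ((hmono (hmem r hr).2).trans_eq heq.symm) (hmono (hmem r hr).1)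
  rw [hev.deriv_eq, deriv_const]

/-- The coordinate is a homeomorphism of the line onto `ℝ`: strictly monotone, and onto by coarse
linearity. It thus parametrizes the leaf, and the result is an integral curve of `W`. -/
lemma exists_coord_param (hH : IsConjugacyLift A F H B) {W : RSpace d → RSpace d}
    (hW : Continuous W) {π : RSpace d →L[ℝ] ℝ} {u : RSpace d} {a D : ℝ}
    (hcurve : ∀ x t₁ t₂, ∃ γ τ, IsTangentCurve H W π x u γ τ ∧ τ 0 = t₁ ∧ τ 1 = t₂)
    (ha : 0 < a) (x : RSpace d) (hmono : StrictMono fun t : ℝ => π (H (x + t • u)))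
    (hD : ∀ t₁ t₂, |π (H (x + t₂ • u)) - π (H (x + t₁ • u)) - a * (t₂ - t₁)| ≤ D) :
    ∃ Γ : ℝ → RSpace d, (∀ t : ℝ, H (x + t • u) = Γ (π (H (x + t • u)))) ∧
      ∀ r, HasDerivAt Γ (W (Γ r)) r := by
  set y : ℝ → ℝ := fun t => π (H (x + t • u)) with hy
  have hyc : Continuous y := π.continuous.comp (hH.continuous.comp (by fun_prop))
  have hsurj : Function.Surjective y := by
    refine hyc.surjective ?_ ?_
    · refine Filter.tendsto_atTop_mono (f := fun t => a * t + (y 0 - D)) (fun t => ?_)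
        (Filter.tendsto_atTop_add_const_right _ _ (Filter.tendsto_id.const_mul_atTop ha))
      have := (abs_le.1 (hD 0 t)).1
      simp only [hy] at this ⊢
      linarith
    · refine Filter.tendsto_atBot_mono (f := fun t => a * t + (y 0 + D)) (fun t => ?_)
        (Filter.tendsto_atBot_add_const_right _ _ (Filter.tendsto_id.const_mul_atBot ha))
      have := (abs_le.1 (hD 0 t)).2
      simp only [hy] at this ⊢
      linarith
  set e : ℝ ≃o ℝ := hmono.orderIsoOfSurjective y hsurj with he
  have hey : ∀ t, e.symm (y t) = t := fun t => e.symm_apply_apply t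
  set Γ : ℝ → RSpace d := fun r => H (x + e.symm r • u) with hΓ
  have hΓc : Continuous Γ := hH.continuous.comp
    (continuous_const.add (e.symm.continuous.smul continuous_const))
  refine ⟨Γ, fun t => ?_, fun r₀ => ?_⟩
  · change _ = H (x + e.symm (y t) • u)
    rw [hey]
  have hintl : ∀ r, Γ r = Γ r₀ + ∫ s in r₀..r, W (Γ s) := by
    intro r
    obtain ⟨γ, τ, hγ, h0, h1⟩ := hcurve x (e.symm r₀) (e.symm r)
    have hQd : ContDiff ℝ 1 fun s => π (γ s) := π.contDiff.comp hγ.contDiff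
    have hγΓ : ∀ s, γ s = Γ (π (γ s)) := fun s => by
      have h2 : π (γ s) = y (τ s) := by rw [hγ.eq]
      rw [h2, hΓ]
      dsimp only
      rw [hey, hγ.eq]
    have hyr : ∀ r, y (e.symm r) = r := fun r => e.apply_symm_apply r
    -- The change of variables is insensitive to backtracking, so integrating the velocity of `γ`
    -- gives the integral of `W ∘ Γ` between the end coordinates. The integral equation follows
    -- without uniqueness of solutions of the differential equation.
    have h2 := intervalIntegral.integral_deriv_smul_comp (a := 0) (b := 1)
      (f := fun s => π (γ s)) (f' := deriv fun s => π (γ s)) (g := fun s => W (Γ s))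
      (fun s _ => (hQd.differentiable one_ne_zero s).hasDerivAt)
      (hQd.continuous_deriv le_rfl).continuousOn (hW.comp hΓc)
    have h3 : ∫ s in (0 : ℝ)..1, deriv γ s = γ 1 - γ 0 :=
      intervalIntegral.integral_eq_sub_of_hasDerivAt
        (fun s _ => (hγ.contDiff.differentiable one_ne_zero s).hasDerivAt)
        ((hγ.contDiff.continuous_deriv le_rfl).intervalIntegrable _ _)
    have h4 : ∀ s, deriv γ s = deriv (fun s => π (γ s)) s • ((fun s => W (Γ s)) ∘ fun s => π (γ s)) s :=
      fun s => by
        rw [hγ.tangent]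
        simp only [Function.comp]
        rw [← hγΓ]
    simp only [h4] at h3
    rw [h2] at h3
    have e0 : π (γ 0) = r₀ := by rw [hγ.eq, h0]; exact hyr r₀
    have e1 : π (γ 1) = r := by rw [hγ.eq, h1]; exact hyr r
    have g0 := hγΓ 0
    have g1 := hγΓ 1
    rw [e0] at g0
    rw [e1] at g1
    rw [e0, e1, g0, g1] at h3
    rw [h3]; abel
  have hcont : Continuous fun s => W (Γ s) := hW.comp hΓc
  have h5 : HasDerivAt (fun r => Γ r₀ + ∫ s in r₀..r, W (Γ s)) (W (Γ r₀)) r₀ :=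
    (hcont.integral_hasStrictDerivAt r₀ r₀).hasDerivAt.const_add _
  exact h5.congr_of_eventuallyEq (Filter.Eventually.of_forall hintl)

theorem exists_isLeafMap (h : IsInvariantFrame β v κ η θ F W c) (G : SpectralGap β κ η q)
    (G' : IsHyperbolicGap β κ μ) (hθ : 0 < θ) (hF : Differentiable ℝ F)
    (hH : IsConjugacyLift A F H B)
    (hper : ∀ x k, F (x + latticeVec k) = F x + linLift A (latticeVec k)) (hm : 1 < |β m|)
    {u : RSpace d} (hu : linLift A u = β m • u)
    (hinj : ∀ x, Function.Injective fun t : ℝ => H (x + t • u))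
    (hcurve : ∀ x t₁ t₂, ∃ γ τ, IsTangentCurve H (W m) (coordCLM v m) x u γ τ ∧ τ 0 = t₁ ∧ τ 1 = t₂)
    (ha : 0 < coordCLM v m (B u)) :
    ∃ D, IsLeafMap A H (W m) (coordCLM v m) (fun z => Real.log |c m z|) u (β m)
      (coordCLM v m (B u)) D := by
  set π := coordCLM v m with hπ
  obtain ⟨D, hD0, hD⟩ := hH.exists_coord_sub_le π
  have hmono := fun x => strictMono_coord h G G' hF hH hper hm hu hinj hcurve ha x
  have hcoarse : ∀ x t₁ t₂, |π (H (x + t₂ • u)) - π (H (x + t₁ • u)) - π (B u) * (t₂ - t₁)| ≤ D :=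
    fun x t₁ t₂ => by
      have h1 := hD (x + t₂ • u) (x + t₁ • u)
      have h2 : x + t₂ • u - (x + t₁ • u) = (t₂ - t₁) • u := by rw [sub_smul]; abel
      rw [h2, map_smul, map_smul, smul_eq_mul, mul_comm] at h1
      exact h1
  have hparam := fun x => exists_coord_param hH (h.continuous hθ m) hcurve ha x (hmono x) (hcoarse x)
  have hβ0 : 0 < |β m| := by linarith
  have hβne : β m ≠ 0 := abs_pos.1 hβ0
  refine ⟨D, hm, ha, hmono, hcoarse, hparam, fun n x => ?_⟩
  obtain ⟨Γ, hΓ, hΓd⟩ := hparam x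
  obtain ⟨l, hl⟩ := hH.exists_iterate_eq hper n
  -- The sign of each multiplier is that of `β m`, so the product is recovered from logarithms of
  -- moduli.
  have hprod : ∀ z, ∏ k ∈ Finset.range n, c m (F^[k] (H z))
      = β m ^ n * Real.exp (birkhoff A H (fun z => Real.log |c m z|) n z - n * Real.log |β m|) := by
    intro z
    have h1 : birkhoff A H (fun z => Real.log |c m z|) n z - n * Real.log |β m|
        = ∑ k ∈ Finset.range n, Real.log (|c m (F^[k] (H z))| / |β m|) := by
      have h2 : (n : ℝ) * Real.log |β m| = ∑ k ∈ Finset.range n, Real.log |β m| := by simp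
      rw [h2, birkhoff, ← Finset.sum_sub_distrib]
      refine Finset.sum_congr rfl fun k _ => ?_
      obtain ⟨l', hl'⟩ := hH.exists_iterate_eq hper k
      rw [hl', h.multiplier_periodic, Real.log_div (abs_ne_zero.2 (h.multiplier_ne_zero G m _))
        hβ0.ne']
    rw [h1, Real.exp_sum]
    have h3 : β m ^ n = ∏ k ∈ Finset.range n, β m := by simp
    rw [h3, ← Finset.prod_mul_distrib]
    refine Finset.prod_congr rfl fun k _ => ?_
    rw [Real.exp_log (div_pos (abs_pos.2 (h.multiplier_ne_zero G m _)) hβ0),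
      ← h.multiplier_div_eq G, mul_div_cancel₀ _ hβne]
  have hder : ∀ r, HasDerivAt (fun r => π (F^[n] (Γ r))) (∏ k ∈ Finset.range n, c m (F^[k] (Γ r))) r :=
    fun r => by
      have := h.hasDerivAt_coord_iterate (g := Γ) (a := 1) (s := r) (m := m) hF
        (by rw [one_smul]; exact hΓd r) n
      rwa [one_mul] at this
  have hval : ∀ t, π (H ((linLift A)^[n] x + (β m ^ n * t) • u))
      = π (F^[n] (Γ (π (H (x + t • u))))) + π (latticeVec l) := fun t => by
    rw [← linLift_iterate_add_smul hu, hl, map_add, ← hΓ]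
  have key : ∀ t₁ t₂, t₁ < t₂ → ∃ t ∈ Set.uIcc t₁ t₂,
      π (H ((linLift A)^[n] x + (β m ^ n * t₂) • u)) - π (H ((linLift A)^[n] x + (β m ^ n * t₁) • u))
        = β m ^ n * Real.exp (birkhoff A H (fun z => Real.log |c m z|) n (x + t • u)
          - n * Real.log |β m|) * (π (H (x + t₂ • u)) - π (H (x + t₁ • u))) := by
    intro t₁ t₂ ht
    -- The mean value theorem along the leaf, where the iterate has derivative the product of
    -- multipliers; the intermediate point is then pulled back to the line.
    obtain ⟨r, hr, hrd⟩ := exists_hasDerivAt_eq_slope (fun r => π (F^[n] (Γ r)))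
      (fun r => ∏ k ∈ Finset.range n, c m (F^[k] (Γ r))) (hmono x ht)
      (fun r _ => (hder r).continuousAt.continuousWithinAt) fun r _ => hder r
    obtain ⟨t, ht', rfl⟩ := intermediate_value_Icc ht.le
      (f := fun t : ℝ => π (H (x + t • u)))
      (π.continuous.comp (hH.continuous.comp (by fun_prop))).continuousOn ⟨hr.1.le, hr.2.le⟩
    refine ⟨t, Set.Icc_subset_uIcc ht', ?_⟩
    rw [← hprod, hval, hval, add_sub_add_right_eq_sub]
    have h6 : π (H (x + t₂ • u)) - π (H (x + t₁ • u)) ≠ 0 := (sub_pos.2 (hmono x ht)).ne'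
    dsimp only at hrd
    rw [eq_div_iff h6, ← hΓ t] at hrd
    exact hrd.symm
  intro t₁ t₂
  rcases lt_trichotomy t₁ t₂ with ht | rfl | ht
  · exact key t₁ t₂ ht
  · exact ⟨t₁, Set.left_mem_uIcc, by simp⟩
  · obtain ⟨t, ht', he⟩ := key t₂ t₁ ht
    exact ⟨t, Set.uIcc_comm t₁ t₂ ▸ ht', by linear_combination -he⟩

end Charts

/-! ### Irreducibility and density of the eigenlines -/

lemma coe_aeval_restrict {K V : Type*} [Field K] [AddCommGroup V] [Module K V] {f : Module.End K V}
    {S : Submodule K V} (hS : ∀ w ∈ S, f w ∈ S) (p : Polynomial K) (w : S) :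
    (Polynomial.aeval (LinearMap.restrict f hS) p w : V) = Polynomial.aeval f p w := by
  have hpow : ∀ (n : ℕ) (w : S), ((LinearMap.restrict f hS ^ n) w : V) = (f ^ n) w := fun n => by
    induction n with
    | zero => intro w; rfl
    | succ n ih => intro w; rw [pow_succ, pow_succ, Module.End.mul_apply, Module.End.mul_apply, ih]; rfl
  induction p using Polynomial.induction_on' with
  | add p q hp hq => simp [hp, hq]
  | monomial n a => simp [Polynomial.aeval_monomial, hpow]

/-- An endomorphism with irreducible characteristic polynomial has no invariant subspaces. -/
lemma eq_top_of_irreducible_charpoly {K V : Type*} [Field K] [AddCommGroup V] [Module K V]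
    [FiniteDimensional K V] {f : Module.End K V} (hf : Irreducible f.charpoly) {S : Submodule K V}
    (hS : ∀ w ∈ S, f w ∈ S) (hne : S ≠ ⊥) : S = ⊤ := by
  set g := LinearMap.restrict f hS with hg
  have : Nontrivial S := Submodule.nontrivial_iff_ne_bot.2 hne
  have hdvd : minpoly K g ∣ f.charpoly := minpoly.dvd K g <| by
    ext w
    rw [coe_aeval_restrict hS, LinearMap.aeval_self_charpoly]
    rfl
  -- The minimal polynomial of the restriction is a nonunit divisor of an irreducible polynomial, so
  -- it has full degree, leaving no room for a proper subspace.
  have hdeg : f.charpoly.natDegree = (minpoly K g).natDegree :=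
    Polynomial.natDegree_eq_natDegree (Polynomial.degree_eq_degree_of_associated
      ((hf.dvd_iff.1 hdvd).resolve_left (minpoly.not_isUnit K g)))
  have hle : (minpoly K g).natDegree ≤ Module.finrank K S := by
    rw [← LinearMap.charpoly_natDegree g]
    exact Polynomial.natDegree_le_of_dvd (LinearMap.minpoly_dvd_charpoly g) g.charpoly_monic.ne_zero
  rw [← hdeg, LinearMap.charpoly_natDegree] at hle
  exact Submodule.eq_top_of_finrank_eq (le_antisymm (Submodule.finrank_le S) hle)

section Density

variable {d : ℕ} {A : Matrix (Fin d) (Fin d) ℤ}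

/-- The coordinates of an eigenvector of an irreducible integer matrix are rationally
independent. -/
lemma sum_mul_ne_zero_of_irreducible (hirr : Irreducible (A.map (Int.cast : ℤ → ℚ)).charpoly)
    {u : RSpace d} {b : ℝ} (hu : linLift A u = b • u) (hu0 : u ≠ 0) {k : Fin d → ℤ} (hk : k ≠ 0) :
    ∑ i, (k i : ℝ) * u i ≠ 0 := by
  intro hsum
  -- Rational relations among the coordinates of `u` form the kernel of `ψ`, which is invariant
  -- under the transposed matrix because `u` is an eigenvector. A nonzero relation would make this
  -- kernel everything and `u` zero.
  set ψ : (Fin d → ℚ) →ₗ[ℚ] ℝ :=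
    { toFun := fun w => ∑ i, (w i : ℝ) * u i
      map_add' := fun w w' => by simp [add_mul, Finset.sum_add_distrib]
      map_smul' := fun r w => by simp [Finset.mul_sum, mul_assoc, Rat.smul_def] } with hψ
  have hψa : ∀ w, ψ w = ∑ i, (w i : ℝ) * u i := fun _ => rfl
  set f : Module.End ℚ (Fin d → ℚ) := Matrix.toLin' (A.map (Int.cast : ℤ → ℚ)).transpose with hf
  have hfψ : ∀ w, ψ (f w) = b * ψ w := by
    intro w
    have h1 : ∀ j, ∑ i, (A j i : ℝ) * u i = b * u j := fun j => by
      have := congrArg (fun x : RSpace d => x j) hu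
      simpa [linLift_apply] using this
    rw [hψa, hψa, Finset.mul_sum]
    have h2 : ∀ i, ((f w) i : ℝ) = ∑ j, (A j i : ℝ) * w j := fun i => by
      simp [hf, Matrix.mulVec, dotProduct]
    simp only [h2, Finset.sum_mul]
    rw [Finset.sum_comm]
    refine Finset.sum_congr rfl fun j _ => ?_
    have h3 : ∑ i, (A j i : ℝ) * w j * u i = w j * ∑ i, (A j i : ℝ) * u i := by
      rw [Finset.mul_sum]
      exact Finset.sum_congr rfl fun i _ => by ring
    rw [h3, h1]; ring
  have hirr' : Irreducible f.charpoly := by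
    rwa [hf, Matrix.charpoly_toLin', Matrix.charpoly_transpose]
  have hker : LinearMap.ker ψ = ⊤ := by
    refine eq_top_of_irreducible_charpoly hirr' (fun w hw => ?_) ?_
    · rw [LinearMap.mem_ker] at hw ⊢
      rw [hfψ, hw, mul_zero]
    · rw [Submodule.ne_bot_iff]
      refine ⟨fun i => (k i : ℚ), ?_, fun h0 => hk ?_⟩
      · rw [LinearMap.mem_ker, hψa]
        simpa using hsum
      · funext i
        simpa using congrFun h0 i
  apply hu0
  ext i
  have : ψ (Pi.single i 1) = 0 := by
    rw [← LinearMap.mem_ker, hker]; trivial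
  rw [hψa] at this
  simpa [Pi.single_apply, apply_ite (Rat.cast : ℚ → ℝ)] using this

lemma mFourier_torusProj (n : Fin d → ℤ) (x : RSpace d) :
    UnitAddTorus.mFourier n (torusProj x)
      = Complex.exp (2 * Real.pi * Complex.I * ((∑ i, (n i : ℝ) * x i : ℝ) : ℂ)) := by
  simp only [UnitAddTorus.mFourier, ContinuousMap.coe_mk, torusProj_apply]
  have h1 : ∀ i, fourier (n i) ((x i : ℝ) : UnitAddCircle)
      = Complex.exp (2 * Real.pi * Complex.I * (((n i : ℝ) * x i : ℝ) : ℂ)) := fun i => by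
    rw [fourier_coe_apply]
    congr 1
    push_cast
    ring
  simp only [h1]
  rw [← Complex.exp_sum, ← Finset.mul_sum]
  congr 2
  push_cast
  rfl

lemma mFourier_apply_add (n : Fin d → ℤ) (p q : Torus d) :
    UnitAddTorus.mFourier n (p + q) = UnitAddTorus.mFourier n p * UnitAddTorus.mFourier n q := by
  obtain ⟨x, rfl⟩ := surjective_torusProj p
  obtain ⟨y, rfl⟩ := surjective_torusProj q
  rw [← torusProj_add, mFourier_torusProj, mFourier_torusProj, mFourier_torusProj, ← Complex.exp_add,
    ← mul_add, ← Complex.ofReal_add, ← Finset.sum_add_distrib]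
  simp [mul_add]

/-- A line of rationally independent direction is dense in the torus. -/
theorem dense_range_torusProj_smul {u : RSpace d}
    (hu : ∀ k : Fin d → ℤ, k ≠ 0 → ∑ i, (k i : ℝ) * u i ≠ 0) :
    DenseRange fun t : ℝ => torusProj (t • u) := by
  set S : Set (Torus d) := Set.range fun t : ℝ => torusProj (t • u) with hS
  -- The distance to the line is invariant under translations along the line. If all its nonconstant
  -- Fourier modes vanish it is constant, hence zero.
  set φ : C(Torus d, ℂ) := ⟨fun p => ((Metric.infDist p S : ℝ) : ℂ),
    Complex.continuous_ofReal.comp (Metric.continuous_infDist_pt S)⟩ with hφ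
  have hinv : ∀ (t : ℝ) p, φ (p + torusProj (t • u)) = φ p := by
    intro t p
    have himg : (fun p => p + torusProj (t • u)) '' S = S := by
      ext q
      constructor
      · rintro ⟨_, ⟨s, rfl⟩, rfl⟩
        exact ⟨s + t, by simp only [add_smul, torusProj_add]⟩
      · rintro ⟨s, rfl⟩
        exact ⟨_, ⟨s - t, rfl⟩, by simp only [← torusProj_add, ← add_smul, sub_add_cancel]⟩
    have := Metric.infDist_image (isometry_add_right (torusProj (t • u))) (x := p) (t := S)
    rw [himg] at this
    simp only [hφ, ContinuousMap.coe_mk]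
    rw [this]
  have hcoeff : ∀ n : Fin d → ℤ, n ≠ 0 → UnitAddTorus.mFourierCoeff φ n = 0 := by
    intro n hn
    have hs := hu (-n) (neg_ne_zero.2 hn)
    set s := ∑ i, ((-n) i : ℝ) * u i with hsdef
    -- Translating by half a period of the character along the line turns the coefficient into its
    -- own negative.
    have h1 : UnitAddTorus.mFourier (-n) (torusProj ((2 * s)⁻¹ • u)) = -1 := by
      rw [mFourier_torusProj]
      have h2 : ∑ i, (((-n) i : ℤ) : ℝ) * ((2 * s)⁻¹ • u) i = 1 / 2 := by
        have : ∀ i, (((-n) i : ℤ) : ℝ) * ((2 * s)⁻¹ • u) i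
            = (2 * s)⁻¹ * ((((-n) i : ℤ) : ℝ) * u i) := fun i => by
          rw [PiLp.smul_apply, smul_eq_mul]; ring
        simp only [this]
        rw [← Finset.mul_sum]
        have h3 : ∑ i, (((-n) i : ℤ) : ℝ) * u i = s := by simp [hsdef]
        rw [h3]
        field_simp
      rw [h2, ← Complex.exp_pi_mul_I]
      congr 1
      push_cast
      ring
    have h2 : UnitAddTorus.mFourierCoeff φ n = ∫ p, UnitAddTorus.mFourier (-n) p • φ p
        ∂(MeasureTheory.Measure.pi fun _ : Fin d => (AddCircle.haarAddCircle (T := 1))) := rfl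
    have h3 : UnitAddTorus.mFourierCoeff φ n = -UnitAddTorus.mFourierCoeff φ n := by
      conv_lhs => rw [h2, ← MeasureTheory.integral_add_right_eq_self _ (torusProj ((2 * s)⁻¹ • u))]
      simp only [hinv, mFourier_apply_add, h1, mul_neg, mul_one, neg_smul]
      rw [MeasureTheory.integral_neg, h2]
    exact self_eq_neg.1 h3
  have hsupp : ∀ n ∉ ({0} : Finset (Fin d → ℤ)), UnitAddTorus.mFourierCoeff φ n = 0 := fun n hn =>
    hcoeff n (by simpa using hn)
  have hsum : Summable (UnitAddTorus.mFourierCoeff φ) := summable_of_ne_finset_zero hsupp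
  have hconst : ∀ p, φ p = UnitAddTorus.mFourierCoeff φ 0 := fun p => by
    have h1 := UnitAddTorus.hasSum_mFourier_series_apply_of_summable hsum p
    have h2 : HasSum (fun n => UnitAddTorus.mFourierCoeff φ n • UnitAddTorus.mFourier n p)
        (UnitAddTorus.mFourierCoeff φ 0 • UnitAddTorus.mFourier 0 p) :=
      hasSum_single 0 fun n hn => by rw [hcoeff n hn, zero_smul]
    rw [h1.unique h2]
    simp [UnitAddTorus.mFourier_zero]
  intro p
  have hne : S.Nonempty := Set.range_nonempty _
  rw [Metric.mem_closure_iff_infDist_zero hne]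
  have h0 : torusProj ((0 : ℝ) • u) ∈ S := ⟨0, rfl⟩
  have h1 := (hconst p).trans (hconst (torusProj ((0 : ℝ) • u))).symm
  simp only [hφ, ContinuousMap.coe_mk, Metric.infDist_zero_of_mem h0] at h1
  exact_mod_cast h1

lemma mem_of_isClosed_of_periodic {u : RSpace d}
    (hu : DenseRange fun t : ℝ => torusProj (t • u)) {Z : Set (RSpace d)} (hZ : IsClosed Z)
    (hper : ∀ x ∈ Z, ∀ k, x + latticeVec k ∈ Z) {z : RSpace d} (hz : ∀ t : ℝ, z + t • u ∈ Z)
    (x : RSpace d) : x ∈ Z := by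
  by_contra hx
  have hopen : IsOpen (torusProj '' ((fun w => z + w) ⁻¹' Zᶜ)) :=
    isOpenQuotientMap_torusProj.isOpenMap _
      (hZ.isOpen_compl.preimage (continuous_const.add continuous_id))
  obtain ⟨t, w, hw, hwt⟩ := hu.exists_mem_open hopen
    ⟨_, x - z, by simpa using hx, rfl⟩
  obtain ⟨k, rfl⟩ := torusProj_eq_iff.1 hwt
  apply hw
  change z + (t • u + latticeVec k) ∈ Z
  rw [← add_assoc]
  exact hper _ (hz t) k

end Density

/-! ### From bounded Birkhoff sums to bounded distortion -/

lemma nonpos_of_forall_nat_mul_le {z C : ℝ} (h : ∀ᶠ n : ℕ in Filter.atTop, n * z ≤ C) : z ≤ 0 := by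
  by_contra hz
  rw [not_le] at hz
  have h1 : Filter.Tendsto (fun n : ℕ => (n : ℝ) * z) Filter.atTop Filter.atTop :=
    tendsto_natCast_atTop_atTop.atTop_mul_const hz
  obtain ⟨n, hn, hn'⟩ := (h.and (h1.eventually (Filter.eventually_gt_atTop C))).exists
  linarith

section Rigidity

variable {d : ℕ} {A : Matrix (Fin d) (Fin d) ℤ} {F H W : RSpace d → RSpace d}
  {B : RSpace d →L[ℝ] RSpace d} {π : RSpace d →L[ℝ] ℝ} {φ : RSpace d → ℝ} {u : RSpace d}
  {b a D K lam θ L M : ℝ}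

/-- The difference quotients of `π ∘ H` along the lines of direction `u`. -/
noncomputable def leafQuotient (H : RSpace d → RSpace d) (π : RSpace d →L[ℝ] ℝ) (u : RSpace d)
    (x : RSpace d) (s : ℝ) : ℝ := (π (H (x + s • u)) - π (H x)) / s

namespace IsLeafMap

/-- After rescaling, the iterates approximate the linear part of `H` along the lines. -/
lemma exists_abs_exp_mul_sub_le (hL : IsLeafMap A H W π φ u b a D) (n : ℕ) (x : RSpace d)
    (t₁ t₂ : ℝ) : ∃ z, |Real.exp (birkhoff A H φ n z - n * Real.log |b|)
      * (π (H (x + t₂ • u)) - π (H (x + t₁ • u))) - a * (t₂ - t₁)| ≤ D / |b| ^ n := by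
  obtain ⟨t, -, ht⟩ := hL.expand n x t₁ t₂
  refine ⟨x + t • u, ?_⟩
  have hb : 0 < |b| := by linarith [hL.one_lt]
  have h1 := hL.coarse ((linLift A)^[n] x) (b ^ n * t₁) (b ^ n * t₂)
  rw [ht] at h1
  rw [le_div_iff₀ (pow_pos hb n), ← abs_pow, ← abs_mul]
  refine le_of_eq_of_le (congrArg abs ?_) h1
  ring

lemma tendsto_div_pow (hL : IsLeafMap A H W π φ u b a D) :
    Filter.Tendsto (fun n : ℕ => D / |b| ^ n) Filter.atTop (nhds 0) :=
  (tendsto_pow_atTop_atTop_of_one_lt hL.one_lt).const_div_atTop D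

/-- The rescaled displacement of a fixed segment is `exp (n * (lam - log |b|))` up to bounded
factors, and it converges to the positive number `a`; the exponent must vanish. -/
lemma log_abs_eq (hL : IsLeafMap A H W π φ u b a D)
    (hK : ∀ n x, |birkhoff A H φ n x - n * lam| ≤ K) : lam = Real.log |b| := by
  have hΔ : 0 < π (H (0 + (1 : ℝ) • u)) - π (H (0 + (0 : ℝ) • u)) :=
    sub_pos.2 (hL.strictMono 0 one_pos)
  set Δ := π (H (0 + (1 : ℝ) • u)) - π (H (0 + (0 : ℝ) • u))
  have key : ∀ n : ℕ, ∃ w, |w| ≤ K ∧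
      |Real.exp (n * (lam - Real.log |b|) + w) * Δ - a| ≤ D / |b| ^ n := fun n => by
    obtain ⟨z, hz⟩ := hL.exists_abs_exp_mul_sub_le n 0 0 1
    refine ⟨birkhoff A H φ n z - n * lam, hK n z, ?_⟩
    convert hz using 2
    rw [sub_zero, mul_one]
    congr 3
    ring
  have hsmall : ∀ᶠ n : ℕ in Filter.atTop, D / |b| ^ n < a / 2 :=
    hL.tendsto_div_pow.eventually (gt_mem_nhds (half_pos hL.pos))
  have ha := hL.pos
  have hup : lam - Real.log |b| ≤ 0 := by
    refine nonpos_of_forall_nat_mul_le (C := Real.log (3 * a / 2 / Δ) + K) ?_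
    filter_upwards [hsmall] with n hn
    obtain ⟨w, hw, hwn⟩ := key n
    have h1 : Real.exp (n * (lam - Real.log |b|) + w) ≤ 3 * a / 2 / Δ := by
      rw [le_div_iff₀ hΔ]
      linarith [(abs_le.1 hwn).2]
    have h2 := (Real.le_log_iff_exp_le (by positivity)).2 h1
    linarith [(abs_le.1 hw).1]
  have hlow : -(lam - Real.log |b|) ≤ 0 := by
    refine nonpos_of_forall_nat_mul_le (C := -Real.log (a / 2 / Δ) + K) ?_
    filter_upwards [hsmall] with n hn
    obtain ⟨w, hw, hwn⟩ := key n
    have h1 : a / 2 / Δ ≤ Real.exp (n * (lam - Real.log |b|) + w) := by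
      rw [div_le_iff₀ hΔ]
      linarith [(abs_le.1 hwn).1]
    have h2 := (Real.log_le_iff_le_exp (by positivity)).2 h1
    linarith [(abs_le.1 hw).2]
  linarith

/-- Expanding any segment, however short, until it is long, the additive error `D` becomes
negligible after rescaling, while bounded Birkhoff sums cost only `exp K`. The lower bound is
symmetric. -/
lemma abs_coord_sub_le (hL : IsLeafMap A H W π φ u b a D)
    (hK : ∀ n x, |birkhoff A H φ n x - n * Real.log (|b|)| ≤ K) (x : RSpace d) (t₁ t₂ : ℝ) :
    |π (H (x + t₂ • u)) - π (H (x + t₁ • u))| ≤ Real.exp K * a * |t₂ - t₁| := by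
  set Δ := π (H (x + t₂ • u)) - π (H (x + t₁ • u))
  have h1 : ∀ n : ℕ, Real.exp (-K) * |Δ| ≤ a * |t₂ - t₁| + D / |b| ^ n := fun n => by
    obtain ⟨z, hz⟩ := hL.exists_abs_exp_mul_sub_le n x t₁ t₂
    have h2 : Real.exp (-K) ≤ Real.exp (birkhoff A H φ n z - n * Real.log |b|) :=
      Real.exp_le_exp.2 (abs_le.1 (hK n z)).1
    have h3 := abs_sub_abs_le_abs_sub
      (Real.exp (birkhoff A H φ n z - n * Real.log |b|) * Δ) (a * (t₂ - t₁))
    rw [abs_mul, abs_mul, Real.abs_exp, abs_of_pos hL.pos] at h3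
    have h4 := mul_le_mul_of_nonneg_right h2 (abs_nonneg Δ)
    linarith
  have h2 : Real.exp (-K) * |Δ| ≤ a * |t₂ - t₁| := by
    refine ge_of_tendsto (x := Filter.atTop) ?_ (Filter.Eventually.of_forall h1)
    simpa using hL.tendsto_div_pow.const_add (a * |t₂ - t₁|)
  calc |Δ| = Real.exp K * (Real.exp (-K) * |Δ|) := by
        rw [← mul_assoc, ← Real.exp_add]; simp
    _ ≤ Real.exp K * (a * |t₂ - t₁|) := mul_le_mul_of_nonneg_left h2 (Real.exp_pos K).le
    _ = _ := by ring

lemma le_abs_coord_sub (hL : IsLeafMap A H W π φ u b a D)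
    (hK : ∀ n x, |birkhoff A H φ n x - n * Real.log (|b|)| ≤ K) (x : RSpace d) (t₁ t₂ : ℝ) :
    Real.exp (-K) * a * |t₂ - t₁| ≤ |π (H (x + t₂ • u)) - π (H (x + t₁ • u))| := by
  set Δ := π (H (x + t₂ • u)) - π (H (x + t₁ • u))
  have h1 : ∀ n : ℕ, a * |t₂ - t₁| ≤ Real.exp K * |Δ| + D / |b| ^ n := fun n => by
    obtain ⟨z, hz⟩ := hL.exists_abs_exp_mul_sub_le n x t₁ t₂
    have h2 : Real.exp (birkhoff A H φ n z - n * Real.log |b|) ≤ Real.exp K :=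
      Real.exp_le_exp.2 (abs_le.1 (hK n z)).2
    have h3 := abs_sub_abs_le_abs_sub (a * (t₂ - t₁))
      (Real.exp (birkhoff A H φ n z - n * Real.log |b|) * Δ)
    rw [abs_sub_comm, abs_mul, abs_mul, Real.abs_exp, abs_of_pos hL.pos] at h3
    have h4 := mul_le_mul_of_nonneg_right h2 (abs_nonneg Δ)
    linarith
  have h2 : a * |t₂ - t₁| ≤ Real.exp K * |Δ| := by
    refine ge_of_tendsto (x := Filter.atTop) ?_ (Filter.Eventually.of_forall h1)
    simpa using hL.tendsto_div_pow.const_add (Real.exp K * |Δ|)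
  calc Real.exp (-K) * a * |t₂ - t₁| = Real.exp (-K) * (a * |t₂ - t₁|) := by ring
    _ ≤ Real.exp (-K) * (Real.exp K * |Δ|) := mul_le_mul_of_nonneg_left h2 (Real.exp_pos _).le
    _ = |Δ| := by rw [← mul_assoc, ← Real.exp_add]; simp

lemma norm_sub_le (hL : IsLeafMap A H W π φ u b a D)
    (hK : ∀ n x, |birkhoff A H φ n x - n * Real.log (|b|)| ≤ K) (hM : ∀ x, ‖W x‖ ≤ M) (x : RSpace d) (t₁ t₂ : ℝ) :
    ‖H (x + t₂ • u) - H (x + t₁ • u)‖ ≤ M * (Real.exp K * a) * |t₂ - t₁| := by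
  obtain ⟨Γ, hΓ, hΓd⟩ := hL.param x
  have hM0 : 0 ≤ M := (norm_nonneg _).trans (hM 0)
  rw [hΓ t₁, hΓ t₂, mul_assoc]
  refine (Convex.norm_image_sub_le_of_norm_hasDerivWithin_le (s := Set.univ) (C := M)
    (fun r _ => (hΓd r).hasDerivWithinAt) (fun r _ => hM _) convex_univ trivial trivial).trans ?_
  exact mul_le_mul_of_nonneg_left (hL.abs_coord_sub_le hK x t₁ t₂) hM0

/-- Distortion of Birkhoff sums along the lines. -/
lemma exists_birkhoff_sub_le (hL : IsLeafMap A H W π φ u b a D)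
    (hu : linLift A u = b • u) (hθ : 0 < θ) (hL0 : 0 ≤ L)
    (hφ : ∀ x y, |φ x - φ y| ≤ L * ‖x - y‖ ^ θ) {C : ℝ}
    (hC : ∀ x t₁ t₂, ‖H (x + t₂ • u) - H (x + t₁ • u)‖ ≤ C * |t₂ - t₁|) :
    ∃ C', 0 ≤ C' ∧ ∀ (n : ℕ) x t₁ t₂,
      |birkhoff A H φ n (x + t₂ • u) - birkhoff A H φ n (x + t₁ • u)|
        ≤ C' * (|b| ^ n * |t₂ - t₁|) ^ θ := by
  have hb : 0 < |b| := by linarith [hL.one_lt]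
  have hC0 : 0 ≤ C := by simpa using (norm_nonneg _).trans (hC 0 0 1)
  set ρ := |b| ^ θ with hρ
  have hρ1 : 1 < ρ := Real.one_lt_rpow hL.one_lt hθ
  refine ⟨L * C ^ θ / (ρ - 1), div_nonneg (by positivity) (by linarith), fun n x t₁ t₂ => ?_⟩
  rw [birkhoff, birkhoff, ← Finset.sum_sub_distrib]
  refine (Finset.abs_sum_le_sum_abs _ _).trans ?_
  have hterm : ∀ k ∈ Finset.range n, |φ (H ((linLift A)^[k] (x + t₂ • u)))
      - φ (H ((linLift A)^[k] (x + t₁ • u)))| ≤ L * C ^ θ * |t₂ - t₁| ^ θ * ρ ^ k := fun k _ => by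
    refine (hφ _ _).trans ?_
    rw [linLift_iterate_add_smul hu, linLift_iterate_add_smul hu]
    have h1 := hC ((linLift A)^[k] x) (b ^ k * t₁) (b ^ k * t₂)
    rw [← mul_sub, abs_mul, abs_pow] at h1
    have h2 := Real.rpow_le_rpow (norm_nonneg _) h1 hθ.le
    rw [Real.mul_rpow hC0 (by positivity), Real.mul_rpow (by positivity) (abs_nonneg _)] at h2
    have h3 : (|b| ^ k) ^ θ = ρ ^ k := by
      rw [hρ, ← Real.rpow_natCast, ← Real.rpow_mul hb.le, ← Real.rpow_natCast, ← Real.rpow_mul hb.le,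
        mul_comm]
    rw [h3] at h2
    calc _ ≤ L * (C ^ θ * (ρ ^ k * |t₂ - t₁| ^ θ)) := mul_le_mul_of_nonneg_left h2 hL0
      _ = _ := by ring
  refine (Finset.sum_le_sum hterm).trans ?_
  rw [← Finset.mul_sum, geom_sum_eq hρ1.ne']
  have h4 : (|b| ^ n * |t₂ - t₁|) ^ θ = ρ ^ n * |t₂ - t₁| ^ θ := by
    rw [Real.mul_rpow (by positivity) (abs_nonneg _), hρ, ← Real.rpow_natCast,
      ← Real.rpow_mul hb.le, ← Real.rpow_natCast, ← Real.rpow_mul hb.le, mul_comm (n : ℝ)]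
  rw [h4]
  have h5 : 0 < ρ - 1 := by linarith
  have h6 : L * C ^ θ / (ρ - 1) * (ρ ^ n * |t₂ - t₁| ^ θ)
      - L * C ^ θ * |t₂ - t₁| ^ θ * ((ρ ^ n - 1) / (ρ - 1))
      = L * C ^ θ * |t₂ - t₁| ^ θ / (ρ - 1) := by field_simp; ring
  have h7 : 0 ≤ L * C ^ θ * |t₂ - t₁| ^ θ / (ρ - 1) := by positivity
  linarith

lemma leafQuotient_pos (hL : IsLeafMap A H W π φ u b a D) (x : RSpace d) {s : ℝ} (hs : s ≠ 0) : 0 < leafQuotient H π u x s := by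
  have h0 : π (H x) = π (H (x + (0 : ℝ) • u)) := by simp
  rw [leafQuotient, h0]
  rcases lt_or_gt_of_ne hs with h | h
  · exact div_pos_of_neg_of_neg (sub_neg.2 (hL.strictMono x h)) h
  · exact div_pos (sub_pos.2 (hL.strictMono x h)) h

/-- Changing scale through the dynamics multiplies a difference quotient by a factor that, up to
distortion, depends on the base point and on `n` but not on the step `t`. Comparing two steps
cancels it. -/
lemma abs_log_leafQuotient_sub_le (hL : IsLeafMap A H W π φ u b a D) {C' : ℝ} (hC'0 : 0 ≤ C') (hθ : 0 < θ)
    (hC' : ∀ (n : ℕ) x t₁ t₂, |birkhoff A H φ n (x + t₂ • u) - birkhoff A H φ n (x + t₁ • u)|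
      ≤ C' * (|b| ^ n * |t₂ - t₁|) ^ θ) (n : ℕ) (x : RSpace d) {t : ℝ} (ht : t ≠ 0) :
    |Real.log (leafQuotient H π u ((linLift A)^[n] x) (b ^ n * t))
      - Real.log (leafQuotient H π u x t) - (birkhoff A H φ n x - n * Real.log |b|)|
      ≤ C' * (|b| ^ n * |t|) ^ θ := by
  have hb : b ≠ 0 := abs_pos.1 (by linarith [hL.one_lt])
  obtain ⟨s, hs, he⟩ := hL.expand n x 0 t
  have h1 : leafQuotient H π u ((linLift A)^[n] x) (b ^ n * t)
      = Real.exp (birkhoff A H φ n (x + s • u) - n * Real.log |b|) * leafQuotient H π u x t := by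
    simp only [mul_zero, zero_smul, add_zero] at he
    rw [leafQuotient, he, leafQuotient]
    field_simp
  rw [h1, Real.log_mul (Real.exp_ne_zero _) (hL.leafQuotient_pos x ht).ne', Real.log_exp]
  have h2 := hC' n x 0 s
  rw [zero_smul, add_zero, sub_zero] at h2
  have h3 : |s| ≤ |t| := by
    have := Set.abs_sub_left_of_mem_uIcc hs
    simpa using this
  calc _ = |birkhoff A H φ n (x + s • u) - birkhoff A H φ n x| := by congr 1; ring
    _ ≤ C' * (|b| ^ n * |s|) ^ θ := h2
    _ ≤ _ := by gcongr

end IsLeafMap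

lemma continuous_leafQuotient (hH : Continuous H) (s : ℝ) :
    Continuous fun x => leafQuotient H π u x s :=
  ((π.continuous.comp (hH.comp (by fun_prop))).sub (π.continuous.comp hH)).div_const s

lemma leafQuotient_add_latticeVec (hH : IsConjugacyLift A F H B) (x : RSpace d) (s : ℝ)
    (k : Fin d → ℤ) : leafQuotient H π u (x + latticeVec k) s = leafQuotient H π u x s := by
  rw [leafQuotient, leafQuotient, add_right_comm, hH.translate, hH.translate, map_add, map_add,
    add_sub_add_right_eq_sub]

/-- The base point moves too, at the same scale `ε n` as the step. Differentiability at `x`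
suffices, as both ends of the secant are compared with `x`. -/
lemma tendsto_leafQuotient {x : RSpace d} {y' : ℝ}
    (hy : HasDerivAt (fun t : ℝ => π (H (x + t • u))) y' 0) (r : ℝ) {s : ℝ} (hs : s ≠ 0) {ε : ℕ → ℝ}
    (hε : Filter.Tendsto ε Filter.atTop (nhds 0)) (hε0 : ∀ n, ε n ≠ 0) :
    Filter.Tendsto (fun n => leafQuotient H π u (x + (ε n * r) • u) (ε n * s)) Filter.atTop
      (nhds y') := by
  have hc : ∀ p : ℝ, HasDerivAt (fun e : ℝ => π (H (x + (e * p) • u))) (y' * p) 0 := fun p => by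
    have h1 : HasDerivAt (fun e : ℝ => e * p) p 0 := by simpa using (hasDerivAt_id (0 : ℝ)).mul_const p
    have h2 : HasDerivAt (fun t : ℝ => π (H (x + t • u))) y' ((0 : ℝ) * p) := by rwa [zero_mul]
    exact h2.comp 0 h1
  have h1 := (hc (r + s)).sub (hc r)
  rw [hasDerivAt_iff_tendsto_slope_zero] at h1
  have h2 : Filter.Tendsto ε Filter.atTop (nhdsWithin 0 {0}ᶜ) :=
    tendsto_nhdsWithin_iff.2 ⟨hε, Filter.Eventually.of_forall hε0⟩
  have h3 := (h1.comp h2).div_const s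
  have h4 : (y' * (r + s) - y' * r) / s = y' := by field_simp; ring
  rw [h4] at h3
  refine h3.congr fun n => ?_
  simp only [Function.comp, Pi.sub_apply, zero_add, zero_mul, zero_smul, add_zero, sub_self, sub_zero,
    smul_eq_mul, leafQuotient]
  have h5 : x + (ε n * r) • u + (ε n * s) • u = x + (ε n * (r + s)) • u := by
    rw [mul_add, add_smul, add_assoc]
  rw [h5, div_mul_eq_div_div, div_eq_inv_mul _ (ε n)]

/-- Bounded distortion of `H` along the lines of direction `u`. -/
theorem IsLeafMap.abs_log_leafQuotient_sub_log_le (hL : IsLeafMap A H W π φ u b a D)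
    (hH : IsConjugacyLift A F H B) (hu : linLift A u = b • u)
    (hdense : DenseRange fun t : ℝ => torusProj (t • u))
    (hK : ∀ n x, |birkhoff A H φ n x - n * Real.log (|b|)| ≤ K) (hθ : 0 < θ) {C : ℝ} (hC0 : 0 ≤ C)
    (hC : ∀ (n : ℕ) x t₁ t₂, |birkhoff A H φ n (x + t₂ • u) - birkhoff A H φ n (x + t₁ • u)|
      ≤ C * (|b| ^ n * |t₂ - t₁|) ^ θ) (x : RSpace d) {s s' : ℝ} (hs : s ≠ 0) (hs' : s' ≠ 0) :
    |Real.log (leafQuotient H π u x s) - Real.log (leafQuotient H π u x s')|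
      ≤ C * |s| ^ θ + C * |s'| ^ θ := by
  have hb : b ≠ 0 := abs_pos.1 (by linarith [hL.one_lt])
  -- Lebesgue's theorem on monotone functions provides one point of differentiability, which is
  -- enough.
  obtain ⟨t₀, ht₀⟩ := (hL.strictMono 0).monotone.ae_differentiableAt.exists
  set x₀ : RSpace d := 0 + t₀ • u with hx₀
  obtain ⟨y', hy'⟩ : ∃ y', HasDerivAt (fun t : ℝ => π (H (x₀ + t • u))) y' 0 := by
    obtain ⟨y', hy'⟩ : ∃ y', HasDerivAt (fun t : ℝ => π (H (0 + t • u))) y' t₀ :=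
      ⟨_, ht₀.hasDerivAt⟩
    have h1 : HasDerivAt (fun t : ℝ => π (H (0 + t • u))) y' (0 + t₀) := by rwa [zero_add]
    refine ⟨_, (h1.comp_add_const 0 t₀).congr_of_eventuallyEq
      (Filter.Eventually.of_forall fun t => ?_)⟩
    dsimp only
    rw [hx₀, add_smul, add_assoc, add_comm (t • u)]
  have hε : Filter.Tendsto (fun n : ℕ => b⁻¹ ^ n) Filter.atTop (nhds 0) :=
    tendsto_pow_atTop_nhds_zero_of_abs_lt_one (by
      rw [abs_inv]; exact inv_lt_one_of_one_lt₀ hL.one_lt)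
  have hε0 : ∀ n : ℕ, b⁻¹ ^ n ≠ 0 := fun n => pow_ne_zero _ (inv_ne_zero hb)
  have hbb : ∀ n : ℕ, b ^ n * b⁻¹ ^ n = 1 := fun n => by
    rw [← mul_pow, mul_inv_cancel₀ hb, one_pow]
  have hlim := fun (r : ℝ) {s : ℝ} (hs : s ≠ 0) => tendsto_leafQuotient (u := u) hy' r hs hε hε0
  have hy'0 : 0 < y' := by
    refine (mul_pos (Real.exp_pos (-K)) hL.pos).trans_le
      (ge_of_tendsto (hlim 0 one_ne_zero) (Filter.Eventually.of_forall fun n => ?_))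
    have h1 := hL.leafQuotient_pos (x₀ + (b⁻¹ ^ n * 0) • u) (s := b⁻¹ ^ n * 1) (by simp [hb])
    have h2 := hL.le_abs_coord_sub hK (x₀ + (b⁻¹ ^ n * 0) • u) 0 (b⁻¹ ^ n * 1)
    rw [← abs_of_pos h1, leafQuotient, abs_div, le_div_iff₀ (abs_pos.2 (by simp [hb]))]
    simpa using h2
  choose l hl using fun n : ℕ => exists_latticeVec_bounded ((linLift A)^[n] x₀)
  -- The forward orbit of `x₀` accumulates, modulo the lattice, at `z`. Near `x₀` the quotients at
  -- scale `b⁻¹ ^ n` become equal, and the dynamics transports this to unit scale near `z`.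
  obtain ⟨z, -, ψ, hψ, hz⟩ := (isCompact_unitCube (d := d)).tendsto_subseq
    (x := fun n => (linLift A)^[n] x₀ + latticeVec (l n)) hl
  set Z : Set (RSpace d) := {x | ∀ s s' : ℝ, s ≠ 0 → s' ≠ 0 →
    |Real.log (leafQuotient H π u x s) - Real.log (leafQuotient H π u x s')|
      ≤ C * |s| ^ θ + C * |s'| ^ θ} with hZ
  have hlogc : ∀ s : ℝ, s ≠ 0 → Continuous fun x => Real.log (leafQuotient H π u x s) := fun s hs =>
    (continuous_leafQuotient hH.continuous s).log fun x => (hL.leafQuotient_pos x hs).ne'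
  suffices hmem : x ∈ Z from hmem s s' hs hs'
  -- The estimate is a closed, periodic condition on the base point, so it is enough to have it on
  -- one dense line.
  refine mem_of_isClosed_of_periodic hdense ?_ ?_ (z := z) ?_ x
  · have : Z = ⋂ (s : ℝ) (s' : ℝ) (_ : s ≠ 0) (_ : s' ≠ 0), {x |
        |Real.log (leafQuotient H π u x s) - Real.log (leafQuotient H π u x s')|
          ≤ C * |s| ^ θ + C * |s'| ^ θ} := by
      ext x; simp [hZ]
    rw [this]
    exact isClosed_iInter fun s => isClosed_iInter fun s' => isClosed_iInter fun hs =>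
      isClosed_iInter fun hs' =>
        isClosed_le ((hlogc s hs).sub (hlogc s' hs')).abs continuous_const
  · intro x hx k s s' hs hs'
    rw [leafQuotient_add_latticeVec hH, leafQuotient_add_latticeVec hH]
    exact hx s s' hs hs'
  · intro r s s' hs hs'
    have hcmp : ∀ (n : ℕ) {s : ℝ}, s ≠ 0 →
        |Real.log (leafQuotient H π u ((linLift A)^[n] x₀ + latticeVec (l n) + r • u) s)
          - Real.log (leafQuotient H π u (x₀ + (b⁻¹ ^ n * r) • u) (b⁻¹ ^ n * s))
          - (birkhoff A H φ n (x₀ + (b⁻¹ ^ n * r) • u) - n * Real.log |b|)| ≤ C * |s| ^ θ := by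
      intro n s hs
      have h1 := hL.abs_log_leafQuotient_sub_le hC0 hθ hC n (x₀ + (b⁻¹ ^ n * r) • u)
        (mul_ne_zero (hε0 n) hs)
      rw [linLift_iterate_add_smul hu, ← mul_assoc, ← mul_assoc, hbb, one_mul, one_mul, ← abs_pow,
        ← abs_mul, ← mul_assoc, hbb, one_mul] at h1
      rwa [add_right_comm, leafQuotient_add_latticeVec hH]
    have hx : Filter.Tendsto (fun n => (linLift A)^[ψ n] x₀ + latticeVec (l (ψ n)) + r • u)
        Filter.atTop (nhds (z + r • u)) := hz.add_const _
    -- Points `r • u` off `z` correspond to points `b⁻¹ ^ n * r` off `x₀`, so the blow-up controls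
    -- the whole line at once.
    have hleft := fun {s : ℝ} (hs : s ≠ 0) => ((hlogc s hs).tendsto _).comp hx
    have hright := fun {s : ℝ} (hs : s ≠ 0) =>
      ((Real.continuousAt_log hy'0.ne').tendsto.comp (hlim r hs)).comp hψ.tendsto_atTop
    have hR := (((hright hs).sub (hright hs')).abs).const_add (C * |s| ^ θ + C * |s'| ^ θ)
    rw [sub_self, abs_zero, add_zero] at hR
    refine le_of_tendsto_of_tendsto ((hleft hs).sub (hleft hs')).abs hR
      (Filter.Eventually.of_forall fun n => ?_)
    simp only [Function.comp]
    have h1 := hcmp (ψ n) hs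
    have h2 := hcmp (ψ n) hs'
    rw [abs_le] at h1 h2
    rw [abs_le]
    have h3 := neg_abs_le
      (Real.log (leafQuotient H π u (x₀ + (b⁻¹ ^ ψ n * r) • u) (b⁻¹ ^ ψ n * s))
        - Real.log (leafQuotient H π u (x₀ + (b⁻¹ ^ ψ n * r) • u) (b⁻¹ ^ ψ n * s')))
    have h4 := le_abs_self
      (Real.log (leafQuotient H π u (x₀ + (b⁻¹ ^ ψ n * r) • u) (b⁻¹ ^ ψ n * s))
        - Real.log (leafQuotient H π u (x₀ + (b⁻¹ ^ ψ n * r) • u) (b⁻¹ ^ ψ n * s')))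
    constructor <;> linarith [h1.1, h1.2, h2.1, h2.2]

end Rigidity

/-! ### Differentiability along the leaves -/

section LeafDerivative

variable {d : ℕ} {A : Matrix (Fin d) (Fin d) ℤ} {F H W : RSpace d → RSpace d}
  {B : RSpace d →L[ℝ] RSpace d} {π : RSpace d →L[ℝ] ℝ} {φ : RSpace d → ℝ} {u : RSpace d}
  {b a D K θ M : ℝ}

lemma abs_exp_sub_exp_le {x y C : ℝ} (hx : x ≤ C) (hy : y ≤ C) :
    |Real.exp x - Real.exp y| ≤ Real.exp C * |x - y| := by
  refine Convex.norm_image_sub_le_of_norm_hasDerivWithin_le (s := Set.Iic C) (f := Real.exp)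
    (f' := Real.exp) (fun z _ => (Real.hasDerivAt_exp z).hasDerivWithinAt) (fun z hz => ?_)
    (convex_Iic C) hy hx
  rw [Real.norm_eq_abs, Real.abs_exp]
  exact Real.exp_le_exp.2 hz

lemma leafQuotient_neg (x : RSpace d) (s : ℝ) :
    leafQuotient H π u (x + s • u) (-s) = leafQuotient H π u x s := by
  rw [leafQuotient, leafQuotient, add_assoc, ← add_smul, add_neg_cancel, zero_smul, add_zero,
    div_neg, ← neg_div, neg_sub]

/-- `H` is differentiable along the lines of direction `u`, with Hölder derivative. -/
theorem IsLeafMap.exists_hasDerivAt (hL : IsLeafMap A H W π φ u b a D)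
    (hK : ∀ n x, |birkhoff A H φ n x - n * Real.log (|b|)| ≤ K) (hθ : 0 < θ)
    (hM : ∀ x, ‖W x‖ ≤ M) (hW0 : ∀ x, W x ≠ 0) {N : ℝ} (hN : 0 ≤ N)
    (hW : ∀ x y, ‖W x - W y‖ ≤ N * ‖x - y‖ ^ θ) {C : ℝ}
    (hC : ∀ x, ∀ s s' : ℝ, s ≠ 0 → s' ≠ 0 →
      |Real.log (leafQuotient H π u x s) - Real.log (leafQuotient H π u x s')|
        ≤ C * |s| ^ θ + C * |s'| ^ θ) :
    ∃ C' : ℝ, ∀ x, ∃ γ' : ℝ → RSpace d, (∀ t : ℝ, HasDerivAt (fun t : ℝ => H (x + t • u)) (γ' t) t) ∧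
      (∀ t, γ' t ≠ 0) ∧ ∀ s t, ‖γ' s - γ' t‖ ≤ C' * |s - t| ^ θ := by
  -- The oscillation bound says that the intervals of radius `C * |s| ^ θ` around the logarithmic
  -- quotients meet pairwise; a common point is the logarithm of the derivative.
  have hlim : ∀ x, ∃ ℓ : ℝ, ∀ s : ℝ, s ≠ 0 →
      |Real.log (leafQuotient H π u x s) - ℓ| ≤ C * |s| ^ θ := fun x => by
    obtain ⟨ℓ, hℓ₁, hℓ₂⟩ := exists_between_of_forall_le
      (s := (fun s : ℝ => Real.log (leafQuotient H π u x s) - C * |s| ^ θ) '' {0}ᶜ)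
      (t := (fun s : ℝ => Real.log (leafQuotient H π u x s) + C * |s| ^ θ) '' {0}ᶜ)
      ⟨_, 1, one_ne_zero, rfl⟩ ⟨_, 1, one_ne_zero, rfl⟩ (by
        rintro _ ⟨s, hs, rfl⟩ _ ⟨s', hs', rfl⟩
        have := (abs_le.1 (hC x s s' hs hs')).2
        dsimp only
        linarith)
    refine ⟨ℓ, fun s hs => abs_le.2 ⟨?_, ?_⟩⟩
    · have := hℓ₂ ⟨s, hs, rfl⟩
      dsimp only at this
      linarith
    · have := hℓ₁ ⟨s, hs, rfl⟩
      dsimp only at this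
      linarith
  choose ℓ hℓ using hlim
  have hpow : Filter.Tendsto (fun s : ℝ => C * |s| ^ θ) (nhdsWithin 0 {0}ᶜ) (nhds 0) := by
    have h1 : Continuous fun s : ℝ => C * |s| ^ θ :=
      continuous_const.mul (continuous_abs.rpow_const fun _ => Or.inr hθ.le)
    have h2 := h1.tendsto 0
    rw [abs_zero, Real.zero_rpow hθ.ne', mul_zero] at h2
    exact h2.mono_left nhdsWithin_le_nhds
  have htend : ∀ x, Filter.Tendsto (leafQuotient H π u x) (nhdsWithin 0 {0}ᶜ)
      (nhds (Real.exp (ℓ x))) := fun x => by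
    have h1 : Filter.Tendsto (fun s => Real.log (leafQuotient H π u x s)) (nhdsWithin 0 {0}ᶜ)
        (nhds (ℓ x)) := by
      rw [tendsto_iff_norm_sub_tendsto_zero]
      refine squeeze_zero' (Filter.Eventually.of_forall fun _ => norm_nonneg _) ?_ hpow
      filter_upwards [self_mem_nhdsWithin] with s hs
      exact hℓ x s hs
    refine ((Real.continuous_exp.tendsto _).comp h1).congr' ?_
    filter_upwards [self_mem_nhdsWithin] with s hs
    exact Real.exp_log (hL.leafQuotient_pos x hs)
  have hderiv : ∀ x (t : ℝ), HasDerivAt (fun t : ℝ => π (H (x + t • u)))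
      (Real.exp (ℓ (x + t • u))) t := fun x t => by
    rw [hasDerivAt_iff_tendsto_slope_zero]
    refine (htend (x + t • u)).congr fun s => ?_
    rw [leafQuotient, add_smul, ← add_assoc, smul_eq_mul, div_eq_inv_mul]
  have hℓK : ∀ x, Real.exp (ℓ x) ≤ Real.exp K * a := fun x => by
    refine le_of_tendsto (htend x) ?_
    filter_upwards [self_mem_nhdsWithin] with s hs
    have h1 := hL.abs_coord_sub_le hK x 0 s
    rw [zero_smul, add_zero, sub_zero] at h1
    rw [← abs_of_pos (hL.leafQuotient_pos x hs), leafQuotient, abs_div, div_le_iff₀ (abs_pos.2 hs)]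
    exact h1
  have ha := hL.pos
  have hKa : 0 < Real.exp K * a := by positivity
  have hℓK' : ∀ x, ℓ x ≤ Real.log (Real.exp K * a) := fun x =>
    (Real.le_log_iff_exp_le hKa).2 (hℓK x)
  -- One difference quotient is seen from both of its endpoints, and each logarithmic derivative is
  -- within `C * |s| ^ θ` of its logarithm.
  have hℓH : ∀ x (s : ℝ), |ℓ (x + s • u) - ℓ x| ≤ 2 * C * |s| ^ θ := fun x s => by
    rcases eq_or_ne s 0 with rfl | hs
    · simp [Real.zero_rpow hθ.ne']
    have h1 := hℓ x s hs
    have h2 := hℓ (x + s • u) (-s) (neg_ne_zero.2 hs)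
    rw [leafQuotient_neg, abs_neg] at h2
    rw [abs_le] at h1 h2 ⊢
    constructor <;> linarith [h1.1, h1.2, h2.1, h2.2]
  have hM0 : 0 ≤ M := (norm_nonneg _).trans (hM 0)
  set P := M * (Real.exp K * a) with hP
  have hP0 : 0 ≤ P := by positivity
  refine ⟨Real.exp K * a * (2 * C) * M + Real.exp K * a * (N * P ^ θ), fun x =>
    ⟨fun t => Real.exp (ℓ (x + t • u)) • W (H (x + t • u)), fun t => ?_,
      fun t => smul_ne_zero (Real.exp_ne_zero _) (hW0 _), fun s t => ?_⟩⟩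
  -- Only one coordinate of `H` has been differentiated; the others follow through the `C¹`
  -- parametrization of the leaf.
  · obtain ⟨Γ, hΓ, hΓd⟩ := hL.param x
    have h1 := (hΓd (π (H (x + t • u)))).scomp t (hderiv x t)
    rw [← hΓ] at h1
    exact h1.congr_of_eventuallyEq (Filter.Eventually.of_forall hΓ)
  · have hst : x + s • u = x + t • u + (s - t) • u := by rw [sub_smul]; abel
    have h1 : |Real.exp (ℓ (x + s • u)) - Real.exp (ℓ (x + t • u))|
        ≤ Real.exp K * a * (2 * C * |s - t| ^ θ) := by
      have h2 := abs_exp_sub_exp_le (hℓK' (x + s • u)) (hℓK' (x + t • u))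
      rw [Real.exp_log hKa] at h2
      refine h2.trans (mul_le_mul_of_nonneg_left ?_ hKa.le)
      rw [hst]
      exact hℓH _ _
    have h3 : ‖W (H (x + s • u)) - W (H (x + t • u))‖ ≤ N * (P ^ θ * |s - t| ^ θ) := by
      refine (hW _ _).trans (mul_le_mul_of_nonneg_left ?_ hN)
      rw [← Real.mul_rpow hP0 (abs_nonneg _)]
      exact Real.rpow_le_rpow (norm_nonneg _) (hL.norm_sub_le hK hM x t s) hθ.le
    have h4 : Real.exp (ℓ (x + s • u)) • W (H (x + s • u))
        - Real.exp (ℓ (x + t • u)) • W (H (x + t • u))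
        = (Real.exp (ℓ (x + s • u)) - Real.exp (ℓ (x + t • u))) • W (H (x + s • u))
          + Real.exp (ℓ (x + t • u)) • (W (H (x + s • u)) - W (H (x + t • u))) := by
      rw [sub_smul, smul_sub]; abel
    rw [h4]
    refine (norm_add_le _ _).trans ?_
    rw [norm_smul, norm_smul, Real.norm_eq_abs, Real.norm_eq_abs, Real.abs_exp]
    have h5 := mul_le_mul h1 (hM (H (x + s • u))) (norm_nonneg _) ((abs_nonneg _).trans h1)
    have h6 := mul_le_mul (hℓK (x + t • u)) h3 (norm_nonneg _) hKa.le
    calc _ ≤ _ := add_le_add h5 h6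
      _ = _ := by ring

end LeafDerivative

/-! ### Choice of constants and conclusion -/

section Main

variable {d : ℕ}

/-- With all moduli at distance at least `r` from `1`, the rate `1 + r / 2` leaves room for a
perturbation of size `r / 4` on both sides. -/
lemma exists_hyperbolicGap {β : Fin d → ℝ} (hβ : ∀ i, |β i| ≠ 1) :
    ∃ κ₀ μ : ℝ, 0 < κ₀ ∧ ∀ κ ≤ κ₀, IsHyperbolicGap β κ μ := by
  have hev : ∀ᶠ r in nhdsWithin (0 : ℝ) (Set.Ioi 0), ∀ i, r ≤ |(|β i|) - 1| :=
    Filter.eventually_all.2 fun i => by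
      filter_upwards [Ioc_mem_nhdsGT (abs_pos.2 (sub_ne_zero.2 (hβ i)))] with r hr using hr.2
  obtain ⟨r, hr, hr0⟩ := (hev.and self_mem_nhdsWithin).exists
  have hr0 : 0 < r := hr0
  refine ⟨r / 4, 1 + r / 2, by linarith, fun κ hκ => ⟨by linarith, hβ, fun i hi => ?_,
    fun i hi => ?_⟩⟩
  · have := hr i
    rw [abs_of_pos (by linarith)] at this
    linarith
  · have := hr i
    rw [abs_of_neg (by linarith)] at this
    rw [← one_div, le_div_iff₀ (by linarith)]
    nlinarith [abs_nonneg (β i)]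

variable {β : Fin d → ℝ} {v : Module.Basis (Fin d) ℝ (RSpace d)} {κ η θ q μ : ℝ}
  {A : Matrix (Fin d) (Fin d) ℤ} {W : Fin d → RSpace d → RSpace d}
  {c : Fin d → RSpace d → ℝ} {B : RSpace d →L[ℝ] RSpace d}

/-- The conjugacy is `C^{1+θ}` along an unstable line field if the Birkhoff sums of the
logarithmic multiplier are uniformly close to those of a constant. -/
theorem isC1HolderAlong_of_birkhoff_bounded {F H : RSpace d → RSpace d}
    (hfr : IsInvariantFrame β v κ η θ F W c)
    (G : SpectralGap β κ η q) (G' : IsHyperbolicGap β κ μ) (hθ : 0 < θ) (hF : Differentiable ℝ F)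
    (hper : ∀ x k, F (x + latticeVec k) = F x + linLift A (latticeVec k))
    (hH : IsConjugacyLift A F H B) {h : Torus d ≃ₜ Torus d}
    (hHh : ∀ x, torusProj (H x) = h (torusProj x)) (hdet : IsUnit A.det)
    (hirr : Irreducible (A.map (Int.cast : ℤ → ℚ)).charpoly) {m : Fin d} (hm : 1 < |β m|)
    (hv : linLift A (v m) = β m • v m) {E : Torus d → Submodule ℝ (RSpace d)}
    (hE : ∀ x, E (torusProj x) = Submodule.span ℝ {W m x})
    (hleaf : ∀ p, h '' tangentLeaf (fun _ => Submodule.span ℝ {v m}) p = tangentLeaf E (h p))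
    {lam K : ℝ} (hK : ∀ n x, |birkhoff A H (fun z => Real.log |c m z|) n x - n * lam| ≤ K) :
    IsC1HolderAlong θ h (v m) := by
  have hvm := v.ne_zero m
  have hcurve := fun {ε : ℝ} (hε : ε ≠ 0) =>
    exists_tangentCurve hfr hH hHh hdet hm hv hE hleaf hε
  have heig : ∀ ε : ℝ, linLift A (ε • v m) = β m • (ε • v m) := fun ε => by
    rw [map_smul, hv, smul_comm]
  have hinj := fun {ε : ℝ} (hε : ε ≠ 0) =>
    injective_along_line hHh hdet hm (heig ε) (smul_ne_zero hε hvm)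
  -- The direction is flipped if the conjugacy reverses it; the sign is undone at the end by `ε * ε
  -- = 1`.
  obtain ⟨ε, hε, ha⟩ : ∃ ε : ℝ, |ε| = 1 ∧ 0 < coordCLM v m (B (ε • v m)) := by
    have h1 := coord_linearPart_ne_zero hfr G G' hF hH hper hm (heig 1) (hinj one_ne_zero)
      (hcurve one_ne_zero)
    rcases lt_or_gt_of_ne h1 with h2 | h2
    · refine ⟨-1, by simp, ?_⟩
      rw [one_smul] at h2
      rw [neg_one_smul, map_neg, map_neg]
      linarith
    · exact ⟨1, by simp, h2⟩
  have hε0 : ε ≠ 0 := fun h0 => by simp [h0] at hε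
  have hu0 : ε • v m ≠ 0 := smul_ne_zero hε0 hvm
  obtain ⟨D, hL⟩ := exists_isLeafMap hfr G G' hθ hF hH hper hm (heig ε) (hinj hε0) (hcurve hε0) ha
  rw [hL.log_abs_eq hK] at hK
  obtain ⟨Cv, hCv1, -, hCv⟩ := exists_coordNorm_equiv v
  have hM : ∀ x, ‖W m x‖ ≤ Cv := fun x => (hCv _).trans <| by
    have := hfr.coordNorm_le_one G.η_le_one m x
    nlinarith
  obtain ⟨L, hL0, hlog⟩ := hfr.exists_log_holder G m
  obtain ⟨C, hC0, hC⟩ := hL.exists_birkhoff_sub_le (heig ε) hθ hL0 hlog (hL.norm_sub_le hK hM)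
  have hdense := dense_range_torusProj_smul fun k hk =>
    sum_mul_ne_zero_of_irreducible hirr (heig ε) hu0 hk
  obtain ⟨N, hN, hW⟩ := hfr.holder
  obtain ⟨C', hC'⟩ := hL.exists_hasDerivAt hK hθ hM (hfr.ne_zero m) hN (hW m)
    fun x s s' hs hs' =>
      hL.abs_log_leafQuotient_sub_log_le hH (heig ε) hdense hK hθ hC0 hC x hs hs'
  have hεε : ε * ε = 1 := by rw [← abs_mul_abs_self, hε, one_mul]
  refine ⟨C', fun x => ?_⟩
  obtain ⟨γ', hd, hne, hhol⟩ := hC' x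
  refine ⟨fun t => H (x + t • v m), fun t => ε • γ' (ε * t), fun t => hHh _, fun t => ?_,
    fun t => smul_ne_zero hε0 (hne _), fun s t => ?_⟩
  · have h1 : HasDerivAt (fun t : ℝ => ε * t) ε t := by
      simpa using (hasDerivAt_id t).const_mul ε
    have h2 := (hd (ε * t)).scomp t h1
    refine h2.congr_of_eventuallyEq (Filter.Eventually.of_forall fun t => ?_)
    simp only [Function.comp, smul_smul]
    rw [mul_right_comm, hεε, one_mul]
  · rw [← smul_sub, norm_smul, Real.norm_eq_abs, hε, one_mul]
    have := hhol (ε * s) (ε * t)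
    rwa [← mul_sub, abs_mul, hε, one_mul] at this

end Main

theorem mainTheorem6 {d : ℕ} (hd : 2 ≤ d)
    (A : Matrix (Fin d) (Fin d) ℤ) (hdet : IsUnit A.det)
    (hirr : Irreducible (A.map (Int.cast : ℤ → ℚ)).charpoly)
    (β : Fin d → ℝ) (v : Module.Basis (Fin d) ℝ (RSpace d))
    (hv : ∀ i, linLift A (v i) = β i • v i)
    (hmod : StrictMono fun i => |β i|)
    (hhyp : ∀ i, |β i| ≠ 1) :
    ∃ δ : ℝ, 0 < δ ∧ ∀ α ∈ Set.Ioo (0 : ℝ) 1,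
      ∀ (f : Torus d ≃ₜ Torus d) (F : RSpace d ≃ₜ RSpace d),
        IsTorusLift F f → IsC1Holder α F → IsC1Close δ A F →
        (∃! E : Fin d → Torus d → Submodule ℝ (RSpace d), IsDominatedLineSplitting F E) ∧
        ∀ E : Fin d → Torus d → Submodule ℝ (RSpace d), IsDominatedLineSplitting F E →
          ((∀ x, IsLyapunovRegular F x) ∨ HasConstantPeriodicData f F) →
          ∀ h : Torus d ≃ₜ Torus d, (∀ p, h (toralMap A p) = f (h p)) →
            (∀ m, 1 < |β m| → ∀ p,
              h '' tangentLeaf (fun _ => Submodule.span ℝ {v m}) p = tangentLeaf (E m) (h p)) →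
            ∃ ε ∈ Set.Ioo (0 : ℝ) 1, ∀ m, 1 < |β m| → IsC1HolderAlong ε h (v m) := by
  have hd0 : 0 < d := by omega
  have hd' : (0 : ℝ) < d := Nat.cast_pos.2 hd0
  have hβ : ∀ i, 0 < |β i| := fun i => abs_pos.2 fun h0 => v.ne_zero i <|
    linLift_injective hdet (by rw [hv, h0, zero_smul, map_zero])
  obtain ⟨κ₀, μ, hκ₀, hgap⟩ := exists_hyperbolicGap hhyp
  have hη0 : (0 : ℝ) < 1 / (2 * d) := by positivity
  have hη : 2 * (d : ℝ) * (1 / (2 * d)) ≤ 1 := by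
    rw [mul_one_div_cancel (by positivity)]
  have hη1 : 1 / (2 * (d : ℝ)) ≤ 1 := by
    rw [div_le_one (by positivity)]
    have : (2 : ℝ) ≤ d := by exact_mod_cast hd
    linarith
  obtain ⟨κ, q, hκ, hκκ₀, G⟩ := exists_spectralGap hβ hmod hη0 hη1 hκ₀
  have G' := hgap κ hκκ₀
  obtain ⟨C, hC1, hC, hC'⟩ := exists_coordNorm_equiv v
  have hC0 : 0 < C := by linarith
  have hδκ : C ^ 2 * (κ / C ^ 2) = κ := by field_simp
  -- The factor `C ^ 2` pays for passing from the Euclidean norm to eigencoordinates and back. This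
  -- `δ` depends on `A` and its eigendata only; the Hölder exponent is chosen later and may depend
  -- on `F`.
  refine ⟨κ / C ^ 2, by positivity, fun α hα f F hlift hF hclose => ?_⟩
  have hδ : 0 ≤ κ / C ^ 2 := by positivity
  have hFd : Differentiable ℝ F := hF.1.differentiable one_ne_zero
  obtain ⟨θ, W, c, hθ, hθα, hfr⟩ :=
    exists_invariantFrame hd0 hv G hC hC' hC0.le hδ hδκ hα.1 hlift hF hclose
  have hθ1 : θ < 1 := hθα.trans_lt hα.2
  have hnear := hclose.isNearDiagonal hv hC hC' hC0.le hδ hFd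
  rw [hδκ] at hnear
  have hper := lift_add_latticeVec (A := A) F.continuous hlift fun x => (hclose x).1.le
  obtain ⟨E₀, hE₀, hE₀W⟩ := hfr.exists_splitting G hη hθ hFd
  refine ⟨⟨E₀, hE₀, fun E hE => hE.unique hE₀ hFd⟩, ?_⟩
  intro E hE hrig h hconj hleaf
  obtain rfl := hE.unique hE₀ hFd
  obtain ⟨H, B, hH, hHh⟩ := exists_conjugacyLift hlift hconj
  refine ⟨θ, ⟨hθ, hθ1⟩, fun m hm => ?_⟩
  obtain ⟨L, hL0, hlog⟩ := hfr.exists_log_holder G m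
  -- The two alternative hypotheses enter only here, through the Birkhoff sums over periodic orbits.
  obtain ⟨K, -, hK⟩ := exists_birkhoff_sub_const_le G' hd0 hv hnear hH
    (φ := fun z => Real.log |c m z|) (lam := Real.log |c m (H 0)|) hL0 hθ hθ1.le hlog
    fun n y hn hy => hrig.elim
      (fun hreg => birkhoff_periodic_of_regular hfr G hη hFd G' hd0 hv hnear hθ hθ1.le
        (hfr.exists_log_holder G) hH hlift hreg m hn hy)
      fun hcpd => birkhoff_periodic_of_constantPeriodicData hfr G hη hFd hH hlift hcpd m hn hy
  exact isC1HolderAlong_of_birkhoff_bounded hfr G G' hθ hFd hper hH hHh hdet hirr hm (hv m)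
    (hE₀W m) (hleaf m hm) hK
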